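/- **Notation.** For a field $F$ let $P_F=F[x_n,\dots,x_1]$, let $f(T)\in P_F[T]$ be monic of degree $d$, $R_F=F[y;x_n,\dots,x_1]$, $I=\langle f(y)\rangle$, $S=R_F/I$, and let $Q(S)$ be the total ring of fractions of $S$. An element $\Delta\in P_F$ is a *conductor element* for $S$ if the integral closure of $S$ in $Q(S)$ is contained in $\frac1\Delta S$. Then $C(P_F,\frac1\Delta S)$ denotes the set of elements of $\frac1\Delta S$ that are integral over $P_F$. A *weight function* on $S$ is a map $wt:S\setminus\{0\}\to\mathbf N^n$ with $wt(c)=0$ for $c\in F\setminus\{0\}$, $wt(gh)=wt(g)+wt(h)$, $wt(g+h)\preceq_{lex}\max(wt(g),wt(h))$, and such that $wt(g)=wt(h)$ implies that for a unique $c\in F$ either $g-ch=0$ or $wt(g-ch)\prec_{lex}wt(g)$. $S$ is *of type I* if it has a weight function for which the standard monomials $x^\alpha y^i$ ($i<d$) have pairwise distinct weights (computed from the weights of the variables). The *weight-over-grevlex* ordering on $R_F$ compares weights lexicographically and breaks ties by the exponent of $y$. Polynomials $g_0=\Delta,g_1,\dots,g_J\in R_F$ of $y$-degree less than $d$ are *canonical*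 if $\Delta$ is a conductor element, all $g_j$ are monic, the fractions $g_j/\Delta$ generate $C(P_F,\frac1\Delta S)$ as a $P_F$-module, and no monomial of $g_j$ is of the form $x^\alpha LM(g_{j'})$ with $j'\ne j$. Let $\overline R_F=F[\overline y_J,\dots,\overline y_1;x_n,\dots,x_1]$, with a monomial ordering that compares total degrees in the $\overline y_j$ first (for example a grevlex-over-weight ordering: grevlex on the $\overline y_j$, then weights). The *ideal of induced relations* is the kernel of $\overline R_F\to Q(S)$, $\overline y_j\mapsto g_j/\Delta$, $x_i\mapsto x_i$. A *canonical presentation* consists of a canonical $(g_j)_{0\le j\le J}$ and the minimal reduced Gröbner basis $(\overline b_k)_{1\le k\le K}$ of the ideal of induced relations, such that the standard monomials of the presentation have pairwise distinct induced weights, where $wt(\overline y_j)=wt(LM(g_j))-wt(LM(\Delta))$. For $N\ge 2$ and an integer $c$, $E_N(c)=\alpha/\beta$, where $\gcd(\alpha,\beta)=1$, $\beta>0$, $c\beta\equiv\alpha\pmod N$, with $\alpha^2+\beta^2$ minimal and then $\beta$ minimal (and $\alpha>0$ if both $\alpha$ and $-\alpha$ remain possible). $E_N$ and the Chinese remainder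 map $CRT$ are applied to polynomials coefficientwise. **Theorem 15.** Let $f^{(0)}(T)\in P^{(0)}[T]$, $P^{(0)}=\mathbf Q[x_n,\dots,x_1]$, be monic, with $S^{(0)}=P^{(0)}[y]/\langle f^{(0)}(y)\rangle$ a domain of type I; put $I^{(0)}=\langle f^{(0)}(y)\rangle\subset R^{(0)}=\mathbf Q[y;x_n,\dots,x_1]$ and let $\Delta^{(0)}\in P^{(0)}$ be a monic conductor element for $S^{(0)}$. Let $(q_l)_{l\in L}$ be a nonempty finite family of distinct primes, none of which divides the denominator of a coefficient of $f^{(0)}$ or $\Delta^{(0)}$, and $N=\prod_{l\in L} q_l$. Let $f^{(q_l)},\Delta^{(q_l)}$ be the images of $f^{(0)},\Delta^{(0)}$ modulo $q_l$, and suppose that for every $l$ a canonical presentation $\left((g_j^{(q_l)})_{0\le j\le J},(\overline b_k^{(q_l)})_{1\le k\le K}\right)$ of $C(P^{(q_l)},\frac1{\Delta^{(q_l)}}S^{(q_l)})$ is given (in particular $\Delta^{(q_l)}$ is a conductor element for $S^{(q_l)}$), with $J$, $K$, $LM(g_j^{(q_l)})$ and $LM(\overline b_k^{(q_l)})$ independent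 of $l$. Let $\psi^{(q_l)}(y)\in\overline R^{(q_l)}$ be a polynomial representing $y$. Put $\overline b_k^{(0,N)}=E_N(CRT((\overline b_k^{(q_l)})_l))\in\overline R^{(0,N)}=\mathbf Q[\overline y_J,\dots,\overline y_1;x_n,\dots,x_1]$, $\overline B^{(0,N)}=(\overline b_k^{(0,N)})_k$, $\overline I^{(0,N)}=\langle\overline B^{(0,N)}\rangle$, $\overline S^{(0,N)}=\overline R^{(0,N)}/\overline I^{(0,N)}$, and let $\psi^{(N)}:R^{(0)}\to\overline R^{(0,N)}$ be the $\mathbf Q$-algebra homomorphism with $x_i\mapsto x_i$ and $y\mapsto E_N(CRT((\psi^{(q_l)}(y))_l))$. If $\overline B^{(0,N)}$ is a Gröbner basis of $\overline I^{(0,N)}$ and $\psi^{(N)}(I^{(0)})\subseteq\overline I^{(0,N)}$, then $\overline S^{(0,N)}$ is the integral closure $\overline S^{(0)}$ of $S^{(0)}$: there is an injective $\mathbf Q$-algebra homomorphism $\theta:\overline S^{(0,N)}\to Q(S^{(0)})$ with $\theta(\psi^{(N)}(r))=r$ for all $r\in R^{(0)}$, whose image is $C(P^{(0)},\frac1{\Delta^{(0)}}S^{(0)})$,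 which is the integral closure of $S^{(0)}$ in $Q(S^{(0)})$. Consequently, for every canonical $(g_j^{(0)})_{0\le j\le J_0}$ over $\mathbf Q$, with ideal of induced relations $\overline I^{(0)}$ in $\overline R^{(0)}=\mathbf Q[\overline y_{J_0},\dots,\overline y_1;x_n,\dots,x_1]$, the presentation $\overline S^{(0)}=\overline R^{(0)}/\overline I^{(0)}$ is isomorphic to $\overline S^{(0,N)}$ as a $\mathbf Q$-algebra, by an isomorphism that takes the element representing $r$ to $\psi^{(N)}(r)$ for all $r\in R^{(0)}$. -/

import Mathlib

open MvPolynomial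

/-! Polynomial rings with dependent variables indexed by `κ` and independent variables
`x_0, …, x_{n-1}` are written `MvPolynomial (κ ⊕ Fin n) F`; the Noether normalization is
`P = MvPolynomial (Fin n) F`. -/

noncomputable section

section Input

variable {F : Type} [Field F] {n : ℕ}

/-- The inclusion of `P` in a polynomial ring with further (dependent) variables. -/
def inclP (κ : Type) : MvPolynomial (Fin n) F →ₐ[F] MvPolynomial (κ ⊕ Fin n) F :=
  rename Sum.inr

/-- `f(y)`, an element of `R = F[y; x]`, for `f(T) ∈ P[T]`. -/
def evalY (f : Polynomial (MvPolynomial (Fin n) F)) : MvPolynomial (Unit ⊕ Fin n) F :=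
  f.eval₂ (inclP Unit).toRingHom (X (Sum.inl ()))

/-- The ideal `I = ⟨f(y)⟩` of `R`. -/
def inputIdeal (f : Polynomial (MvPolynomial (Fin n) F)) :
    Ideal (MvPolynomial (Unit ⊕ Fin n) F) :=
  Ideal.span {evalY f}

/-- `S = R / I`. -/
abbrev InputRing (f : Polynomial (MvPolynomial (Fin n) F)) : Type :=
  MvPolynomial (Unit ⊕ Fin n) F ⧸ inputIdeal f

/-- `Q(S)`, the total ring of fractions of `S` (the field of fractions if `S` is a domain). -/
abbrev FracS (f : Polynomial (MvPolynomial (Fin n) F)) : Type := FractionRing (InputRing f)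

/-- The map `R → S → Q(S)`. -/
def toFrac (f : Polynomial (MvPolynomial (Fin n) F)) :
    MvPolynomial (Unit ⊕ Fin n) F →+* FracS f :=
  (algebraMap (InputRing f) (FracS f)).comp (Ideal.Quotient.mk (inputIdeal f))

/-- The map `P → Q(S)`. -/
def toFracP (f : Polynomial (MvPolynomial (Fin n) F)) : MvPolynomial (Fin n) F →+* FracS f :=
  (toFrac f).comp (inclP Unit).toRingHom

/-- `Δ ∈ P` is a conductor element for `S`: the integral closure of `S` in `Q(S)` is contained
in `(1/Δ) S`. -/
def IsConductor (f : Polynomial (MvPolynomial (Fin n) F)) (Δ : MvPolynomial (Fin n) F) : Prop :=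
  ∀ z : FracS f, IsIntegral (InputRing f) z →
    ∃ r : MvPolynomial (Unit ⊕ Fin n) F, toFracP f Δ * z = toFrac f r

/-- `C(P, (1/Δ) S)`: the elements of `(1/Δ) S ⊆ Q(S)` that are integral over `P`. -/
def closureIn (f : Polynomial (MvPolynomial (Fin n) F)) (Δ : MvPolynomial (Fin n) F) :
    Set (FracS f) :=
  {z | (toFracP f).IsIntegralElem z ∧
    ∃ r : MvPolynomial (Unit ⊕ Fin n) F, toFracP f Δ * z = toFrac f r}

/-- A weight function on an `F`-algebra `A`, with values in `ℕ^n` ordered lexicographically.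
(The value at `0` is irrelevant.) -/
structure IsWeightFunction (F : Type) [Field F] {n : ℕ} {A : Type} [CommRing A] [Algebra F A]
    (wt : A → Fin n → ℕ) : Prop where
  const : ∀ c : F, c ≠ 0 → wt (algebraMap F A c) = 0
  mul : ∀ g h : A, g ≠ 0 → h ≠ 0 → wt (g * h) = wt g + wt h
  add_le : ∀ g h : A, g ≠ 0 → h ≠ 0 → g + h ≠ 0 →
    toLex (wt (g + h)) ≤ max (toLex (wt g)) (toLex (wt h))
  eq_weight : ∀ g h : A, g ≠ 0 → h ≠ 0 → wt g = wt h →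
    ∃! c : F, g - c • h = 0 ∨ toLex (wt (g - c • h)) < toLex (wt g)

/-- `S = P[y]/⟨f(y)⟩` is of type I, with weight function `wt`: the weights of the variables are
given by `w`, and the standard monomials `x^α y^i`, `i < deg f`, have pairwise distinct weights. -/
structure IsTypeI (f : Polynomial (MvPolynomial (Fin n) F)) (wt : InputRing f → Fin n → ℕ)
    (w : Unit ⊕ Fin n → Fin n → ℕ) : Prop where
  weight : IsWeightFunction F wt
  wt_var : ∀ i, X i ∉ inputIdeal f → wt (Ideal.Quotient.mk (inputIdeal f) (X i)) = w i
  distinct : ∀ a b : Unit ⊕ Fin n →₀ ℕ, a (Sum.inl ()) < f.natDegree →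
    b (Sum.inl ()) < f.natDegree → Finsupp.weight w a = Finsupp.weight w b → a = b

end Input

section Orders

variable {n : ℕ}

open scoped MonomialOrder

/-- The weight-over-grevlex monomial ordering on `F[y; x]`: compare weights lexicographically,
break ties by the exponent of `y`. -/
def IsWeightOverGrevlex (m : MonomialOrder (Unit ⊕ Fin n)) (w : Unit ⊕ Fin n → Fin n → ℕ) : Prop :=
  ∀ a b : Unit ⊕ Fin n →₀ ℕ,
    (toLex (Finsupp.weight w a) < toLex (Finsupp.weight w b) ∨
      (Finsupp.weight w a = Finsupp.weight w b ∧ a (Sum.inl ()) < b (Sum.inl ()))) → a ≺[m] b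

/-- A monomial ordering on `F[ȳ; x]` that compares total degrees in the dependent variables `ȳ`
first. Every grevlex-over-weight ordering (grevlex on the `ȳ`, then weights) is of this kind. -/
def IsDependentDegreeFirst {J : ℕ} (m : MonomialOrder (Fin J ⊕ Fin n)) : Prop :=
  ∀ a b : Fin J ⊕ Fin n →₀ ℕ, ∑ j, a (Sum.inl j) < ∑ j, b (Sum.inl j) → a ≺[m] b

end Orders

section Groebner

variable {σ F : Type} [Field F]

/-- `b` is a Gröbner basis of the ideal `I`. -/
def IsGroebnerBasis (m : MonomialOrder σ) {K : ℕ} (b : Fin K → MvPolynomial σ F)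
    (I : Ideal (MvPolynomial σ F)) : Prop :=
  Ideal.span (Set.range b) = I ∧
    ∀ h ∈ I, h ≠ 0 → ∃ k, b k ≠ 0 ∧ m.degree (b k) ≤ m.degree h

/-- `b` is a minimal, reduced Gröbner basis (with monic elements) of the ideal `I`. -/
def IsReducedGroebnerBasis (m : MonomialOrder σ) {K : ℕ} (b : Fin K → MvPolynomial σ F)
    (I : Ideal (MvPolynomial σ F)) : Prop :=
  IsGroebnerBasis m b I ∧ (∀ k, m.Monic (b k)) ∧
    ∀ k k', k ≠ k' → ∀ a ∈ (b k).support, ¬ m.degree (b k') ≤ a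

end Groebner

section Output

variable {F : Type} [Field F] {n J K : ℕ}

/-- The ordered set `(g_j : 0 ≤ j ≤ J)` is canonical for `C(P, (1/Δ) S)`. -/
structure IsCanonical (m : MonomialOrder (Unit ⊕ Fin n))
    (f : Polynomial (MvPolynomial (Fin n) F)) (Δ : MvPolynomial (Fin n) F)
    (g : Fin (J + 1) → MvPolynomial (Unit ⊕ Fin n) F) : Prop where
  /-- The `g_j` are normal forms: they represent elements of `S`. -/
  normal : ∀ j, ∀ a ∈ (g j).support, a (Sum.inl ()) < f.natDegree
  monic : ∀ j, m.Monic (g j)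
  zero : g 0 = inclP Unit Δ
  conductor : IsConductor f Δ
  generate : ∀ z : FracS f, z ∈ closureIn f Δ ↔
    ∃ c : Fin (J + 1) → MvPolynomial (Fin n) F,
      toFracP f Δ * z = toFrac f (∑ j, inclP Unit (c j) * g j)
  interreduced : ∀ j j', j ≠ j' → ∀ a ∈ (g j).support, ∀ α : Fin n →₀ ℕ,
    a ≠ m.degree (g j') + α.mapDomain Sum.inr

/-- The map `F[ȳ; x] → Q(S)` sending `ȳ_j` to `g_j / Δ` (for `j = 1, …, J`) and `x_i` to `x_i`. -/
def evalBar (f : Polynomial (MvPolynomial (Fin n) F)) (Δ : MvPolynomial (Fin n) F)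
    (g : Fin (J + 1) → MvPolynomial (Unit ⊕ Fin n) F) :
    MvPolynomial (Fin J ⊕ Fin n) F →ₐ[F] FracS f :=
  aeval (Sum.elim (fun j => toFrac f (g j.succ) * Ring.inverse (toFracP f Δ))
    (fun i => toFracP f (X i)))

/-- The ideal of induced relations. -/
def inducedIdeal (f : Polynomial (MvPolynomial (Fin n) F)) (Δ : MvPolynomial (Fin n) F)
    (g : Fin (J + 1) → MvPolynomial (Unit ⊕ Fin n) F) : Ideal (MvPolynomial (Fin J ⊕ Fin n) F) :=
  RingHom.ker (evalBar f Δ g)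

/-- The induced weights `wt(ȳ_j) = wt(g_j) - wt(g_0)`, with `wt(g)` read off from the leading
monomial of `g`; the `x_i` keep their weights. -/
def inducedWeight (m : MonomialOrder (Unit ⊕ Fin n)) (w : Unit ⊕ Fin n → Fin n → ℕ)
    (g : Fin (J + 1) → MvPolynomial (Unit ⊕ Fin n) F) : Fin J ⊕ Fin n → Fin n → ℤ :=
  Sum.elim
    (fun j k => (Finsupp.weight w (m.degree (g j.succ)) k : ℤ) - Finsupp.weight w (m.degree (g 0)) k)
    (fun i k => (w (Sum.inr i) k : ℤ))

/-- A canonical presentation `F[ȳ; x]/Ī` of `C(P, (1/Δ) S)`, as produced by the Qth-power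
algorithm: a canonical ordered set `g`, the minimal reduced Gröbner basis `b` of the ideal of
induced relations, and the induced weights, in which the standard monomials of the presentation
have pairwise distinct weights. -/
structure IsCanonicalPresentation (m : MonomialOrder (Unit ⊕ Fin n))
    (mbar : MonomialOrder (Fin J ⊕ Fin n)) (w : Unit ⊕ Fin n → Fin n → ℕ)
    (f : Polynomial (MvPolynomial (Fin n) F)) (Δ : MvPolynomial (Fin n) F)
    (g : Fin (J + 1) → MvPolynomial (Unit ⊕ Fin n) F)
    (b : Fin K → MvPolynomial (Fin J ⊕ Fin n) F) : Prop where
  canonical : IsCanonical m f Δ g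
  groebner : IsReducedGroebnerBasis mbar b (inducedIdeal f Δ g)
  distinct : ∀ a a' : Fin J ⊕ Fin n →₀ ℕ,
    (∀ k, ¬ mbar.degree (b k) ≤ a) → (∀ k, ¬ mbar.degree (b k) ≤ a') →
    Finsupp.weight (inducedWeight m w g) a = Finsupp.weight (inducedWeight m w g) a' → a = a'

/-- The homomorphism `F[y; x] → F[ȳ; x]` that fixes the `x_i` and sends `y` to `p`. -/
def psi (p : MvPolynomial (Fin J ⊕ Fin n) F) :
    MvPolynomial (Unit ⊕ Fin n) F →ₐ[F] MvPolynomial (Fin J ⊕ Fin n) F :=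
  aeval (Sum.elim (fun _ => p) (fun i => X (Sum.inr i)))

end Output

section Reconstruction

/-- `p' = μ_q(p)`: no denominator of a coefficient `α/β` of `p` is divisible by `q`, and the
corresponding coefficient `c` of `p'` satisfies `c β ≡ α (mod q)`. -/
def IsModImage {σ : Type} (q : ℕ) (p : MvPolynomial σ ℚ) (p' : MvPolynomial σ (ZMod q)) : Prop :=
  ∀ a, ¬ q ∣ (p.coeff a).den ∧
    p'.coeff a * ((p.coeff a).den : ZMod q) = ((p.coeff a).num : ZMod q)

/-- `r = α/β` (in lowest terms, `β > 0`) is `E_N(c)`: `c β ≡ α (mod N)` with `α² + β²` minimal,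
then `β` minimal (and, if `α` and `-α` still tie, `α` is the positive one). -/
def IsRatReconstruction (N : ℕ) (c : ℤ) (r : ℚ) : Prop :=
  (N : ℤ) ∣ c * r.den - r.num ∧
    ∀ s : ℚ, (N : ℤ) ∣ c * s.den - s.num →
      r.num ^ 2 + (r.den : ℤ) ^ 2 < s.num ^ 2 + (s.den : ℤ) ^ 2 ∨
      (r.num ^ 2 + (r.den : ℤ) ^ 2 = s.num ^ 2 + (s.den : ℤ) ^ 2 ∧
        (r.den < s.den ∨ (r.den = s.den ∧ s.num ≤ r.num)))

/-- `p₀ = E_N(CRT((p_l)_l))` coefficientwise, with `N = ∏ q_l`. -/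
def IsLift {σ L : Type} [Fintype L] (q : L → ℕ) (p : ∀ l, MvPolynomial σ (ZMod (q l)))
    (p₀ : MvPolynomial σ ℚ) : Prop :=
  ∀ a, ∃ c : ℤ, (∀ l, (c : ZMod (q l)) = (p l).coeff a) ∧
    IsRatReconstruction (∏ l, q l) c (p₀.coeff a)

end Reconstruction

end

/-!
The proof works with a single prime `q` from the family: all statements are about the local ring
`A ⊆ ℚ` of the rational numbers whose denominator is prime to `q`, its reduction to `𝔽_q`, and the
field `ℚ` (abstractly: `IsReduction`). The other primes are used only to see that the lifted
relations are monic with the prescribed leading monomials, reduce to the given relations modulo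
`q`, and have their leading monomials as monomials of the largest weight (`IsLift.isModImage`,
`IsLift.degree_eq_and_monic`, `IsCanonicalPresentation.lexWeight_le`). What is obtained in this way
is recorded in `IsLiftedPresentation`. Write `P` for the polynomial ring in the `x_i`, `T` for the
lifted ring, `ψ : S → T` for the lifted map and `W` for the weight.

*Embedding.* The lifted relations are a Gröbner basis over `ℚ` and monic over `A`, so that
the standard monomials modulo them are independent over `A`, `ℚ` and `𝔽_q` alike. As the reduction
of `T` is a ring without `P`-torsion, so is `T` itself (`mem_of_rename_mul_mem`), and `ψ` is
injective, since `S` is a domain that is integral over `P`. Modulo `q` one has `Δ ȳ_j = g_j(y)`;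
over `A` these equations hold up to multiples of `q`, and Cramer's rule turns them into equations
`D ȳ_j = s_j(y)` with `D ≢ 0` modulo `q` (`exists_denominator`). Hence `T` embeds in `Q(S)`, and
the powers of each of its elements have a common denominator, so that `T` is integral over `P`
(`exists_embedding`).

*Leading monomials.* By Gauss's lemma the elements `ȳ_j` of `Q(S)` have the form `G_j / Δ`, where
the coefficients of `G_j` are in `A` and `G_j` reduces to `g_j` (`exists_numerators`). Let
`e_j = W(G_j) - W(g_j) ≥ 0`, and let `e_i` be the largest of these numbers. In the expression of
`ȳ_i²` by standard monomials, all of which are linear in the `ȳ_j`, no monomial has an induced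
weight above that of `ȳ_i²`. As weights are multiplicative in a ring of type I, this gives
`2 e_i ≤ e_i`. So `G_j` and `g_j` have the same weight, and the same leading monomial
(`degree_G_eq`).

*Normality.* Let `H / Δ` be integral over `P`. After multiplication by a power of `q` the
coefficients of `H` are in `A`. The reduction of `H / Δ` is integral again, so that it is a
combination of the `x^α g_j / Δ` with `x^α ȳ_j` standard, whose leading monomials are distinct. If
the leading coefficient of `H` is a unit modulo `q`, then the leading monomial of `H` is therefore
one of some `x^α G_j`; otherwise one subtracts the same combination of the `x^α G_j` and divides
by `q`, which lowers the `q`-adic valuation of the leading coefficient (`exists_degree_eq`).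
Well-founded induction on the leading monomial now shows that `H / Δ` is in `T` (`mem_range`).
So `T` is the integral closure, and any presentation of the integral closure is isomorphic to it.
-/

open scoped MonomialOrder

/-! ### Reduction modulo monic polynomials -/

section Reduction

variable {σ ι R Γ : Type*} [CommRing R]

/-- The exponent `t` is standard with respect to the leading exponents `e`: none of them
divides it. -/
def IsStandard (e : ι → σ →₀ ℕ) (t : σ →₀ ℕ) : Prop := ∀ k, ¬ e k ≤ t

theorem exists_standard_sum [LinearOrder Γ] {e : ι → σ →₀ ℕ} {I : Ideal (MvPolynomial σ R)}
    (ω : (σ →₀ ℕ) → Γ) (p : MvPolynomial σ R)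
    (h : ∀ t ∈ p.support, ∃ r : MvPolynomial σ R, monomial t 1 - r ∈ I ∧
      ∀ s ∈ r.support, IsStandard e s ∧ ω s ≤ ω t) :
    ∃ r : MvPolynomial σ R, p - r ∈ I ∧
      ∀ s ∈ r.support, IsStandard e s ∧ ∃ t ∈ p.support, ω s ≤ ω t := by
  classical
  choose! r hr hs using h
  refine ⟨∑ t ∈ p.support, C (p.coeff t) * r t, ?_, ?_⟩
  · have : p - ∑ t ∈ p.support, C (p.coeff t) * r t
        = ∑ t ∈ p.support, C (p.coeff t) * (monomial t 1 - r t) := by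
      simp only [mul_sub, Finset.sum_sub_distrib, C_mul_monomial, mul_one]
      rw [support_sum_monomial_coeff]
    rw [this]
    exact Ideal.sum_mem _ fun t ht => Ideal.mul_mem_left _ _ (hr t ht)
  · intro s hsm
    obtain ⟨t, ht, hst⟩ : ∃ t ∈ p.support, s ∈ (C (p.coeff t) * r t).support := by
      have := MvPolynomial.support_sum hsm
      simpa using this
    have : s ∈ (r t).support := by
      rw [mem_support_iff, coeff_C_mul] at hst
      exact mem_support_iff.2 (right_ne_zero_of_mul hst)
    exact ⟨(hs t ht s this).1, t, ht, (hs t ht s this).2⟩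

variable [AddCommMonoid Γ] [LinearOrder Γ] [IsOrderedAddMonoid Γ]

/-- Reduction of a monomial modulo monic polynomials, none of whose monomials has larger weight
than the leading one: the remainder is standard, and the weight does not increase. -/
theorem exists_standard_monomial (m : MonomialOrder σ) {b : ι → MvPolynomial σ R}
    {e : ι → σ →₀ ℕ} (hb : ∀ k, m.Monic (b k)) (he : ∀ k, m.degree (b k) = e k)
    (ω : (σ →₀ ℕ) →+ Γ) (hω : ∀ k, ∀ t ∈ (b k).support, ω t ≤ ω (e k)) (t : σ →₀ ℕ) :
    ∃ r : MvPolynomial σ R, monomial t 1 - r ∈ Ideal.span (Set.range b) ∧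
      ∀ s ∈ r.support, IsStandard e s ∧ ω s ≤ ω t := by
  classical
  induction ht : m.toSyn t using WellFoundedLT.induction generalizing t with
  | ind u ih =>
  subst ht
  by_cases hstd : IsStandard e t
  · refine ⟨monomial t 1, by simp, fun s hs => ?_⟩
    have := support_monomial_subset hs
    simp only [Finset.mem_singleton] at this
    subst this
    exact ⟨hstd, le_rfl⟩
  · unfold IsStandard at hstd
    push Not at hstd
    obtain ⟨k, hk⟩ := hstd
    obtain ⟨s, rfl⟩ := exists_add_of_le hk
    set p : MvPolynomial σ R := monomial s 1 * (monomial (e k) 1 - b k) with hp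
    have hsup : ∀ a ∈ p.support, m.toSyn a < m.toSyn (e k + s) ∧ ω a ≤ ω (e k + s) := by
      intro a ha
      rw [mem_support_iff, hp, coeff_monomial_mul'] at ha
      split_ifs at ha with hsa
      · rw [one_mul] at ha
        obtain ⟨c, rfl⟩ := exists_add_of_le hsa
        rw [add_tsub_cancel_left] at ha
        have hc : c ≠ e k := by
          rintro rfl
          apply ha
          have := (hb k).coeff_degree
          rw [he] at this
          simp [this]
        have hcb : c ∈ (b k).support := by
          rw [mem_support_iff]
          intro h0
          apply ha
          simp [h0, coeff_monomial, hc.symm]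
        have h1 : m.toSyn c ≤ m.toSyn (e k) := he k ▸ m.le_degree hcb
        have h2 : m.toSyn c < m.toSyn (e k) :=
          lt_of_le_of_ne h1 fun h => hc (m.toSyn.injective h)
        rw [map_add, map_add, map_add, map_add, add_comm (m.toSyn (e k)), add_comm (ω (e k))]
        exact ⟨by gcongr, by gcongr; exact hω k c hcb⟩
      · exact absurd rfl ha
    obtain ⟨r, hr, hrs⟩ := exists_standard_sum (e := e) (I := Ideal.span (Set.range b)) ω p
      fun a ha => ih _ (hsup a ha).1 a rfl
    refine ⟨r, ?_, fun a ha => ⟨(hrs a ha).1, ?_⟩⟩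
    · have : monomial (e k + s) 1 - r = (p - r) + monomial s 1 * b k := by
        rw [hp, mul_sub, monomial_mul, one_mul, add_comm s]; ring
      rw [this]
      exact Ideal.add_mem _ hr (Ideal.mul_mem_left _ _ (Ideal.subset_span ⟨k, rfl⟩))
    · obtain ⟨c, hc, hac⟩ := (hrs a ha).2
      exact hac.trans (hsup c hc).2

/-- Reduction of a polynomial modulo monic polynomials, with control of the weights. -/
theorem exists_standard_weight (m : MonomialOrder σ) {b : ι → MvPolynomial σ R}
    {e : ι → σ →₀ ℕ} (hb : ∀ k, m.Monic (b k)) (he : ∀ k, m.degree (b k) = e k)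
    (ω : (σ →₀ ℕ) →+ Γ) (hω : ∀ k, ∀ t ∈ (b k).support, ω t ≤ ω (e k)) (p : MvPolynomial σ R) :
    ∃ r : MvPolynomial σ R, p - r ∈ Ideal.span (Set.range b) ∧
      ∀ s ∈ r.support, IsStandard e s ∧ ∃ t ∈ p.support, ω s ≤ ω t :=
  exists_standard_sum ω p fun t _ => exists_standard_monomial m hb he ω hω t

theorem exists_standard (m : MonomialOrder σ) {b : ι → MvPolynomial σ R}
    {e : ι → σ →₀ ℕ} (hb : ∀ k, m.Monic (b k)) (he : ∀ k, m.degree (b k) = e k)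
    (p : MvPolynomial σ R) :
    ∃ r : MvPolynomial σ R, p - r ∈ Ideal.span (Set.range b) ∧
      ∀ s ∈ r.support, IsStandard e s := by
  obtain ⟨r, h1, h2⟩ := exists_standard_weight m hb he (0 : (σ →₀ ℕ) →+ ℕ) (by simp) p
  exact ⟨r, h1, fun s hs => (h2 s hs).1⟩

/-- A linear combination, with nonzero coefficients, of monic polynomials with distinct leading
exponents has the largest of them as its leading exponent. -/
theorem exists_degree_sum_eq (m : MonomialOrder σ) {T : Finset ι} (hT : T.Nonempty) {c : ι → R}
    (hc : ∀ t ∈ T, c t ≠ 0) {h : ι → MvPolynomial σ R} (hh : ∀ t ∈ T, m.Monic (h t))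
    (hinj : Set.InjOn (fun t => m.degree (h t)) T) :
    ∑ i ∈ T, C (c i) * h i ≠ 0 ∧
    ∃ t ∈ T, m.degree (∑ i ∈ T, C (c i) * h i) = m.degree (h t) ∧
      ∀ i ∈ T, m.degree (h i) ≼[m] m.degree (h t) := by
  classical
  obtain ⟨t, ht, hmax⟩ := T.exists_max_image (fun t => m.toSyn (m.degree (h t))) hT
  have hle : ∀ i ∈ T, m.degree (C (c i) * h i) ≼[m] m.degree (h i) := fun i _ => by
    rw [← smul_eq_C_mul]; exact m.degree_smul_le
  have hco : (∑ i ∈ T, C (c i) * h i).coeff (m.degree (h t)) = c t := by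
    rw [coeff_sum, Finset.sum_eq_single t]
    · rw [coeff_C_mul, (hh t ht).coeff_degree, mul_one]
    · intro i hi hit
      rw [coeff_C_mul, m.coeff_eq_zero_of_lt, mul_zero]
      exact lt_of_le_of_ne (hmax i hi) fun he => hit (hinj hi ht (m.toSyn.injective he))
    · exact fun h => absurd ht h
  refine ⟨fun h0 => ?_, t, ht, m.toSyn.injective (le_antisymm ?_ ?_), hmax⟩
  · rw [h0, coeff_zero] at hco
    exact hc t ht hco.symm
  · refine m.degree_le_iff.2 fun s hs => ?_
    obtain ⟨i, hi, hsi⟩ : ∃ i ∈ T, s ∈ (C (c i) * h i).support := by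
      have := MvPolynomial.support_sum hs
      simpa using this
    exact (m.le_degree hsi).trans ((hle i hi).trans (hmax i hi))
  · exact m.le_degree (by rw [mem_support_iff, hco]; exact hc t ht)

end Reduction

theorem IsGroebnerBasis.eq_zero_of_standard {σ F : Type} [Field F] {m : MonomialOrder σ} {K : ℕ}
    {b : Fin K → MvPolynomial σ F} {I : Ideal (MvPolynomial σ F)} (h : IsGroebnerBasis m b I)
    {r : MvPolynomial σ F} (hr : r ∈ I)
    (hs : ∀ s ∈ r.support, IsStandard (fun k => m.degree (b k)) s) : r = 0 := by
  by_contra h0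
  obtain ⟨k, -, hk⟩ := h.2 r hr h0
  exact hs _ (m.degree_mem_support h0) k hk

/-! ### Normal forms in `S = P[y]/⟨f(y)⟩` -/

section NormalForms

/-- The polynomial `p` has `y`-degree less than `d`. -/
def IsNormal {R : Type} [CommRing R] {n : ℕ} (d : ℕ) (p : MvPolynomial (Unit ⊕ Fin n) R) : Prop :=
  ∀ a ∈ p.support, a (Sum.inl ()) < d

section

variable {R : Type} [CommRing R] {n d : ℕ} {p p' : MvPolynomial (Unit ⊕ Fin n) R}

theorem IsNormal.zero : IsNormal d (0 : MvPolynomial (Unit ⊕ Fin n) R) := by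
  simp [IsNormal]

theorem IsNormal.add (h : IsNormal d p) (h' : IsNormal d p') : IsNormal d (p + p') := by
  classical
  intro a ha
  rcases Finset.mem_union.1 (support_add ha) with h1 | h1
  · exact h a h1
  · exact h' a h1

theorem IsNormal.sum {ι : Type*} {s : Finset ι} {p : ι → MvPolynomial (Unit ⊕ Fin n) R}
    (h : ∀ i ∈ s, IsNormal d (p i)) : IsNormal d (∑ i ∈ s, p i) :=
  Finset.sum_induction _ _ (fun _ _ => IsNormal.add) IsNormal.zero h

theorem IsNormal.neg (h : IsNormal d p) : IsNormal d (-p) := by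
  intro a ha
  rw [support_neg] at ha
  exact h a ha

theorem IsNormal.sub (h : IsNormal d p) (h' : IsNormal d p') : IsNormal d (p - p') := by
  rw [sub_eq_add_neg]
  exact h.add h'.neg

theorem apply_inl_eq_zero_of_mem_support_rename {c : MvPolynomial (Fin n) R}
    {a : Unit ⊕ Fin n →₀ ℕ} (ha : a ∈ (rename Sum.inr c).support) : a (Sum.inl ()) = 0 := by
  classical
  rw [support_rename_of_injective Sum.inr_injective] at ha
  obtain ⟨u, -, rfl⟩ := Finset.mem_image.1 ha
  exact Finsupp.mapDomain_of_notMem_range _ _ (by simp)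

theorem IsNormal.rename_mul (c : MvPolynomial (Fin n) R) (h : IsNormal d p) :
    IsNormal d (rename Sum.inr c * p) := by
  classical
  intro a ha
  obtain ⟨u, hu, v, hv, rfl⟩ := Finset.mem_add.1 (support_mul _ _ ha)
  rw [Finsupp.add_apply, apply_inl_eq_zero_of_mem_support_rename hu, zero_add]
  exact h v hv

theorem IsNormal.map {R' : Type} [CommRing R'] (φ : R →+* R') (h : IsNormal d p) :
    IsNormal d (MvPolynomial.map φ p) :=
  fun a ha => h a (support_map_subset _ _ ha)

theorem IsNormal.C_mul (c : R) (h : IsNormal d p) : IsNormal d (C c * p) := by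
  intro a ha
  apply h
  rw [mem_support_iff, coeff_C_mul] at ha
  exact mem_support_iff.2 (right_ne_zero_of_mul ha)

theorem isNormal_rename (hd : 0 < d) (c : MvPolynomial (Fin n) R) :
    IsNormal d (rename Sum.inr c : MvPolynomial (Unit ⊕ Fin n) R) :=
  fun _ ha => by rwa [apply_inl_eq_zero_of_mem_support_rename ha]

end

variable {F : Type} [Field F] {n : ℕ}

theorem exponent_eq (a : Unit ⊕ Fin n →₀ ℕ) :
    ∃ α : Fin n →₀ ℕ, a = Finsupp.single (Sum.inl ()) (a (Sum.inl ())) + α.mapDomain Sum.inr := by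
  refine ⟨a.comapDomain Sum.inr Sum.inr_injective.injOn, ?_⟩
  ext i
  rcases i with ⟨⟩ | i
  · simp [Finsupp.mapDomain_of_notMem_range]
  · simp [Finsupp.mapDomain_apply Sum.inr_injective]

theorem coeff_evalY (f : Polynomial (MvPolynomial (Fin n) F)) (i : ℕ) (α : Fin n →₀ ℕ) :
    (evalY f).coeff (Finsupp.single (Sum.inl ()) i + α.mapDomain Sum.inr)
      = (f.coeff i).coeff α := by
  classical
  induction f using Polynomial.induction_on' with
  | add p q hp hq =>
    have : evalY (p + q) = evalY p + evalY q := by simp [evalY, Polynomial.eval₂_add]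
    simp [this, hp, hq]
  | monomial j p =>
    have : evalY (Polynomial.monomial j p)
        = rename Sum.inr p * monomial (Finsupp.single (Sum.inl ()) j) 1 := by
      simp [evalY, Polynomial.eval₂_monomial, inclP, X_pow_eq_monomial]
    rw [this, coeff_mul_monomial', mul_one, Polynomial.coeff_monomial]
    split_ifs with h1 h2 h2
    · subst h2
      rw [add_tsub_cancel_left, coeff_rename_mapDomain _ Sum.inr_injective]
    · rw [coeff_zero]
      by_contra h3
      have := apply_inl_eq_zero_of_mem_support_rename (mem_support_iff.2 h3)
      have h4 := h1 (Sum.inl ())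
      simp [Finsupp.mapDomain_of_notMem_range] at this h4
      omega
    · exact absurd (h2 ▸ self_le_add_right _ _) h1
    · simp

theorem eq_single_or_lt_of_mem_support_evalY {f : Polynomial (MvPolynomial (Fin n) F)}
    (hf : f.Monic) {t : Unit ⊕ Fin n →₀ ℕ} (ht : t ∈ (evalY f).support) :
    t = Finsupp.single (Sum.inl ()) f.natDegree ∨ t (Sum.inl ()) < f.natDegree := by
  classical
  obtain ⟨α, hα⟩ := exponent_eq t
  rw [hα, mem_support_iff, coeff_evalY] at ht
  rcases lt_trichotomy (t (Sum.inl ())) f.natDegree with h | h | h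
  · exact Or.inr h
  · left
    rw [h, hf.coeff_natDegree, coeff_one] at ht
    split_ifs at ht with h0
    · rw [hα, h, ← h0, Finsupp.mapDomain_zero, add_zero]
    · exact absurd rfl ht
  · rw [Polynomial.coeff_eq_zero_of_natDegree_lt h] at ht
    exact absurd (coeff_zero _) ht

theorem coeff_single_natDegree_evalY {f : Polynomial (MvPolynomial (Fin n) F)} (hf : f.Monic) :
    (evalY f).coeff (Finsupp.single (Sum.inl ()) f.natDegree) = 1 := by
  have := coeff_evalY f f.natDegree 0
  rwa [Finsupp.mapDomain_zero, add_zero, hf.coeff_natDegree, coeff_zero_one] at this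

/-- A nonzero normal form does not vanish in `S`. -/
theorem eq_zero_of_isNormal {f : Polynomial (MvPolynomial (Fin n) F)} (hf : f.Monic)
    {p : MvPolynomial (Unit ⊕ Fin n) F} (hp : IsNormal f.natDegree p) (hI : p ∈ inputIdeal f) :
    p = 0 := by
  by_contra h0
  obtain ⟨r, rfl⟩ := Ideal.mem_span_singleton.1 hI
  have h1 := degreeOf_mul_eq (n := Sum.inl ()) (left_ne_zero_of_mul h0) (right_ne_zero_of_mul h0)
  have h2 : f.natDegree ≤ degreeOf (Sum.inl ()) (evalY f) := by
    have h := monomial_le_degreeOf (Sum.inl ()) (f := evalY f)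
      (m := Finsupp.single (Sum.inl ()) f.natDegree)
      (by rw [mem_support_iff, coeff_single_natDegree_evalY hf]; exact one_ne_zero)
    rwa [Finsupp.single_eq_same] at h
  obtain ⟨a, ha⟩ := Finset.nonempty_of_ne_empty (support_eq_empty.not.2 h0)
  have h3 := (degreeOf_lt_iff ((Nat.zero_le _).trans_lt (hp a ha))).2 hp
  omega

/-- The leading term of `f(y)` is `y^d`, with `d` the degree of `f`. -/
structure IsLedByPower (m : MonomialOrder (Unit ⊕ Fin n))
    (f : Polynomial (MvPolynomial (Fin n) F)) : Prop where
  poly_monic : f.Monic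
  monic : m.Monic (evalY f)
  degree : m.degree (evalY f) = Finsupp.single (Sum.inl ()) f.natDegree

variable {m : MonomialOrder (Unit ⊕ Fin n)} {f : Polynomial (MvPolynomial (Fin n) F)}
  {p p' : MvPolynomial (Unit ⊕ Fin n) F} {Δ : MvPolynomial (Fin n) F}

theorem IsLedByPower.eq_zero (h : IsLedByPower m f) (hp : IsNormal f.natDegree p)
    (hI : p ∈ inputIdeal f) : p = 0 :=
  eq_zero_of_isNormal h.poly_monic hp hI

theorem IsLedByPower.eq_of_sub_mem (h : IsLedByPower m f) (hp : IsNormal f.natDegree p)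
    (hp' : IsNormal f.natDegree p') (hI : p - p' ∈ inputIdeal f) : p = p' :=
  sub_eq_zero.1 (h.eq_zero (hp.sub hp') hI)

/-- Division with remainder by `y^d + …`, with control of the weights and over any ring. -/
theorem exists_normal_of_monic {R Γ : Type} [CommRing R] [AddCommMonoid Γ] [LinearOrder Γ]
    [IsOrderedAddMonoid Γ] {φ : MvPolynomial (Unit ⊕ Fin n) R} {d : ℕ} (hφ : m.Monic φ)
    (hd : m.degree φ = Finsupp.single (Sum.inl ()) d) (ω : (Unit ⊕ Fin n →₀ ℕ) →+ Γ)
    (hω : ∀ t ∈ φ.support, ω t ≤ ω (Finsupp.single (Sum.inl ()) d))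
    (p : MvPolynomial (Unit ⊕ Fin n) R) :
    ∃ r, p - r ∈ Ideal.span {φ} ∧ IsNormal d r ∧ ∀ s ∈ r.support, ∃ t ∈ p.support, ω s ≤ ω t := by
  obtain ⟨r, h1, h2⟩ := exists_standard_weight m (b := fun _ : Unit => φ)
    (e := fun _ => Finsupp.single (Sum.inl ()) d) (fun _ => hφ) (fun _ => hd) ω (fun _ => hω) p
  refine ⟨r, by simpa using h1, fun s hs => ?_, fun s hs => (h2 s hs).2⟩
  have := (h2 s hs).1 ()
  rwa [Finsupp.single_le_iff, not_le] at this

theorem IsLedByPower.exists_normal (h : IsLedByPower m f) (p : MvPolynomial (Unit ⊕ Fin n) F) :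
    ∃ r, p - r ∈ inputIdeal f ∧ IsNormal f.natDegree r := by
  obtain ⟨r, h1, h2, -⟩ :=
    exists_normal_of_monic h.monic h.degree (0 : (Unit ⊕ Fin n →₀ ℕ) →+ ℕ) (by simp) p
  exact ⟨r, h1, h2⟩

theorem inclP_injective : Function.Injective (inclP (F := F) (n := n) Unit) :=
  rename_injective _ Sum.inr_injective

theorem IsLedByPower.mem_of_inclP_mul_mem (h : IsLedByPower m f) (hΔ : Δ ≠ 0)
    (hp : inclP Unit Δ * p ∈ inputIdeal f) : p ∈ inputIdeal f := by
  obtain ⟨r, hr, hn⟩ := h.exists_normal p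
  have h1 : inclP Unit Δ * r ∈ inputIdeal f := by
    have : inclP Unit Δ * r = inclP Unit Δ * p - inclP Unit Δ * (p - r) := by ring
    rw [this]
    exact Ideal.sub_mem _ hp (Ideal.mul_mem_left _ _ hr)
  have h2 := h.eq_zero (hn.rename_mul Δ) h1
  rcases mul_eq_zero.1 h2 with h3 | h3
  · exact absurd ((map_eq_zero_iff _ inclP_injective).1 h3) hΔ
  · simpa [h3] using hr

theorem toFrac_eq_zero_iff : toFrac f p = 0 ↔ p ∈ inputIdeal f := by
  rw [toFrac, RingHom.comp_apply,
    map_eq_zero_iff _ (IsFractionRing.injective (InputRing f) (FracS f)),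
    Ideal.Quotient.eq_zero_iff_mem]

theorem toFrac_eq_iff : toFrac f p = toFrac f p' ↔ p - p' ∈ inputIdeal f := by
  rw [← toFrac_eq_zero_iff, map_sub, sub_eq_zero]

theorem IsLedByPower.mk_inclP_mem_nonZeroDivisors (h : IsLedByPower m f) (hΔ : Δ ≠ 0) :
    Ideal.Quotient.mk (inputIdeal f) (inclP Unit Δ) ∈ nonZeroDivisors (InputRing f) := by
  refine mem_nonZeroDivisors_iff_right.2 fun x hx => ?_
  obtain ⟨p, rfl⟩ := Ideal.Quotient.mk_surjective x
  rw [← map_mul, Ideal.Quotient.eq_zero_iff_mem, mul_comm] at hx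
  exact Ideal.Quotient.eq_zero_iff_mem.2 (h.mem_of_inclP_mul_mem hΔ hx)

theorem toFracP_apply (c : MvPolynomial (Fin n) F) : toFracP f c = toFrac f (inclP Unit c) := rfl

theorem IsLedByPower.isUnit_toFracP (h : IsLedByPower m f) (hΔ : Δ ≠ 0) :
    IsUnit (toFracP f Δ) :=
  IsLocalization.map_units (FracS f)
    (⟨_, h.mk_inclP_mem_nonZeroDivisors hΔ⟩ : nonZeroDivisors (InputRing f))

theorem toFrac_eq_iff_of_normal (h : IsLedByPower m f) (hp : IsNormal f.natDegree p)
    (hp' : IsNormal f.natDegree p') : toFrac f p = toFrac f p' ↔ p = p' :=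
  ⟨fun he => h.eq_of_sub_mem hp hp' (toFrac_eq_iff.1 he), fun he => he ▸ rfl⟩

theorem isIntegralElem_toFrac (hf : f.Monic) (p : MvPolynomial (Unit ⊕ Fin n) F) :
    (toFracP f).IsIntegralElem (toFrac f p) := by
  induction p using MvPolynomial.induction_on with
  | C c =>
    have : toFrac f (C c) = toFracP f (C c) := by simp [toFracP_apply, inclP]
    rw [this]
    exact RingHom.isIntegralElem_map _
  | add p q hp hq => rw [map_add]; exact hp.add _ hq
  | mul_X p i hp =>
    rw [map_mul]
    refine hp.mul _ ?_
    rcases i with ⟨⟩ | i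
    · refine ⟨f, hf, ?_⟩
      have h1 : (toFracP f) = (toFrac f).comp (inclP Unit).toRingHom := rfl
      rw [h1, ← Polynomial.hom_eval₂]
      exact toFrac_eq_zero_iff.2 (Ideal.subset_span rfl)
    · have : toFrac f (X (Sum.inr i)) = toFracP f (X i) := by simp [toFracP_apply, inclP]
      rw [this]
      exact RingHom.isIntegralElem_map _

theorem isIntegral_iff_isIntegralElem_comp {P S Q : Type*} [CommRing P] [CommRing S] [CommRing Q]
    [Algebra S Q] (g : P →+* S) (hinj : Function.Injective (algebraMap S Q))
    (hg : ∀ s, ((algebraMap S Q).comp g).IsIntegralElem (algebraMap S Q s)) (z : Q) :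
    IsIntegral S z ↔ ((algebraMap S Q).comp g).IsIntegralElem z := by
  let : Algebra P S := g.toAlgebra
  let : Algebra P Q := ((algebraMap S Q).comp g).toAlgebra
  have : IsScalarTower P S Q := IsScalarTower.of_algebraMap_eq fun _ => rfl
  have : Algebra.IsIntegral P S := ⟨fun x => (isIntegral_algebraMap_iff hinj).1 (hg x)⟩
  exact ⟨fun h => isIntegral_trans (R := P) z h, fun h => IsIntegral.tower_top (R := P) h⟩

theorem isIntegral_iff_isIntegralElem (hf : f.Monic) (z : FracS f) :
    IsIntegral (InputRing f) z ↔ (toFracP f).IsIntegralElem z := by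
  refine isIntegral_iff_isIntegralElem_comp
    ((Ideal.Quotient.mk (inputIdeal f)).comp (inclP Unit).toRingHom)
    (IsFractionRing.injective (InputRing f) (FracS f)) (fun s => ?_) z
  obtain ⟨p, rfl⟩ := Ideal.Quotient.mk_surjective s
  exact isIntegralElem_toFrac hf p

/-- An element all of whose powers have the common denominator `Δ` is integral. -/
theorem IsLedByPower.isIntegralElem_of_pow (h : IsLedByPower m f) (hf : f.Monic) (hΔ : Δ ≠ 0)
    {z : FracS f} (hz : ∀ k : ℕ, ∃ r, toFracP f Δ * z ^ k = toFrac f r) :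
    (toFracP f).IsIntegralElem z := by
  rw [← isIntegral_iff_isIntegralElem hf]
  refine IsAlmostIntegral.isIntegral_of_nonZeroDivisors_le_comap
    ⟨_, h.mk_inclP_mem_nonZeroDivisors hΔ, fun k => ?_⟩ ?_
  · obtain ⟨r, hr⟩ := hz k
    refine ⟨Ideal.Quotient.mk _ r, ?_⟩
    rw [Algebra.smul_def]
    exact hr.symm
  · intro x hx
    exact (IsLocalization.map_units (FracS f)
      (⟨x, hx⟩ : nonZeroDivisors (InputRing f))).mem_nonZeroDivisors

end NormalForms

/-! ### Presentations of the integral closure -/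

section Presentations

/-- The generators `ȳ_0 = 1, ȳ_1, …, ȳ_J` of `R[ȳ; x]` as an algebra over `R[x]`. -/
noncomputable def barVar (R : Type) [CommRing R] {n J : ℕ} (j : Fin (J + 1)) :
    MvPolynomial (Fin J ⊕ Fin n) R :=
  Fin.cases 1 (fun i => X (Sum.inl i)) j

/-- The exponent of `x^α ȳ_j`. -/
noncomputable def barExp {n J : ℕ} (j : Fin (J + 1)) (α : Fin n →₀ ℕ) : Fin J ⊕ Fin n →₀ ℕ :=
  Fin.cases 0 (fun i => Finsupp.single (Sum.inl i) 1) j + α.mapDomain Sum.inr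

/-- The total degree in the dependent variables. -/
def barDegree {n J : ℕ} (t : Fin J ⊕ Fin n →₀ ℕ) : ℕ := ∑ j, t (Sum.inl j)

open Classical in
/-- The index `j` of an exponent of the form `x^α ȳ_j`. -/
noncomputable def barIndex {n J : ℕ} (t : Fin J ⊕ Fin n →₀ ℕ) : Fin (J + 1) :=
  if h : ∃ j, t (Sum.inl j) ≠ 0 then h.choose.succ else 0

/-- The exponent `α` of an exponent of the form `x^α ȳ_j`. -/
noncomputable def barShift {n J : ℕ} (t : Fin J ⊕ Fin n →₀ ℕ) : Fin n →₀ ℕ :=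
  t.comapDomain Sum.inr Sum.inr_injective.injOn

/-- The polynomial `x^α g_j` that corresponds to the exponent `t` of `x^α ȳ_j`. -/
noncomputable def barMul {R : Type} [CommRing R] {n J : ℕ}
    (g : Fin (J + 1) → MvPolynomial (Unit ⊕ Fin n) R) (t : Fin J ⊕ Fin n →₀ ℕ) :
    MvPolynomial (Unit ⊕ Fin n) R :=
  rename Sum.inr (monomial (barShift t) 1) * g (barIndex t)

/-- The polynomial `∑ c x^α g_j` that corresponds to `p = ∑ c x^α ȳ_j`. -/
noncomputable def barSum {R : Type} [CommRing R] {n J : ℕ}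
    (g : Fin (J + 1) → MvPolynomial (Unit ⊕ Fin n) R) (p : MvPolynomial (Fin J ⊕ Fin n) R) :
    MvPolynomial (Unit ⊕ Fin n) R :=
  ∑ t ∈ p.support, C (p.coeff t) * barMul g t

section Exponents

variable {R : Type} [CommRing R] {n J : ℕ}

theorem barDegree_add (s t : Fin J ⊕ Fin n →₀ ℕ) :
    barDegree (s + t) = barDegree s + barDegree t := by
  simp [barDegree, Finset.sum_add_distrib]

@[simp] theorem barDegree_mapDomain_inr (α : Fin n →₀ ℕ) :
    barDegree (α.mapDomain Sum.inr : Fin J ⊕ Fin n →₀ ℕ) = 0 := by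
  simp [barDegree, Finsupp.mapDomain_of_notMem_range]

@[simp] theorem barDegree_single_inl (j : Fin J) (k : ℕ) :
    barDegree (Finsupp.single (Sum.inl j) k : Fin J ⊕ Fin n →₀ ℕ) = k := by
  simp [barDegree, Finsupp.single_apply]

theorem eq_barExp {t : Fin J ⊕ Fin n →₀ ℕ} (ht : barDegree t ≤ 1) :
    t = barExp (barIndex t) (barShift t) := by
  ext i
  rw [barExp, Finsupp.add_apply]
  rcases i with i | i
  · rw [Finsupp.mapDomain_of_notMem_range _ _ (by simp), add_zero]
    unfold barIndex
    split_ifs with h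
    · have h0 := h.choose_spec
      set j := h.choose
      simp only [Fin.cases_succ, Finsupp.single_apply]
      have hle : t (Sum.inl j) ≤ barDegree t :=
        Finset.single_le_sum (f := fun j => t (Sum.inl j)) (fun _ _ => Nat.zero_le _)
          (Finset.mem_univ j)
      split_ifs with hji
      · rw [← hji]; omega
      · have hne : j ≠ i := fun h => hji (congrArg _ h)
        have := Finset.add_le_sum (f := fun j => t (Sum.inl j)) (s := Finset.univ)
          (fun _ _ => Nat.zero_le _) (Finset.mem_univ j) (Finset.mem_univ i) hne
        change _ ≤ barDegree t at this
        omega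
    · push Not at h
      simp [h]
  · rw [Finsupp.mapDomain_apply Sum.inr_injective]
    have : ∀ j : Fin (J + 1), (Fin.cases 0 (fun j => Finsupp.single (Sum.inl j) 1) j :
        Fin J ⊕ Fin n →₀ ℕ) (Sum.inr i) = 0 := fun j => by
      refine Fin.cases ?_ (fun j => ?_) j <;> simp
    rw [this, zero_add]
    rfl

theorem monomial_barExp (j : Fin (J + 1)) (α : Fin n →₀ ℕ) (c : R) :
    monomial (barExp j α) c = C c * (rename Sum.inr (monomial α 1) * barVar R j) := by
  rw [rename_monomial, barExp, barVar]
  refine Fin.cases ?_ (fun j => ?_) j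
  · simp [C_mul_monomial]
  · simp [X, monomial_mul, C_mul_monomial, add_comm]

theorem barDegree_le_of_mem_support_mul_barVar {c : MvPolynomial (Fin n) R} {j : Fin (J + 1)}
    {t : Fin J ⊕ Fin n →₀ ℕ} (ht : t ∈ (rename Sum.inr c * barVar R j).support) :
    barDegree t ≤ 1 := by
  classical
  obtain ⟨u, hu, v, hv, rfl⟩ := Finset.mem_add.1 (support_mul _ _ ht)
  rw [support_rename_of_injective Sum.inr_injective] at hu
  obtain ⟨u, -, rfl⟩ := Finset.mem_image.1 hu
  rw [barDegree_add, barDegree_mapDomain_inr, zero_add]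
  revert hv
  refine Fin.cases ?_ (fun j => ?_) j
  · intro hv
    have := support_monomial_subset (R := R) (a := 1) (s := (0 : Fin J ⊕ Fin n →₀ ℕ)) hv
    simp only [Finset.mem_singleton] at this
    simp [this, barDegree]
  · intro hv
    have := support_monomial_subset (R := R) (a := 1) hv
    simp only [Finset.mem_singleton] at this
    simp [this]

theorem map_barVar {R' : Type} [CommRing R'] (φ : R →+* R') (j : Fin (J + 1)) :
    map φ (barVar R j : MvPolynomial (Fin J ⊕ Fin n) R) = barVar R' j := by
  unfold barVar
  refine Fin.cases ?_ (fun j => ?_) j <;> simp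

theorem eq_sum_barVar {p : MvPolynomial (Fin J ⊕ Fin n) R}
    (hp : ∀ t ∈ p.support, barDegree t ≤ 1) :
    p = ∑ t ∈ p.support,
      C (p.coeff t) * (rename Sum.inr (monomial (barShift t) 1) * barVar R (barIndex t)) := by
  conv_lhs => rw [← support_sum_monomial_coeff p]
  exact Finset.sum_congr rfl fun t ht => by
    rw [← monomial_barExp, ← eq_barExp (hp t ht)]

theorem IsNormal.barMul {g : Fin (J + 1) → MvPolynomial (Unit ⊕ Fin n) R} {d : ℕ}
    (hg : ∀ j, IsNormal d (g j)) (t : Fin J ⊕ Fin n →₀ ℕ) : IsNormal d (barMul g t) :=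
  (hg _).rename_mul _

theorem IsNormal.barSum {g : Fin (J + 1) → MvPolynomial (Unit ⊕ Fin n) R} {d : ℕ}
    (hg : ∀ j, IsNormal d (g j)) (p : MvPolynomial (Fin J ⊕ Fin n) R) : IsNormal d (barSum g p) :=
  IsNormal.sum fun t _ => (IsNormal.barMul hg t).C_mul _

theorem map_barMul {R' : Type} [CommRing R'] (φ : R →+* R')
    (g : Fin (J + 1) → MvPolynomial (Unit ⊕ Fin n) R) (t : Fin J ⊕ Fin n →₀ ℕ) :
    map φ (barMul g t) = barMul (fun j => map φ (g j)) t := by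
  simp [barMul, rename_monomial]

theorem degree_barMul [IsDomain R] {m : MonomialOrder (Unit ⊕ Fin n)}
    {g : Fin (J + 1) → MvPolynomial (Unit ⊕ Fin n) R} (hg : ∀ j, g j ≠ 0)
    (t : Fin J ⊕ Fin n →₀ ℕ) :
    m.degree (barMul g t) = (barShift t).mapDomain Sum.inr + m.degree (g (barIndex t)) := by
  classical
  have h1 : rename Sum.inr (monomial (barShift t) (1 : R)) ≠
      (0 : MvPolynomial (Unit ⊕ Fin n) R) := by
    rw [rename_monomial, Ne, monomial_eq_zero]; exact one_ne_zero
  rw [barMul, m.degree_mul h1 (hg _), rename_monomial, m.degree_monomial, if_neg one_ne_zero]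

theorem exists_eq_sum_barVar {p : MvPolynomial (Fin J ⊕ Fin n) R}
    (hp : ∀ t ∈ p.support, barDegree t ≤ 1) :
    ∃ c : Fin (J + 1) → MvPolynomial (Fin n) R, p = ∑ j, rename Sum.inr (c j) * barVar R j := by
  classical
  refine ⟨fun j => ∑ t ∈ p.support with barIndex t = j, monomial (barShift t) (p.coeff t), ?_⟩
  conv_lhs => rw [eq_sum_barVar hp, ← Finset.sum_fiberwise (s := p.support) (g := barIndex)]
  refine Finset.sum_congr rfl fun j _ => ?_
  rw [map_sum, Finset.sum_mul]
  refine Finset.sum_congr rfl fun t ht => ?_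
  rw [(Finset.mem_filter.1 ht).2, ← mul_assoc]
  congr 1
  rw [rename_monomial, rename_monomial, C_mul_monomial, mul_one]

theorem barSum_eq_sum {g : Fin (J + 1) → MvPolynomial (Unit ⊕ Fin n) R}
    {p : MvPolynomial (Fin J ⊕ Fin n) R} {T : Finset (Fin J ⊕ Fin n →₀ ℕ)} (hT : p.support ⊆ T) :
    barSum g p = ∑ t ∈ T, C (p.coeff t) * barMul g t := by
  refine Finset.sum_subset hT fun t _ ht => ?_
  rw [notMem_support_iff.1 ht, C_0, zero_mul]

theorem barSum_monomial_one [Nontrivial R] (g : Fin (J + 1) → MvPolynomial (Unit ⊕ Fin n) R)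
    (t : Fin J ⊕ Fin n →₀ ℕ) : barSum g (monomial t 1) = barMul g t := by
  classical
  rw [barSum, support_monomial, if_neg one_ne_zero, Finset.sum_singleton, coeff_monomial,
    if_pos rfl, C_1, one_mul]

theorem exists_mem_support_barMul {g : Fin (J + 1) → MvPolynomial (Unit ⊕ Fin n) R}
    {p : MvPolynomial (Fin J ⊕ Fin n) R} {s : Unit ⊕ Fin n →₀ ℕ} (hs : s ∈ (barSum g p).support) :
    ∃ t ∈ p.support, s ∈ (barMul g t).support := by
  classical
  have h := MvPolynomial.support_sum hs
  simp only [Finset.mem_biUnion] at h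
  obtain ⟨t, ht, hst⟩ := h
  rw [mem_support_iff, coeff_C_mul] at hst
  exact ⟨t, ht, mem_support_iff.2 (right_ne_zero_of_mul hst)⟩

theorem map_barSum {R' : Type} [CommRing R'] (φ : R →+* R')
    (g : Fin (J + 1) → MvPolynomial (Unit ⊕ Fin n) R) (p : MvPolynomial (Fin J ⊕ Fin n) R) :
    map φ (barSum g p) = barSum (fun j => map φ (g j)) (map φ p) := by
  rw [barSum_eq_sum (support_map_subset φ p), barSum, map_sum]
  refine Finset.sum_congr rfl fun t _ => ?_
  rw [map_mul, map_C, coeff_map, map_barMul]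

theorem monic_barMul [Nontrivial R] {m : MonomialOrder (Unit ⊕ Fin n)}
    {g : Fin (J + 1) → MvPolynomial (Unit ⊕ Fin n) R} (hg : ∀ j, m.Monic (g j))
    (t : Fin J ⊕ Fin n →₀ ℕ) : m.Monic (barMul g t) ∧
      m.degree (barMul g t) = (barShift t).mapDomain Sum.inr + m.degree (g (barIndex t)) := by
  classical
  have h1 : m.Monic (rename Sum.inr (monomial (barShift t) (1 : R)) :
      MvPolynomial (Unit ⊕ Fin n) R) := by
    rw [rename_monomial]; exact m.monic_monomial_one
  refine ⟨h1.mul (hg _), ?_⟩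
  rw [barMul, m.degree_mul_of_mul_leadingCoeff_ne_zero, rename_monomial, m.degree_monomial,
    if_neg one_ne_zero]
  rw [h1.leadingCoeff_eq_one, (hg _).leadingCoeff_eq_one]
  simp

end Exponents

section Evaluation

variable {F : Type} [Field F] {n J K : ℕ} {m : MonomialOrder (Unit ⊕ Fin n)}
  {f : Polynomial (MvPolynomial (Fin n) F)} {Δ : MvPolynomial (Fin n) F}
  {g : Fin (J + 1) → MvPolynomial (Unit ⊕ Fin n) F}

theorem evalBar_rename (c : MvPolynomial (Fin n) F) :
    evalBar f Δ g (rename Sum.inr c) = toFracP f c := by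
  induction c using MvPolynomial.induction_on with
  | C a =>
    rw [rename_C, toFracP_apply, inclP, rename_C, ← algebraMap_eq, AlgHom.commutes]
    rfl
  | add p q hp hq => simp only [map_add, hp, hq]
  | mul_X p i hp =>
    rw [map_mul, map_mul, map_mul, hp, rename_X]
    simp only [evalBar, aeval_X, Sum.elim_inr]

theorem toFracP_mul_evalBar_barVar (hu : IsUnit (toFracP f Δ)) (h0 : g 0 = inclP Unit Δ)
    (j : Fin (J + 1)) : toFracP f Δ * evalBar f Δ g (barVar F j) = toFrac f (g j) := by
  unfold barVar
  refine Fin.cases ?_ (fun j => ?_) j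
  · simp [h0, toFracP_apply]
  · simp only [Fin.cases_succ, evalBar, aeval_X, Sum.elim_inl]
    rw [mul_left_comm, Ring.mul_inverse_cancel _ hu, mul_one]

/-- If a homomorphism over `P` takes `ȳ_j` to `g_j / Δ`, then it takes a polynomial that is linear
in the dependent variables to a fraction with denominator `Δ`. -/
theorem toFracP_mul_eq_toFrac_barSum {ev : MvPolynomial (Fin J ⊕ Fin n) F →+* FracS f}
    (hev : ∀ c, ev (rename Sum.inr c) = toFracP f c)
    (hg : ∀ j, toFracP f Δ * ev (barVar F j) = toFrac f (g j))
    {p : MvPolynomial (Fin J ⊕ Fin n) F} (hp : ∀ t ∈ p.support, barDegree t ≤ 1) :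
    toFracP f Δ * ev p = toFrac f (barSum g p) := by
  conv_lhs => rw [eq_sum_barVar hp]
  simp only [barSum, barMul, map_sum, map_mul, Finset.mul_sum]
  refine Finset.sum_congr rfl fun t _ => ?_
  rw [← hg, hev, toFracP_apply (monomial _ _), inclP]
  have : ev (C (p.coeff t)) = toFrac f (C (p.coeff t)) := by
    have := hev (C (p.coeff t))
    rw [rename_C] at this
    rw [this, toFracP_apply, inclP, rename_C]
  rw [this]
  ring

theorem toFracP_mul_evalBar (hu : IsUnit (toFracP f Δ)) (h0 : g 0 = inclP Unit Δ)
    {p : MvPolynomial (Fin J ⊕ Fin n) F} (hp : ∀ t ∈ p.support, barDegree t ≤ 1) :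
    toFracP f Δ * evalBar f Δ g p = toFrac f (barSum g p) :=
  toFracP_mul_eq_toFrac_barSum (ev := (evalBar f Δ g).toRingHom) evalBar_rename
    (toFracP_mul_evalBar_barVar hu h0) hp

variable (hl : IsLedByPower m f) (hf : f.Monic) (hc : IsCanonical m f Δ g)

theorem mem_closureIn_iff (hf : f.Monic) (hcond : IsConductor f Δ) {z : FracS f} :
    z ∈ closureIn f Δ ↔ (toFracP f).IsIntegralElem z :=
  ⟨fun h => h.1, fun h => ⟨h, hcond z ((isIntegral_iff_isIntegralElem hf z).2 h)⟩⟩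

include hc in
theorem IsCanonical.ne_zero : Δ ≠ 0 := by
  rintro rfl
  exact (hc.monic 0).ne_zero (by rw [hc.zero, map_zero])

include hl hc

theorem IsCanonical.isUnit : IsUnit (toFracP f Δ) := hl.isUnit_toFracP hc.ne_zero

theorem IsCanonical.isIntegralElem_evalBar (p : MvPolynomial (Fin J ⊕ Fin n) F) :
    (toFracP f).IsIntegralElem (evalBar f Δ g p) := by
  induction p using MvPolynomial.induction_on with
  | C a =>
    have := evalBar_rename (f := f) (Δ := Δ) (g := g) (C a)
    rw [rename_C] at this
    rw [this]
    exact RingHom.isIntegralElem_map _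
  | add p q hp hq => rw [map_add]; exact hp.add _ hq
  | mul_X p i hp =>
    rw [map_mul]
    refine hp.mul _ ?_
    rcases i with i | i
    · refine ((hc.generate _).2 ⟨Pi.single i.succ 1, ?_⟩).1
      have := toFracP_mul_evalBar_barVar (hc.isUnit hl) hc.zero i.succ
      rw [Finset.sum_eq_single i.succ (fun j _ hj => by simp [hj]) (by simp)]
      simpa [barVar] using this
    · have := evalBar_rename (f := f) (Δ := Δ) (g := g) (X i)
      rw [rename_X] at this
      rw [this]
      exact RingHom.isIntegralElem_map _

/-- The canonical generators generate the integral closure as a module, and so as an algebra. -/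
theorem IsCanonical.exists_evalBar_eq {z : FracS f} (hz : z ∈ closureIn f Δ) :
    ∃ c : Fin (J + 1) → MvPolynomial (Fin n) F,
      evalBar f Δ g (∑ j, rename Sum.inr (c j) * barVar F j) = z := by
  obtain ⟨c, hc'⟩ := (hc.generate z).1 hz
  refine ⟨c, (hc.isUnit hl).mul_left_cancel ?_⟩
  rw [hc', map_sum, Finset.mul_sum, map_sum]
  refine Finset.sum_congr rfl fun j _ => ?_
  rw [map_mul, map_mul, evalBar_rename, mul_left_comm,
    toFracP_mul_evalBar_barVar (hc.isUnit hl) hc.zero, toFracP_apply]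

include hf

theorem IsCanonical.range_evalBar : Set.range (evalBar f Δ g) = closureIn f Δ := by
  ext z
  constructor
  · rintro ⟨p, rfl⟩
    exact (mem_closureIn_iff hf hc.conductor).2 (hc.isIntegralElem_evalBar hl p)
  · intro hz
    obtain ⟨c, h⟩ := hc.exists_evalBar_eq hl hz
    exact ⟨_, h⟩

variable {mbar : MonomialOrder (Fin J ⊕ Fin n)} (hmbar : IsDependentDegreeFirst mbar)
include hmbar

/-- Products `ȳ_i ȳ_j` are not standard: they can be rewritten as linear combinations of the
generators. -/
theorem IsCanonical.exists_degree_le {b : Fin K → MvPolynomial (Fin J ⊕ Fin n) F}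
    (hb : IsGroebnerBasis mbar b (inducedIdeal f Δ g)) (i j : Fin J) :
    ∃ k, mbar.degree (b k) ≤ Finsupp.single (Sum.inl i) 1 + Finsupp.single (Sum.inl j) 1 := by
  classical
  obtain ⟨c, hz⟩ := hc.exists_evalBar_eq hl ((hc.range_evalBar hl hf).subset
    ⟨X (Sum.inl i) * X (Sum.inl j), rfl⟩)
  set lin := ∑ j, rename Sum.inr (c j) * barVar F j
  set e : Fin J ⊕ Fin n →₀ ℕ := Finsupp.single (Sum.inl i) 1 + Finsupp.single (Sum.inl j) 1
    with he
  have hXX : (X (Sum.inl i) * X (Sum.inl j) : MvPolynomial (Fin J ⊕ Fin n) F) = monomial e 1 := by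
    simp [X, monomial_mul, he]
  have hdl : barDegree (mbar.degree lin) ≤ 1 := by
    by_cases h0 : lin = 0
    · simp [h0, barDegree]
    · obtain ⟨j, -, hj⟩ : ∃ j ∈ Finset.univ, mbar.degree lin ∈
          (rename Sum.inr (c j) * barVar F j).support := by
        have := MvPolynomial.support_sum (mbar.degree_mem_support h0)
        simpa using this
      exact barDegree_le_of_mem_support_mul_barVar hj
  have hde : barDegree e = 2 := by simp [he, barDegree_add]
  have hlt : mbar.degree lin ≺[mbar] mbar.degree (monomial e (1 : F)) := by
    rw [mbar.degree_monomial, if_neg one_ne_zero]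
    refine hmbar _ _ ?_
    change barDegree _ < barDegree _
    omega
  have hdeg := mbar.degree_sub_of_lt hlt
  rw [mbar.degree_monomial, if_neg one_ne_zero] at hdeg
  obtain ⟨k, -, hk⟩ := hb.2 (monomial e 1 - lin) (by
    rw [inducedIdeal, RingHom.mem_ker]
    change evalBar f Δ g _ = 0
    rw [map_sub, hz, ← hXX, sub_self]) (by
      intro h0
      rw [h0, mbar.degree_zero] at hdeg
      rw [← hdeg] at hde
      simp [barDegree] at hde)
  exact ⟨k, hdeg ▸ hk⟩

omit hf hc in
/-- No power product of the independent variables is a leading monomial of an induced relation. -/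
theorem barDegree_degree_ne_zero (hd : 0 < f.natDegree) {p : MvPolynomial (Fin J ⊕ Fin n) F}
    (hp : p ∈ inducedIdeal f Δ g) (h0 : p ≠ 0) : barDegree (mbar.degree p) ≠ 0 := by
  intro hz
  have hvars : ↑p.vars ⊆ Set.range (Sum.inr : Fin n → Fin J ⊕ Fin n) := by
    intro i hi
    obtain ⟨t, ht, hit⟩ := (mem_vars_iff_mem_support _).1 hi
    rcases i with i | i
    · exfalso
      have h1 : ¬ mbar.degree p ≺[mbar] t := not_lt.2 (mbar.le_degree ht)
      refine h1 (hmbar _ _ ?_)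
      change barDegree _ < barDegree _
      rw [hz]
      have : t (Sum.inl i) ≤ barDegree t := Finset.single_le_sum (f := fun j => t (Sum.inl j))
        (fun _ _ => Nat.zero_le _) (Finset.mem_univ i)
      have := Finsupp.mem_support_iff.1 hit
      omega
    · exact ⟨i, rfl⟩
  obtain ⟨c, rfl⟩ := exists_rename_eq_of_vars_subset_range p _ Sum.inr_injective hvars
  rw [inducedIdeal, RingHom.mem_ker] at hp
  change evalBar f Δ g _ = 0 at hp
  rw [evalBar_rename, toFracP_apply, toFrac_eq_zero_iff] at hp
  have := hl.eq_zero (isNormal_rename hd c) hp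
  exact h0 ((rename_injective _ Sum.inr_injective).eq_iff' (map_zero _) |>.1 this ▸ map_zero _)

end Evaluation

end Presentations

/-! ### Weights of induced relations -/

section Weights

/-- The weight of an exponent, as an element of the lexicographically ordered group `ℤ^n`. -/
noncomputable def lexWeight {σ : Type} {n : ℕ} (w : σ → Fin n → ℤ) :
    (σ →₀ ℕ) →+ Lex (Fin n → ℤ) where
  toFun a := toLex (Finsupp.weight w a)
  map_zero' := by simp
  map_add' a b := by rw [map_add]; rfl

variable {n : ℕ}

/-- The weight in `ℤ^n` that is given by a weight in `ℕ^n`. -/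
noncomputable abbrev natWeight (w : Unit ⊕ Fin n → Fin n → ℕ) :
    (Unit ⊕ Fin n →₀ ℕ) →+ Lex (Fin n → ℤ) :=
  lexWeight fun i k => (w i k : ℤ)

theorem natWeight_apply (w : Unit ⊕ Fin n → Fin n → ℕ) (a : Unit ⊕ Fin n →₀ ℕ) :
    natWeight w a = toLex fun k => ((Finsupp.weight w a k : ℕ) : ℤ) := by
  change toLex _ = toLex _
  congr 1
  ext k
  simp [Finsupp.weight_apply, Finsupp.sum, Finset.sum_apply]

theorem toLex_natCast_lt_iff {u v : Fin n → ℕ} :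
    (toLex fun k => (u k : ℤ)) < (toLex fun k => (v k : ℤ)) ↔ toLex u < toLex v := by
  constructor
  · rintro ⟨i, h1, h2⟩
    exact ⟨i, fun j hj => Int.natCast_inj.1 (h1 j hj), Int.ofNat_lt.1 h2⟩
  · rintro ⟨i, h1, h2⟩
    exact ⟨i, fun j hj => Int.natCast_inj.2 (h1 j hj), Int.ofNat_lt.2 h2⟩

theorem natWeight_lt_iff {w : Unit ⊕ Fin n → Fin n → ℕ} {a b : Unit ⊕ Fin n →₀ ℕ} :
    natWeight w a < natWeight w b ↔
      toLex (Finsupp.weight w a) < toLex (Finsupp.weight w b) := by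
  rw [natWeight_apply, natWeight_apply, toLex_natCast_lt_iff]

theorem natWeight_eq_iff {w : Unit ⊕ Fin n → Fin n → ℕ} {a b : Unit ⊕ Fin n →₀ ℕ} :
    natWeight w a = natWeight w b ↔ Finsupp.weight w a = Finsupp.weight w b := by
  refine ⟨fun h => ?_, fun h => by rw [natWeight_apply, natWeight_apply, h]⟩
  rw [natWeight_apply, natWeight_apply] at h
  ext k
  exact_mod_cast congrFun (toLex.injective h) k

theorem IsWeightOverGrevlex.natWeight_le {m : MonomialOrder (Unit ⊕ Fin n)}
    {w : Unit ⊕ Fin n → Fin n → ℕ} (hm : IsWeightOverGrevlex m w) {a b : Unit ⊕ Fin n →₀ ℕ}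
    (h : a ≼[m] b) : natWeight w a ≤ natWeight w b := by
  by_contra h'
  exact absurd (hm b a (Or.inl (natWeight_lt_iff.1 (not_le.1 h')))) (not_lt.2 h)

theorem IsWeightOverGrevlex.natWeight_le_degree {R : Type} [CommRing R]
    {m : MonomialOrder (Unit ⊕ Fin n)}
    {w : Unit ⊕ Fin n → Fin n → ℕ} (hm : IsWeightOverGrevlex m w)
    {p : MvPolynomial (Unit ⊕ Fin n) R} {a : Unit ⊕ Fin n →₀ ℕ} (h : a ∈ p.support) :
    natWeight w a ≤ natWeight w (m.degree p) :=
  hm.natWeight_le (m.le_degree h)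

variable {F : Type} [Field F] {J K : ℕ} {m : MonomialOrder (Unit ⊕ Fin n)}
  {mbar : MonomialOrder (Fin J ⊕ Fin n)} {w : Unit ⊕ Fin n → Fin n → ℕ}
  {f : Polynomial (MvPolynomial (Fin n) F)} {Δ : MvPolynomial (Fin n) F}
  {g : Fin (J + 1) → MvPolynomial (Unit ⊕ Fin n) F}
  {b : Fin K → MvPolynomial (Fin J ⊕ Fin n) F}

theorem lexWeight_mapDomain_inr (α : Fin n →₀ ℕ) :
    lexWeight (inducedWeight m w g) (α.mapDomain Sum.inr)
      = natWeight w (α.mapDomain Sum.inr) := by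
  change toLex _ = toLex _
  congr 1
  simp only [Finsupp.weight_apply]
  rw [Finsupp.sum_mapDomain_index (by simp) (by intros; rw [add_smul]),
    Finsupp.sum_mapDomain_index (by simp) (by intros; rw [add_smul])]
  rfl

theorem lexWeight_single_inl (j : Fin J) :
    lexWeight (inducedWeight m w g) (Finsupp.single (Sum.inl j) 1)
      = natWeight w (m.degree (g j.succ)) - natWeight w (m.degree (g 0)) := by
  rw [natWeight_apply, natWeight_apply]
  change toLex _ = toLex _
  congr 1
  rw [Finsupp.weight_single, one_smul]
  rfl

theorem lexWeight_barExp (j : Fin (J + 1)) (α : Fin n →₀ ℕ) :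
    lexWeight (inducedWeight m w g) (barExp j α) =
      natWeight w (α.mapDomain Sum.inr) + natWeight w (m.degree (g j))
        - natWeight w (m.degree (g 0)) := by
  rw [barExp, map_add, lexWeight_mapDomain_inr]
  refine Fin.cases ?_ (fun j => ?_) j
  · simp
  · rw [Fin.cases_succ, lexWeight_single_inl]; abel

/-- The leading monomial of `x^α g_j` has the induced weight of `x^α ȳ_j`, up to the weight of
`g_0 = Δ`. -/
theorem natWeight_degree_barMul (hg : ∀ j, m.Monic (g j)) {t : Fin J ⊕ Fin n →₀ ℕ}
    (ht : barDegree t ≤ 1) :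
    natWeight w (m.degree (barMul g t)) =
      lexWeight (inducedWeight m w g) t + natWeight w (m.degree (g 0)) := by
  rw [(monic_barMul hg t).2, map_add]
  conv_rhs => rw [eq_barExp ht, lexWeight_barExp]
  abel

section

variable (hl : IsLedByPower m f) (hf : f.Monic) (hc : IsCanonical m f Δ g)
  (hm : IsWeightOverGrevlex m w)
  (hw : ∀ t ∈ (evalY f).support,
    natWeight w t ≤ natWeight w (Finsupp.single (Sum.inl ()) f.natDegree))
include hl hf hc hm hw

/-- Elements of the integral closure have numerators whose weights are bounded by the induced
weights: multiplication in `S` does not increase weights. -/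
theorem IsCanonical.exists_numerator (t : Fin J ⊕ Fin n →₀ ℕ) :
    ∃ H, IsNormal f.natDegree H ∧ toFracP f Δ * evalBar f Δ g (monomial t 1) = toFrac f H ∧
      ∀ s ∈ H.support, natWeight w s ≤
        lexWeight (inducedWeight m w g) t + natWeight w (m.degree (g 0)) := by
  classical
  set Ω := lexWeight (inducedWeight m w g)
  have hbase : ∀ t : Fin J ⊕ Fin n →₀ ℕ, barDegree t ≤ 1 → ∃ H, IsNormal f.natDegree H ∧
      toFracP f Δ * evalBar f Δ g (monomial t 1) = toFrac f H ∧
      ∀ s ∈ H.support, natWeight w s ≤ Ω t + natWeight w (m.degree (g 0)) := by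
    intro t ht
    have hsupp : (monomial t (1 : F)).support = {t} := by
      rw [support_monomial, if_neg one_ne_zero]
    refine ⟨barMul g t, IsNormal.barMul hc.normal t, ?_, fun s hs => ?_⟩
    · rw [toFracP_mul_evalBar (hc.isUnit hl) hc.zero (fun s hs => ?_), barSum_monomial_one]
      rw [hsupp, Finset.mem_singleton] at hs
      exact hs ▸ ht
    · rw [← natWeight_degree_barMul hc.monic ht]
      exact hm.natWeight_le_degree hs
  have hadd : ∀ t₁ t₂ : Fin J ⊕ Fin n →₀ ℕ,
      (∃ H, IsNormal f.natDegree H ∧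
        toFracP f Δ * evalBar f Δ g (monomial t₁ 1) = toFrac f H ∧
        ∀ s ∈ H.support, natWeight w s ≤ Ω t₁ + natWeight w (m.degree (g 0))) →
      (∃ H, IsNormal f.natDegree H ∧
        toFracP f Δ * evalBar f Δ g (monomial t₂ 1) = toFrac f H ∧
        ∀ s ∈ H.support, natWeight w s ≤ Ω t₂ + natWeight w (m.degree (g 0))) →
      (∃ H, IsNormal f.natDegree H ∧
        toFracP f Δ * evalBar f Δ g (monomial (t₁ + t₂) 1) = toFrac f H ∧
        ∀ s ∈ H.support, natWeight w s ≤ Ω (t₁ + t₂) + natWeight w (m.degree (g 0))) := by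
    rintro t₁ t₂ ⟨H₁, hn₁, he₁, hs₁⟩ ⟨H₂, hn₂, he₂, hs₂⟩
    obtain ⟨r, hr⟩ := ((hc.range_evalBar hl hf).subset ⟨monomial (t₁ + t₂) 1, rfl⟩).2
    obtain ⟨H, hrH, hn⟩ := hl.exists_normal r
    have hz : toFracP f Δ * evalBar f Δ g (monomial (t₁ + t₂) 1) = toFrac f H :=
      hr.trans (toFrac_eq_iff.2 hrH)
    refine ⟨H, hn, hz, ?_⟩
    obtain ⟨N, hN, hNn, hNs⟩ :=
      exists_normal_of_monic hl.monic hl.degree (natWeight w) hw (H₁ * H₂)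
    -- The product of numerators is `Δ` times the numerator of the product.
    have hprod : g 0 * H = N := by
      refine (toFrac_eq_iff_of_normal hl ?_ hNn).1 ?_
      · rw [hc.zero]; exact hn.rename_mul _
      · rw [← toFrac_eq_iff.2 hN, map_mul, map_mul, ← he₁, ← he₂, hc.zero, ← toFracP_apply, ← hz]
        have : (monomial (t₁ + t₂) (1 : F) : MvPolynomial (Fin J ⊕ Fin n) F)
            = monomial t₁ 1 * monomial t₂ 1 := by rw [monomial_mul, one_mul]
        rw [this, map_mul]
        ring
    intro s hs
    have hH0 : H ≠ 0 := by rintro rfl; simp at hs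
    have h0 : g 0 ≠ 0 := (hc.monic 0).ne_zero
    have hmem : m.degree (g 0) + m.degree H ∈ N.support := by
      rw [← m.degree_mul h0 hH0, hprod, m.degree_mem_support_iff, ← hprod]
      exact mul_ne_zero h0 hH0
    obtain ⟨u, hu, hle⟩ := hNs _ hmem
    obtain ⟨u₁, hu₁, u₂, hu₂, rfl⟩ := Finset.mem_add.1 (support_mul _ _ hu)
    have h1 := hs₁ _ hu₁
    have h2 := hs₂ _ hu₂
    have h3 := hm.natWeight_le_degree hs
    rw [map_add, map_add] at hle
    have h4 := hle.trans (add_le_add h1 h2)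
    have h5 : natWeight w (m.degree (g 0)) + natWeight w (m.degree H) ≤
        natWeight w (m.degree (g 0)) + (Ω (t₁ + t₂) + natWeight w (m.degree (g 0))) := by
      refine h4.trans (le_of_eq ?_)
      rw [map_add]; abel
    exact h3.trans (le_of_add_le_add_left h5)
  induction t using Finsupp.induction_linear with
  | zero => exact hbase 0 (by simp [barDegree])
  | add t₁ t₂ h₁ h₂ => exact hadd t₁ t₂ h₁ h₂
  | single i k =>
    induction k with
    | zero => rw [Finsupp.single_zero]; exact hbase 0 (by simp [barDegree])
    | succ k ih =>
      rw [Finsupp.single_add]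
      refine hadd _ _ ih (hbase _ ?_)
      rcases i with i | i
      · simp
      · simp [barDegree]

end

section

variable (hl : IsLedByPower m f) (hf : f.Monic) (hm : IsWeightOverGrevlex m w)
  (hw : ∀ t ∈ (evalY f).support,
    natWeight w t ≤ natWeight w (Finsupp.single (Sum.inl ()) f.natDegree))
  (hmbar : IsDependentDegreeFirst mbar)
  (hp : IsCanonicalPresentation m mbar w f Δ g b)

include hl hf hmbar hp

theorem IsCanonicalPresentation.barDegree_le_one {t : Fin J ⊕ Fin n →₀ ℕ}
    (ht : IsStandard (fun k => mbar.degree (b k)) t) : barDegree t ≤ 1 := by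
  by_contra h
  obtain ⟨i, j, hij⟩ : ∃ i j : Fin J,
      Finsupp.single (Sum.inl i) 1 + Finsupp.single (Sum.inl j) 1 ≤ t := by
    have h2 : 1 < ∑ j, t (Sum.inl j) := not_le.1 h
    obtain ⟨i, -, hi⟩ : ∃ i ∈ Finset.univ, t (Sum.inl i) ≠ 0 :=
      Finset.exists_ne_zero_of_sum_ne_zero (by omega)
    have h3 : Finsupp.single (Sum.inl i) 1 ≤ t := by rw [Finsupp.single_le_iff]; omega
    obtain ⟨u, rfl⟩ := exists_add_of_le h3
    have h4 : barDegree u ≠ 0 := by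
      have : ¬ barDegree (Finsupp.single (Sum.inl i) 1 + u) ≤ 1 := h
      rw [barDegree_add, barDegree_single_inl] at this
      omega
    obtain ⟨j, -, hj⟩ := Finset.exists_ne_zero_of_sum_ne_zero h4
    refine ⟨i, j, add_le_add_right ?_ _⟩
    rw [Finsupp.single_le_iff]; omega
  obtain ⟨k, hk⟩ := hp.canonical.exists_degree_le hl hf hmbar hp.groebner.1 i j
  exact ht k (hk.trans hij)

theorem IsCanonicalPresentation.injOn_degree_barMul :
    Set.InjOn (fun t => m.degree (barMul g t))
      {t | IsStandard (fun k => mbar.degree (b k)) t} := by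
  intro t ht t' ht' h
  refine hp.distinct t t' ht ht' ?_
  have h1 := congrArg (natWeight w) h
  simp only at h1
  rw [natWeight_degree_barMul hp.canonical.monic (hp.barDegree_le_one hl hf hmbar ht),
    natWeight_degree_barMul hp.canonical.monic (hp.barDegree_le_one hl hf hmbar ht')] at h1
  exact toLex.injective (add_right_cancel h1)

/-- The numerators of the elements of the integral closure are the linear combinations of the
`x^α g_j` for which `x^α ȳ_j` is standard. -/
theorem IsCanonicalPresentation.exists_eq_barSum {H : MvPolynomial (Unit ⊕ Fin n) F}
    (hH : IsNormal f.natDegree H) {z : FracS f} (hz : z ∈ closureIn f Δ)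
    (hHz : toFracP f Δ * z = toFrac f H) :
    ∃ p : MvPolynomial (Fin J ⊕ Fin n) F,
      (∀ t ∈ p.support, IsStandard (fun k => mbar.degree (b k)) t) ∧ H = barSum g p := by
  obtain ⟨p₀, rfl⟩ := (hp.canonical.range_evalBar hl hf).symm.subset hz
  obtain ⟨p, hpp, hs⟩ := exists_standard mbar hp.groebner.2.1 (fun _ => rfl) p₀
  refine ⟨p, hs, (toFrac_eq_iff_of_normal hl hH
    (IsNormal.barSum hp.canonical.normal p)).1 ?_⟩
  rw [← toFracP_mul_evalBar (hp.canonical.isUnit hl) hp.canonical.zero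
    fun t ht => hp.barDegree_le_one hl hf hmbar (hs t ht), ← hHz]
  congr 1
  rw [hp.groebner.1.1, inducedIdeal, RingHom.mem_ker] at hpp
  change evalBar f Δ g _ = 0 at hpp
  rwa [map_sub, sub_eq_zero] at hpp

include hm hw

/-- In an element of the reduced Gröbner basis, the leading monomial has the largest weight. -/
theorem IsCanonicalPresentation.lexWeight_le (k : Fin K) {t : Fin J ⊕ Fin n →₀ ℕ}
    (ht : t ∈ (b k).support) :
    lexWeight (inducedWeight m w g) t ≤
      lexWeight (inducedWeight m w g) (mbar.degree (b k)) := by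
  classical
  set e := mbar.degree (b k) with he
  by_cases hte : t = e
  · rw [hte]
  set p := monomial e 1 - b k with hpdef
  have hcoeff : ∀ s, s ≠ e → p.coeff s = - (b k).coeff s := by
    intro s hs
    rw [hpdef, coeff_sub, coeff_monomial, if_neg hs.symm, zero_sub]
  have hcoeffe : p.coeff e = 0 := by
    rw [hpdef, coeff_sub, coeff_monomial, if_pos rfl, he, (hp.groebner.2.1 k).coeff_degree,
      sub_self]
  have hstd : ∀ s ∈ p.support, IsStandard (fun k => mbar.degree (b k)) s := by
    intro s hs k' hk'
    have hse : s ≠ e := by rintro rfl; exact (mem_support_iff.1 hs) hcoeffe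
    have hsb : s ∈ (b k).support := by
      rw [mem_support_iff, hcoeff s hse, neg_ne_zero] at hs
      exact mem_support_iff.2 hs
    by_cases hkk : k = k'
    · subst hkk
      refine hse (mbar.toSyn.injective (le_antisymm (mbar.le_degree hsb) ?_))
      exact mbar.toSyn_monotone hk'
    · exact hp.groebner.2.2 k k' hkk s hsb hk'
  have htp : t ∈ p.support := by
    rw [mem_support_iff, hcoeff t hte, neg_ne_zero]
    exact mem_support_iff.1 ht
  obtain ⟨H, hn, hH, hHs⟩ := hp.canonical.exists_numerator hl hf hm hw e
  have hHp : H = barSum g p := by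
    refine (toFrac_eq_iff_of_normal hl hn (IsNormal.barSum hp.canonical.normal p)).1 ?_
    rw [← toFracP_mul_evalBar (hp.canonical.isUnit hl) hp.canonical.zero
      fun t ht => hp.barDegree_le_one hl hf hmbar (hstd t ht), ← hH]
    congr 1
    have : b k ∈ inducedIdeal f Δ g := by
      rw [← hp.groebner.1.1]; exact Ideal.subset_span ⟨k, rfl⟩
    rw [inducedIdeal, RingHom.mem_ker] at this
    change evalBar f Δ g _ = 0 at this
    rw [hpdef, map_sub, this, sub_zero]
  obtain ⟨hne, u, hu, hdeg, hmax⟩ := exists_degree_sum_eq m (T := p.support) ⟨t, htp⟩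
    (c := fun t => p.coeff t) (fun s hs => mem_support_iff.1 hs)
    (h := barMul g) (fun s _ => (monic_barMul hp.canonical.monic s).1)
    ((hp.injOn_degree_barMul hl hf hmbar).mono hstd)
  change m.degree (barSum g p) = _ at hdeg
  have hH0 : H ≠ 0 := hHp ▸ hne
  have h1 := hHs _ (m.degree_mem_support hH0)
  rw [hHp, hdeg] at h1
  have h2 := (hm.natWeight_le (hmax t htp)).trans h1
  rw [natWeight_degree_barMul hp.canonical.monic
    (hp.barDegree_le_one hl hf hmbar (hstd t htp))] at h2
  exact le_of_add_le_add_right h2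

end

end Weights

/-! ### Rings of type I -/

section TypeI

theorem IsWeightFunction.neg {F : Type} [Field F] {n : ℕ} {A : Type} [CommRing A] [Algebra F A]
    {wt : A → Fin n → ℕ} (h : IsWeightFunction F wt) {g : A} (hg : g ≠ 0) : wt (-g) = wt g := by
  have h1 : algebraMap F A (-1) = -1 := by simp
  have h2 : (-1 : A) ≠ 0 := neg_ne_zero.2 fun h => hg (by rw [← one_mul g, h, zero_mul])
  rw [← neg_one_mul, h.mul _ _ h2 hg, ← h1, h.const _ (by simp), zero_add]

theorem IsWeightFunction.add_of_lt {F : Type} [Field F] {n : ℕ} {A : Type} [CommRing A]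
    [Algebra F A] {wt : A → Fin n → ℕ} (h : IsWeightFunction F wt) {g g' : A} (hg : g ≠ 0)
    (hg' : g' ≠ 0) (hlt : toLex (wt g) < toLex (wt g')) : g + g' ≠ 0 ∧ wt (g + g') = wt g' := by
  have h0 : g + g' ≠ 0 := fun h0 => by
    rw [eq_neg_of_add_eq_zero_left h0, h.neg hg'] at hlt
    exact lt_irrefl _ hlt
  refine ⟨h0, toLex.injective (le_antisymm ?_ ?_)⟩
  · simpa [max_eq_right hlt.le] using h.add_le g g' hg hg' h0
  · have h1 := h.add_le (g + g') (-g) h0 (neg_ne_zero.2 hg) (by simpa using hg')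
    rw [add_neg_cancel_comm, h.neg hg, le_max_iff] at h1
    exact h1.resolve_right (not_le.2 hlt)

variable {F : Type} [Field F] {n : ℕ} {f : Polynomial (MvPolynomial (Fin n) F)}
  {wt : InputRing f → Fin n → ℕ} {w : Unit ⊕ Fin n → Fin n → ℕ}

theorem natDegree_pos_of_isPrime (hf : f.Monic) (hprime : (inputIdeal f).IsPrime) :
    0 < f.natDegree := by
  rw [pos_iff_ne_zero]
  intro h
  have h1 : f = 1 := Polynomial.eq_one_of_monic_natDegree_zero hf h
  refine hprime.ne_top ((Ideal.eq_top_iff_one _).2 (Ideal.subset_span ?_))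
  simp [h1, evalY]

theorem isNormal_monomial {R : Type} [CommRing R] {d : ℕ} {a : Unit ⊕ Fin n →₀ ℕ}
    (ha : a (Sum.inl ()) < d) (c : R) : IsNormal d (monomial a c) := by
  intro s hs
  have := support_monomial_subset hs
  rw [Finset.mem_singleton] at this
  exact this ▸ ha

theorem IsTypeI.wt_mk_monomial (hwt : IsTypeI f wt w) (hprime : (inputIdeal f).IsPrime)
    {a : Unit ⊕ Fin n →₀ ℕ} (ha : ∀ i, a i ≠ 0 → X i ∉ inputIdeal f) :
    (monomial a 1 : MvPolynomial (Unit ⊕ Fin n) F) ∉ inputIdeal f ∧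
      wt (Ideal.Quotient.mk (inputIdeal f) (monomial a 1)) = Finsupp.weight w a := by
  classical
  have hone : (monomial 0 (1 : F) : MvPolynomial (Unit ⊕ Fin n) F) ∉ inputIdeal f ∧
      wt (Ideal.Quotient.mk (inputIdeal f) (monomial 0 1)) =
        Finsupp.weight w (0 : Unit ⊕ Fin n →₀ ℕ) := by
    refine ⟨fun h => hprime.ne_top ((Ideal.eq_top_iff_one _).2 h), ?_⟩
    have := hwt.weight.const 1 one_ne_zero
    rw [map_zero, ← this]
    rfl
  have hmul : ∀ a b : Unit ⊕ Fin n →₀ ℕ,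
      (monomial a (1 : F) ∉ inputIdeal f ∧
        wt (Ideal.Quotient.mk (inputIdeal f) (monomial a 1)) = Finsupp.weight w a) →
      (monomial b (1 : F) ∉ inputIdeal f ∧
        wt (Ideal.Quotient.mk (inputIdeal f) (monomial b 1)) = Finsupp.weight w b) →
      (monomial (a + b) (1 : F) ∉ inputIdeal f ∧
        wt (Ideal.Quotient.mk (inputIdeal f) (monomial (a + b) 1)) = Finsupp.weight w (a + b)) := by
    rintro a b ⟨ha, ha'⟩ ⟨hb, hb'⟩
    have hab : (monomial (a + b) (1 : F)) = monomial a 1 * monomial b 1 := by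
      rw [monomial_mul, one_mul]
    rw [hab]
    refine ⟨fun h => (hprime.mem_or_mem h).elim ha hb, ?_⟩
    rw [map_mul, hwt.weight.mul _ _ (Ideal.Quotient.eq_zero_iff_mem.not.2 ha)
      (Ideal.Quotient.eq_zero_iff_mem.not.2 hb), ha', hb', map_add]
  induction a using Finsupp.induction_linear with
  | zero => exact hone
  | add a b iha ihb =>
    refine hmul a b (iha fun i hi => ha i ?_) (ihb fun i hi => ha i ?_)
    · rw [Finsupp.add_apply]; omega
    · rw [Finsupp.add_apply]; omega
  | single i k =>
    induction k with
    | zero => rw [Finsupp.single_zero]; exact hone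
    | succ k ih =>
      have hi : X i ∉ inputIdeal f := ha i (by simp)
      rw [Finsupp.single_add]
      refine hmul _ _ (ih fun j hj => ?_) ⟨hi, ?_⟩
      · by_cases hji : j = i
        · rwa [hji]
        · rw [Finsupp.single_eq_of_ne hji] at hj; exact absurd rfl hj
      · change wt (Ideal.Quotient.mk (inputIdeal f) (X i)) = _
        rw [hwt.wt_var i hi, Finsupp.weight_single, one_smul]

theorem IsTypeI.wt_mk_normal_monomial (hwt : IsTypeI f wt w) (hf : f.Monic)
    (hprime : (inputIdeal f).IsPrime) {a : Unit ⊕ Fin n →₀ ℕ}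
    (ha : a (Sum.inl ()) < f.natDegree) {c : F} (hc : c ≠ 0) :
    Ideal.Quotient.mk (inputIdeal f) (monomial a c) ≠ 0 ∧
      wt (Ideal.Quotient.mk (inputIdeal f) (monomial a c)) = Finsupp.weight w a := by
  obtain ⟨h1, h2⟩ := hwt.wt_mk_monomial hprime (a := a) fun i hi hX => by
    have : IsNormal f.natDegree (X i : MvPolynomial (Unit ⊕ Fin n) F) := by
      refine isNormal_monomial ?_ 1
      rcases i with i | i
      · change a (Sum.inl ()) ≠ 0 at hi
        rw [Finsupp.single_eq_same]; omega
      · simpa using natDegree_pos_of_isPrime hf hprime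
    exact X_ne_zero i (eq_zero_of_isNormal hf this hX)
  have h3 : Ideal.Quotient.mk (inputIdeal f) (monomial a c)
      = algebraMap F (InputRing f) c * Ideal.Quotient.mk (inputIdeal f) (monomial a 1) := by
    have : monomial a c = C c * monomial a (1 : F) := by rw [C_mul_monomial, mul_one]
    rw [this, map_mul]
    rfl
  have h4 : Ideal.Quotient.mk (inputIdeal f) (monomial a c) ≠ 0 := by
    rw [Ne, Ideal.Quotient.eq_zero_iff_mem]
    intro h
    exact hc ((monomial_eq_zero).1 (eq_zero_of_isNormal hf (isNormal_monomial ha c) h))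
  refine ⟨h4, ?_⟩
  rw [h3] at h4 ⊢
  rw [hwt.weight.mul _ _ (left_ne_zero_of_mul h4) (right_ne_zero_of_mul h4),
    hwt.weight.const c hc, h2, zero_add]

/-- The weight of a normal form is the largest weight of a monomial in it. -/
theorem IsTypeI.exists_wt_mk_eq (hwt : IsTypeI f wt w) (hf : f.Monic)
    (hprime : (inputIdeal f).IsPrime) {p : MvPolynomial (Unit ⊕ Fin n) F} (hp0 : p ≠ 0)
    (hp : IsNormal f.natDegree p) :
    (∃ a ∈ p.support, wt (Ideal.Quotient.mk (inputIdeal f) p) = Finsupp.weight w a) ∧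
      ∀ a ∈ p.support, toLex (Finsupp.weight w a) ≤
        toLex (wt (Ideal.Quotient.mk (inputIdeal f) p)) := by
  classical
  induction p using MvPolynomial.monomial_add_induction_on with
  | C c =>
    have hc : c ≠ 0 := fun h => hp0 (by rw [h, C_0])
    obtain ⟨-, h2⟩ := hwt.wt_mk_normal_monomial hf hprime (a := 0)
      (by simpa using natDegree_pos_of_isPrime hf hprime) hc
    change wt (Ideal.Quotient.mk (inputIdeal f) (C c)) = _ at h2
    have hs : (C c : MvPolynomial (Unit ⊕ Fin n) F).support = {0} := by
      rw [← monomial_zero', support_monomial, if_neg hc]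
    rw [hs, h2]
    simp
  | monomial_add a c p ha hc ih =>
    have hcoeffa : p.coeff a = 0 := notMem_support_iff.1 ha
    have hs : (monomial a c + p).support = insert a p.support := by
      ext s
      rw [Finset.mem_insert, mem_support_iff, mem_support_iff, coeff_add, coeff_monomial]
      by_cases h : a = s
      · subst h; simp [hcoeffa, hc]
      · rw [if_neg h, zero_add]
        simp [Ne.symm h]
    have had : a (Sum.inl ()) < f.natDegree := hp a (by rw [hs]; exact Finset.mem_insert_self _ _)
    have hpn : IsNormal f.natDegree p := fun s hsp => hp s (by
      rw [hs]; exact Finset.mem_insert_of_mem hsp)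
    obtain ⟨ha0, haw⟩ := hwt.wt_mk_normal_monomial hf hprime had hc
    rw [hs]
    by_cases hp0' : p = 0
    · subst hp0'
      rw [add_zero, haw]
      simp
    obtain ⟨⟨s, hsp, hsw⟩, hle⟩ := ih hp0' hpn
    have hpI : Ideal.Quotient.mk (inputIdeal f) p ≠ 0 := by
      rw [Ne, Ideal.Quotient.eq_zero_iff_mem]
      exact fun h => hp0' (eq_zero_of_isNormal hf hpn h)
    have hne : toLex (Finsupp.weight w a) ≠ toLex (Finsupp.weight w s) := fun h =>
      ha (hwt.distinct a s had (hpn s hsp) (toLex.injective h) ▸ hsp)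
    rw [map_add]
    rcases hne.lt_or_gt with hlt | hlt
    · obtain ⟨-, h2⟩ := hwt.weight.add_of_lt ha0 hpI (by rwa [haw, hsw])
      rw [h2]
      refine ⟨⟨s, Finset.mem_insert_of_mem hsp, hsw⟩, fun t ht => ?_⟩
      rcases Finset.mem_insert.1 ht with rfl | ht
      · rw [hsw]; exact hlt.le
      · exact hle t ht
    · obtain ⟨-, h2⟩ := hwt.weight.add_of_lt hpI ha0 (by rwa [haw, hsw])
      rw [add_comm, h2, haw]
      refine ⟨⟨a, Finset.mem_insert_self _ _, rfl⟩, fun t ht => ?_⟩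
      rcases Finset.mem_insert.1 ht with rfl | ht
      · exact le_rfl
      · exact (hle t ht).trans (by rw [hsw]; exact hlt.le)

theorem IsTypeI.wt_mk (hwt : IsTypeI f wt w) (hf : f.Monic) (hprime : (inputIdeal f).IsPrime)
    {m : MonomialOrder (Unit ⊕ Fin n)} (hm : IsWeightOverGrevlex m w)
    {p : MvPolynomial (Unit ⊕ Fin n) F} (hp0 : p ≠ 0) (hp : IsNormal f.natDegree p) :
    wt (Ideal.Quotient.mk (inputIdeal f) p) = Finsupp.weight w (m.degree p) := by
  obtain ⟨⟨a, ha, hwa⟩, hle⟩ := hwt.exists_wt_mk_eq hf hprime hp0 hp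
  refine toLex.injective (le_antisymm ?_ (hle _ (m.degree_mem_support hp0)))
  rw [hwa]
  have := hm.natWeight_le_degree ha
  by_contra h
  exact absurd (natWeight_lt_iff.2 (not_le.1 h)) (not_lt.2 this)

/-- Weights of leading monomials are additive for products in `S`. -/
theorem IsTypeI.natWeight_add_eq (hwt : IsTypeI f wt w) (hf : f.Monic)
    (hprime : (inputIdeal f).IsPrime) {m : MonomialOrder (Unit ⊕ Fin n)}
    (hm : IsWeightOverGrevlex m w) {p p' q q' : MvPolynomial (Unit ⊕ Fin n) F} (hp0 : p ≠ 0)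
    (hp0' : p' ≠ 0) (hq0 : q ≠ 0) (hq0' : q' ≠ 0) (hp : IsNormal f.natDegree p)
    (hp' : IsNormal f.natDegree p') (hq : IsNormal f.natDegree q) (hq' : IsNormal f.natDegree q')
    (h : p * p' - q * q' ∈ inputIdeal f) :
    natWeight w (m.degree p) + natWeight w (m.degree p') =
      natWeight w (m.degree q) + natWeight w (m.degree q') := by
  have hne : ∀ r : MvPolynomial (Unit ⊕ Fin n) F, r ≠ 0 → IsNormal f.natDegree r →
      Ideal.Quotient.mk (inputIdeal f) r ≠ 0 := fun r h0 hn h =>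
    h0 (eq_zero_of_isNormal hf hn (Ideal.Quotient.eq_zero_iff_mem.1 h))
  have h1 := (Ideal.Quotient.mk_eq_mk_iff_sub_mem _ _).2 h
  have h2 := congrArg wt h1
  rw [map_mul, map_mul, hwt.weight.mul _ _ (hne p hp0 hp) (hne p' hp0' hp'),
    hwt.weight.mul _ _ (hne q hq0 hq) (hne q' hq0' hq'), hwt.wt_mk hf hprime hm hp0 hp,
    hwt.wt_mk hf hprime hm hp0' hp', hwt.wt_mk hf hprime hm hq0 hq,
    hwt.wt_mk hf hprime hm hq0' hq', ← map_add, ← map_add] at h2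
  rw [← map_add, ← map_add]
  exact natWeight_eq_iff.2 h2

/-- No monomial of `f(y)` has larger weight than `y^d`. -/
theorem IsTypeI.natWeight_le (hwt : IsTypeI f wt w) (hf : f.Monic)
    (hprime : (inputIdeal f).IsPrime) {t : Unit ⊕ Fin n →₀ ℕ} (ht : t ∈ (evalY f).support) :
    natWeight w t ≤ natWeight w (Finsupp.single (Sum.inl ()) f.natDegree) := by
  classical
  have hpos := natDegree_pos_of_isPrime hf hprime
  have hI : evalY f ∈ inputIdeal f := Ideal.subset_span rfl
  set r := monomial (Finsupp.single (Sum.inl ()) f.natDegree) (1 : F) - evalY f with hr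
  have hrn : IsNormal f.natDegree r := by
    intro a ha
    have hae : a ≠ Finsupp.single (Sum.inl ()) f.natDegree := by
      rintro rfl
      rw [mem_support_iff, hr, coeff_sub, coeff_monomial, if_pos rfl,
        coeff_single_natDegree_evalY hf, sub_self] at ha
      exact ha rfl
    rw [mem_support_iff, hr, coeff_sub, coeff_monomial, if_neg hae.symm, zero_sub,
      neg_ne_zero] at ha
    exact (eq_single_or_lt_of_mem_support_evalY hf (mem_support_iff.2 ha)).resolve_left hae
  rcases eq_single_or_lt_of_mem_support_evalY hf ht with rfl | htlt
  · exact le_rfl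
  have hte : Finsupp.single (Sum.inl ()) f.natDegree ≠ t := by
    rintro rfl; simp at htlt
  have htr : t ∈ r.support := by
    rw [mem_support_iff, hr, coeff_sub, coeff_monomial, if_neg hte, zero_sub, neg_ne_zero]
    exact mem_support_iff.1 ht
  have hr0 : r ≠ 0 := fun h => by rw [h] at htr; simp at htr
  -- If `y = 0` in `S`, then `f(y) = y`, and the weight of `y` plays no role.
  have hy : X (Sum.inl ()) ∉ inputIdeal f := by
    intro hy
    refine hr0 (eq_zero_of_isNormal hf hrn (Ideal.sub_mem _ ?_ hI))
    rw [← X_pow_eq_monomial]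
    exact Ideal.pow_mem_of_mem _ hy _ hpos
  obtain ⟨-, h2⟩ := hwt.wt_mk_monomial hprime
    (a := Finsupp.single (Sum.inl ()) f.natDegree) (fun i hi => by
      have : i = Sum.inl () := by
        by_contra h
        exact hi (Finsupp.single_eq_of_ne h)
      rwa [this])
  have h3 : Ideal.Quotient.mk (inputIdeal f) r = Ideal.Quotient.mk (inputIdeal f)
      (monomial (Finsupp.single (Sum.inl ()) f.natDegree) 1) := by
    rw [hr, map_sub, Ideal.Quotient.eq_zero_iff_mem.2 hI, sub_zero]
  have h4 := (hwt.exists_wt_mk_eq hf hprime hr0 hrn).2 t htr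
  rw [h3, h2] at h4
  by_contra h
  exact absurd (natWeight_lt_iff.1 (not_le.1 h)) (not_lt.2 h4)

/-- If the monomials of `f(y)` have at most the weight of `y^d`, then `y^d` is the leading
term. -/
theorem isLedByPower_of_natWeight_le (hf : f.Monic) {m : MonomialOrder (Unit ⊕ Fin n)}
    (hm : IsWeightOverGrevlex m w) (h : ∀ t ∈ (evalY f).support,
      natWeight w t ≤ natWeight w (Finsupp.single (Sum.inl ()) f.natDegree)) :
    IsLedByPower m f := by
  have hdeg : m.degree (evalY f) = Finsupp.single (Sum.inl ()) f.natDegree := by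
    refine m.toSyn.injective (le_antisymm (m.degree_le_iff.2 fun t ht => ?_) (m.le_degree ?_))
    · rcases eq_single_or_lt_of_mem_support_evalY hf ht with rfl | htlt
      · exact le_rfl
      · refine (hm _ _ ?_).le
        rcases (h t ht).lt_or_eq with h1 | h1
        · exact Or.inl (natWeight_lt_iff.1 h1)
        · exact Or.inr ⟨natWeight_eq_iff.1 h1, by simpa using htlt⟩
    · rw [mem_support_iff, coeff_single_natDegree_evalY hf]
      exact one_ne_zero
  refine ⟨hf, ?_, hdeg⟩
  rw [MonomialOrder.Monic, MonomialOrder.leadingCoeff, hdeg]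
  exact coeff_single_natDegree_evalY hf

end TypeI

/-! ### Reduction of polynomials modulo a prime element -/

section ReductionModPrime

/-- `A` is a ring like `ℤ_(q)`: a subring (via `ι`) of a field `K`, which is obtained by inverting
`π`, with residue field `k` (via `red`) modulo `π`, and separated for the `π`-adic topology. -/
structure IsReduction {A K k : Type} [CommRing A] [Field K] [Field k] (ι : A →+* K)
    (red : A →+* k) (π : A) : Prop where
  injective : Function.Injective ι
  surjective : Function.Surjective red
  red_eq_zero : ∀ a, red a = 0 ↔ π ∣ a
  ne_zero : π ≠ 0
  exists_mul_eq : ∀ x : K, ∃ (i : ℕ) (a : A), ι (π ^ i) * x = ι a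
  exists_not_dvd : ∀ a : A, a ≠ 0 → ∃ i : ℕ, ¬ π ^ (i + 1) ∣ a

variable {A K k : Type} [CommRing A] [Field K] [Field k] {ι : A →+* K} {red : A →+* k} {π : A}
  {σ : Type}

namespace IsReduction

variable (hr : IsReduction ι red π)
include hr

theorem isDomain : IsDomain A := hr.injective.isDomain ι

theorem map_injective : Function.Injective (map ι : MvPolynomial σ A → MvPolynomial σ K) :=
  MvPolynomial.map_injective ι hr.injective

theorem support_map (p : MvPolynomial σ A) : (map ι p).support = p.support :=
  support_map_of_injective p hr.injective

theorem degree_map (m : MonomialOrder σ) (p : MvPolynomial σ A) :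
    m.degree (map ι p) = m.degree p := by
  rw [MonomialOrder.degree, MonomialOrder.degree, hr.support_map]

theorem isNormal_map_iff {n d : ℕ} {p : MvPolynomial (Unit ⊕ Fin n) A} :
    IsNormal d (map ι p) ↔ IsNormal d p := by
  rw [IsNormal, IsNormal, hr.support_map]

theorem exists_lift (p : MvPolynomial σ k) :
    ∃ p' : MvPolynomial σ A, map red p' = p ∧ p'.support ⊆ p.support := by
  classical
  choose s hs using hr.surjective
  refine ⟨∑ t ∈ p.support, monomial t (s (p.coeff t)), ?_, ?_⟩
  · rw [map_sum]
    simp only [map_monomial, hs]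
    exact support_sum_monomial_coeff p
  · intro t ht
    have := MvPolynomial.support_sum ht
    simp only [Finset.mem_biUnion] at this
    obtain ⟨u, hu, htu⟩ := this
    have := support_monomial_subset htu
    rw [Finset.mem_singleton] at this
    exact this ▸ hu

theorem exists_eq_mul_of_map_eq_zero {p : MvPolynomial σ A} (hp : map red p = 0) :
    ∃ p', p = C π * p' := by
  refine (C_dvd_iff_dvd_coeff _ _).2 fun t => (hr.red_eq_zero _).1 ?_
  rw [← coeff_map, hp, coeff_zero]

theorem exists_C_mul_eq_map (p : MvPolynomial σ K) :
    ∃ (i : ℕ) (p' : MvPolynomial σ A), C (ι (π ^ i)) * p = map ι p' := by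
  induction p using MvPolynomial.induction_on with
  | C x =>
    obtain ⟨i, a, h⟩ := hr.exists_mul_eq x
    exact ⟨i, C a, by rw [map_C, ← h, C_mul]⟩
  | add p q hp hq =>
    obtain ⟨i, p', hp⟩ := hp
    obtain ⟨j, q', hq⟩ := hq
    refine ⟨i + j, C (π ^ j) * p' + C (π ^ i) * q', ?_⟩
    rw [map_add, map_mul, map_mul, ← hp, ← hq, map_C, map_C, pow_add, map_mul, C_mul]
    ring
  | mul_X p s hp =>
    obtain ⟨i, p', hp⟩ := hp
    exact ⟨i, p' * X s, by rw [map_mul, ← hp, map_X, mul_assoc]⟩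

theorem ι_ne_zero : ι π ≠ 0 := (map_ne_zero_iff ι hr.injective).2 hr.ne_zero

theorem C_ne_zero (i : ℕ) : (C (ι (π ^ i)) : MvPolynomial σ K) ≠ 0 := by
  rw [Ne, C_eq_zero, map_pow]
  exact pow_ne_zero _ hr.ι_ne_zero

/-- Up to a power of `π`, every nonzero polynomial is primitive. -/
theorem exists_primitive {p : MvPolynomial σ K} (hp : p ≠ 0) :
    ∃ (c : K) (p' : MvPolynomial σ A), c ≠ 0 ∧ C c * p = map ι p' ∧ map red p' ≠ 0 := by
  have := hr.isDomain
  have key : ∀ (i : ℕ) (p : MvPolynomial σ A) (t : σ →₀ ℕ), ¬ π ^ (i + 1) ∣ p.coeff t →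
      ∃ (j : ℕ) (p' : MvPolynomial σ A), p = C (π ^ j) * p' ∧ map red p' ≠ 0 := by
    intro i
    induction i with
    | zero =>
      intro p t ht
      refine ⟨0, p, by simp, fun h => ht ?_⟩
      rw [zero_add, pow_one, ← hr.red_eq_zero, ← coeff_map, h, coeff_zero]
    | succ i ih =>
      intro p t ht
      by_cases h : map red p = 0
      · obtain ⟨q, rfl⟩ := hr.exists_eq_mul_of_map_eq_zero h
        obtain ⟨j, p', rfl, hp'⟩ := ih q t fun hd => ht (by
          rw [coeff_C_mul, pow_succ' π (i + 1)]
          exact mul_dvd_mul_left _ hd)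
        exact ⟨j + 1, p', by rw [pow_succ', C_mul, mul_assoc], hp'⟩
      · exact ⟨0, p, by simp, h⟩
  obtain ⟨i, p₁, h₁⟩ := hr.exists_C_mul_eq_map p
  have hp₁ : p₁ ≠ 0 := by
    rintro rfl
    rw [map_zero] at h₁
    exact mul_ne_zero (hr.C_ne_zero i) hp h₁
  obtain ⟨t, ht⟩ := ne_zero_iff.1 hp₁
  obtain ⟨l, hl⟩ := hr.exists_not_dvd _ ht
  obtain ⟨j, p', rfl, hp'⟩ := key l p₁ t hl
  refine ⟨(ι (π ^ j))⁻¹ * ι (π ^ i), p', ?_, ?_, hp'⟩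
  · simp only [map_pow]
    exact mul_ne_zero (inv_ne_zero (pow_ne_zero _ hr.ι_ne_zero)) (pow_ne_zero _ hr.ι_ne_zero)
  · rw [C_mul, mul_assoc, h₁, map_mul, map_C, ← mul_assoc, ← C_mul, inv_mul_cancel₀, C_1, one_mul]
    rw [map_pow]
    exact pow_ne_zero _ hr.ι_ne_zero

/-- Gauss's lemma: a quotient by a polynomial that does not vanish modulo `π` has no
denominators. -/
theorem exists_map_eq_of_mul_eq {D t : MvPolynomial σ A} (hD : map red D ≠ 0)
    {s : MvPolynomial σ K} (h : map ι D * s = map ι t) : ∃ s', map ι s' = s := by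
  have := hr.isDomain
  have key : ∀ (i : ℕ) (s t : MvPolynomial σ A), D * s = C (π ^ i) * t →
      ∃ s', s = C (π ^ i) * s' := by
    intro i
    induction i with
    | zero => exact fun s t _ => ⟨s, by simp⟩
    | succ i ih =>
      intro s t hst
      have h0 : map red s = 0 := by
        have := congrArg (map red) hst
        rw [map_mul, map_mul, map_C, map_pow, (hr.red_eq_zero π).2 dvd_rfl, zero_pow (by simp),
          C_0, zero_mul] at this
        exact (mul_eq_zero.1 this).resolve_left hD
      obtain ⟨s₁, rfl⟩ := hr.exists_eq_mul_of_map_eq_zero h0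
      obtain ⟨s', rfl⟩ := ih s₁ t (by
        refine mul_left_cancel₀ (a := C π) (by rw [Ne, C_eq_zero]; exact hr.ne_zero) ?_
        rw [mul_left_comm, hst, pow_succ', C_mul, mul_assoc])
      exact ⟨s', by rw [pow_succ', C_mul, mul_assoc]⟩
  obtain ⟨i, s₁, h₁⟩ := hr.exists_C_mul_eq_map s
  obtain ⟨s', rfl⟩ := key i s₁ t (hr.map_injective (by
    rw [map_mul, ← h₁, mul_left_comm, h, map_mul, map_C]))
  refine ⟨s', ?_⟩
  rw [map_mul, map_C] at h₁
  exact (mul_left_cancel₀ (hr.C_ne_zero i) h₁).symm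

end IsReduction

end ReductionModPrime

/-! ### Lifted presentations -/

section LiftedPresentations

/-- The homomorphism `R[y; x] → R[ȳ; x]` over `R[x]` that takes `y` to `p`, over any ring. -/
noncomputable def psiHom {R : Type} [CommRing R] {n J : ℕ} (p : MvPolynomial (Fin J ⊕ Fin n) R) :
    MvPolynomial (Unit ⊕ Fin n) R →ₐ[R] MvPolynomial (Fin J ⊕ Fin n) R :=
  aeval (Sum.elim (fun _ => p) (fun i => X (Sum.inr i)))

theorem psiHom_rename {R : Type} [CommRing R] {n J : ℕ} (p : MvPolynomial (Fin J ⊕ Fin n) R)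
    (c : MvPolynomial (Fin n) R) : psiHom p (rename Sum.inr c) = rename Sum.inr c := by
  have : (psiHom p).comp (rename Sum.inr) =
      (rename Sum.inr : MvPolynomial (Fin n) R →ₐ[R] MvPolynomial (Fin J ⊕ Fin n) R) := by
    ext i
    simp [psiHom]
  exact DFunLike.congr_fun this c

theorem map_psiHom {R R' : Type} [CommRing R] [CommRing R'] (φ : R →+* R') {n J : ℕ}
    (p : MvPolynomial (Fin J ⊕ Fin n) R) (r : MvPolynomial (Unit ⊕ Fin n) R) :
    map φ (psiHom p r) = psiHom (map φ p) (map φ r) := by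
  induction r using MvPolynomial.induction_on with
  | C a => simp [psiHom]
  | add r s hr hs => simp only [map_add, hr, hs]
  | mul_X r i hr =>
    rw [map_mul, map_mul, map_mul, map_mul, hr]
    congr 1
    rcases i with i | i <;> simp [psiHom]

theorem evalBar_psiHom {F : Type} [Field F] {n J : ℕ} {f : Polynomial (MvPolynomial (Fin n) F)}
    {Δ : MvPolynomial (Fin n) F} {g : Fin (J + 1) → MvPolynomial (Unit ⊕ Fin n) F}
    {p : MvPolynomial (Fin J ⊕ Fin n) F} (hp : evalBar f Δ g p = toFrac f (X (Sum.inl ())))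
    (r : MvPolynomial (Unit ⊕ Fin n) F) : evalBar f Δ g (psiHom p r) = toFrac f r := by
  induction r using MvPolynomial.induction_on with
  | C a =>
    have h1 : psiHom p (C a) = rename Sum.inr (C a) := by
      rw [rename_C, ← algebraMap_eq, AlgHom.commutes]; rfl
    rw [h1, evalBar_rename, toFracP_apply, inclP, rename_C]
  | add r s hr hs => simp only [map_add, hr, hs]
  | mul_X r i hr =>
    rw [map_mul, map_mul, map_mul, hr]
    congr 1
    rcases i with i | i
    · simpa [psiHom] using hp
    · have := evalBar_rename (f := f) (Δ := Δ) (g := g) (X i)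
      rw [rename_X] at this
      simpa [psiHom, toFracP_apply, inclP] using this

variable {A K k : Type} [CommRing A] [Field K] [Field k] {ι : A →+* K} {red : A →+* k} {π : A}
  {n J N : ℕ}

/-- A canonical presentation over the residue field `k` of `A`, together with a lift to `A` of
its relations `β` and of the image `υ` of `y`, which satisfies the stopping criterion over `K`;
the polynomial `f` and the conductor element `δ` are compatible with reduction. -/
structure IsLiftedPresentation (ι : A →+* K) (red : A →+* k) (π : A)
    (m : MonomialOrder (Unit ⊕ Fin n)) (mbar : MonomialOrder (Fin J ⊕ Fin n))
    (w : Unit ⊕ Fin n → Fin n → ℕ) (f : Polynomial (MvPolynomial (Fin n) K))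
    (wt : InputRing f → Fin n → ℕ) (f' : Polynomial (MvPolynomial (Fin n) k))
    (φ : MvPolynomial (Unit ⊕ Fin n) A) (δ : MvPolynomial (Fin n) A)
    (g : Fin (J + 1) → MvPolynomial (Unit ⊕ Fin n) k)
    (b : Fin N → MvPolynomial (Fin J ⊕ Fin n) k)
    (β : Fin N → MvPolynomial (Fin J ⊕ Fin n) A) (υ : MvPolynomial (Fin J ⊕ Fin n) A) :
    Prop where
  reduction : IsReduction ι red π
  order : IsWeightOverGrevlex m w
  bar_order : IsDependentDegreeFirst mbar
  monic : f.Monic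
  prime : (inputIdeal f).IsPrime
  typeI : IsTypeI f wt w
  monic' : f'.Monic
  natDegree_eq : f'.natDegree = f.natDegree
  map_φ : map ι φ = evalY f
  red_φ : map red φ = evalY f'
  conductor : IsConductor f (map ι δ)
  monic_δ : m.Monic (inclP Unit (map ι δ))
  presentation : IsCanonicalPresentation m mbar w f' (map red δ) g b
  red_β : ∀ l, map red (β l) = b l
  monic_β : ∀ l, mbar.Monic (β l)
  degree_β : ∀ l, mbar.degree (β l) = mbar.degree (b l)
  weight_β : ∀ l, ∀ t ∈ (β l).support, lexWeight (inducedWeight m w g) t ≤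
    lexWeight (inducedWeight m w g) (mbar.degree (b l))
  groebner : IsGroebnerBasis mbar (fun l => map ι (β l)) (Ideal.span (Set.range fun l => map ι (β l)))
  eval_υ : evalBar f' (map red δ) g (map red υ) = toFrac f' (X (Sum.inl ()))
  psi_mem : ∀ r ∈ inputIdeal f, psiHom (map ι υ) r ∈ Ideal.span (Set.range fun l => map ι (β l))

variable {m : MonomialOrder (Unit ⊕ Fin n)} {mbar : MonomialOrder (Fin J ⊕ Fin n)}
  {w : Unit ⊕ Fin n → Fin n → ℕ} {f : Polynomial (MvPolynomial (Fin n) K)}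
  {wt : InputRing f → Fin n → ℕ} {f' : Polynomial (MvPolynomial (Fin n) k)}
  {φ : MvPolynomial (Unit ⊕ Fin n) A} {δ : MvPolynomial (Fin n) A}
  {g : Fin (J + 1) → MvPolynomial (Unit ⊕ Fin n) k}
  {b : Fin N → MvPolynomial (Fin J ⊕ Fin n) k}
  {β : Fin N → MvPolynomial (Fin J ⊕ Fin n) A} {υ : MvPolynomial (Fin J ⊕ Fin n) A}

/-- The ideal of the lifted relations over `K`. -/
noncomputable abbrev liftedIdeal (ι : A →+* K) (β : Fin N → MvPolynomial (Fin J ⊕ Fin n) A) :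
    Ideal (MvPolynomial (Fin J ⊕ Fin n) K) :=
  Ideal.span (Set.range fun l => map ι (β l))

theorem map_mem_liftedIdeal {r : MvPolynomial (Fin J ⊕ Fin n) A}
    (hr : r ∈ Ideal.span (Set.range β)) : map ι r ∈ liftedIdeal ι β := by
  have : Ideal.span (Set.range β) ≤ (liftedIdeal ι β).comap (map ι) := by
    rw [Ideal.span_le]
    rintro _ ⟨l, rfl⟩
    exact Ideal.subset_span ⟨l, rfl⟩
  exact this hr

/-- The bound on the weights of the monomials of `f(y)` is inherited by its reduction. -/
theorem IsReduction.natWeight_le (hr : IsReduction ι red π) (hwt : IsTypeI f wt w) (hf : f.Monic)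
    (hprime : (inputIdeal f).IsPrime) (hφ : map ι φ = evalY f) (hφ' : map red φ = evalY f')
    (hd : f'.natDegree = f.natDegree) {t : Unit ⊕ Fin n →₀ ℕ} (ht : t ∈ (evalY f').support) :
    natWeight w t ≤ natWeight w (Finsupp.single (Sum.inl ()) f'.natDegree) := by
  rw [hd]
  refine hwt.natWeight_le hf hprime ?_
  rw [← hφ, hr.support_map]
  rw [← hφ'] at ht
  exact support_map_subset _ _ ht

namespace IsLiftedPresentation

variable (h : IsLiftedPresentation ι red π m mbar w f wt f' φ δ g b β υ)
include h

theorem natDegree_pos : 0 < f.natDegree := natDegree_pos_of_isPrime h.monic h.prime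

theorem led : IsLedByPower m f :=
  isLedByPower_of_natWeight_le h.monic h.order fun _ ht => h.typeI.natWeight_le h.monic h.prime ht

theorem natWeight_le' (t : Unit ⊕ Fin n →₀ ℕ) (ht : t ∈ (evalY f').support) :
    natWeight w t ≤ natWeight w (Finsupp.single (Sum.inl ()) f'.natDegree) :=
  h.reduction.natWeight_le h.typeI h.monic h.prime h.map_φ h.red_φ h.natDegree_eq ht

theorem led' : IsLedByPower m f' :=
  isLedByPower_of_natWeight_le h.monic' h.order h.natWeight_le'

theorem degree_φ : m.degree φ = Finsupp.single (Sum.inl ()) f.natDegree := by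
  rw [← h.reduction.degree_map (ι := ι), h.map_φ, h.led.degree]

theorem monic_φ : m.Monic φ := by
  refine h.reduction.injective ?_
  rw [MonomialOrder.leadingCoeff, ← coeff_map, ← h.reduction.degree_map (ι := ι), h.map_φ, map_one]
  exact h.led.monic

theorem evalBar_map_eq_zero {r : MvPolynomial (Fin J ⊕ Fin n) A}
    (hr : r ∈ Ideal.span (Set.range β)) : evalBar f' (map red δ) g (map red r) = 0 := by
  have : Ideal.span (Set.range β) ≤ (inducedIdeal f' (map red δ) g).comap (map red) := by
    rw [Ideal.span_le]
    rintro _ ⟨l, rfl⟩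
    rw [← h.presentation.groebner.1.1]
    exact Ideal.subset_span ⟨l, (h.red_β l).symm⟩
  exact this hr

theorem eq_zero_of_standard {r : MvPolynomial (Fin J ⊕ Fin n) K} (hr : r ∈ liftedIdeal ι β)
    (hs : ∀ t ∈ r.support, IsStandard (fun l => mbar.degree (b l)) t) : r = 0 := by
  refine h.groebner.eq_zero_of_standard hr fun t ht l hl => hs t ht l ?_
  change mbar.degree (map ι (β l)) ≤ t at hl
  rwa [h.reduction.degree_map, h.degree_β] at hl

/-- Relations over `K` with coefficients in `A` are relations over `A`. -/
theorem mem_span_of_map_mem {r : MvPolynomial (Fin J ⊕ Fin n) A} (hr : map ι r ∈ liftedIdeal ι β) :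
    r ∈ Ideal.span (Set.range β) := by
  obtain ⟨s, hs, hstd⟩ := exists_standard mbar h.monic_β h.degree_β r
  have h0 : map ι s = 0 := by
    refine h.eq_zero_of_standard ?_ fun t ht => hstd t (by rwa [h.reduction.support_map] at ht)
    have : map ι s = map ι r - map ι (r - s) := by rw [map_sub]; ring
    rw [this]
    exact Ideal.sub_mem _ hr (map_mem_liftedIdeal hs)
  rw [h.reduction.map_injective.eq_iff' (map_zero _)] at h0
  simpa [h0] using hs

theorem exists_standard_lift (p : MvPolynomial (Fin J ⊕ Fin n) K) :
    ∃ r : MvPolynomial (Fin J ⊕ Fin n) K, p - r ∈ liftedIdeal ι β ∧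
      ∀ t ∈ r.support, IsStandard (fun l => mbar.degree (b l)) t := by
  refine exists_standard mbar (b := fun l => map ι (β l)) (fun l => ?_) (fun l => ?_) p
  · rw [MonomialOrder.Monic, MonomialOrder.leadingCoeff, h.reduction.degree_map, coeff_map,
      (h.monic_β l).coeff_degree, map_one]
  · rw [h.reduction.degree_map, h.degree_β]

theorem barDegree_le_one {t : Fin J ⊕ Fin n →₀ ℕ}
    (ht : IsStandard (fun l => mbar.degree (b l)) t) : barDegree t ≤ 1 :=
  h.presentation.barDegree_le_one h.led' h.monic' h.bar_order ht

/-- The lifted ring is torsion-free over the polynomial ring in the independent variables, since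
its reduction is. -/
theorem mem_of_rename_mul_mem {c : MvPolynomial (Fin n) K} (hc : c ≠ 0)
    {s : MvPolynomial (Fin J ⊕ Fin n) K} (hs : rename Sum.inr c * s ∈ liftedIdeal ι β) :
    s ∈ liftedIdeal ι β := by
  obtain ⟨r, hsr, hstd⟩ := h.exists_standard_lift s
  by_cases hr0 : r = 0
  · simpa [hr0] using hsr
  exfalso
  -- After scaling, `c` and `r` have coefficients in `A` and do not vanish modulo `π`, although
  -- their product does.
  obtain ⟨u, c', hu, hc', hcr⟩ := h.reduction.exists_primitive hc
  obtain ⟨v, r', hv, hr', hrr⟩ := h.reduction.exists_primitive hr0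
  have h1 : map ι (rename Sum.inr c' * r') ∈ liftedIdeal ι β := by
    have : map ι (rename Sum.inr c' * r') = C (u * v) * (rename Sum.inr c * s)
        - C (u * v) * rename Sum.inr c * (s - r) := by
      rw [map_mul, map_rename, ← hc', ← hr', map_mul, rename_C, C_mul]; ring
    rw [this]
    exact Ideal.sub_mem _ (Ideal.mul_mem_left _ _ hs) (Ideal.mul_mem_left _ _ hsr)
  have h2 := h.evalBar_map_eq_zero (h.mem_span_of_map_mem h1)
  rw [map_mul, map_rename, map_mul, evalBar_rename, (h.led'.isUnit_toFracP hcr).mul_right_eq_zero] at h2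
  refine hrr (h.presentation.groebner.1.eq_zero_of_standard (RingHom.mem_ker.2 h2) fun t ht => ?_)
  refine hstd t ?_
  have h3 : t ∈ (map ι r').support := by
    rw [h.reduction.support_map]; exact support_map_subset _ _ ht
  rw [← hr', mem_support_iff, coeff_C_mul] at h3
  exact mem_support_iff.2 (right_ne_zero_of_mul h3)

theorem not_rename_mem {c : MvPolynomial (Fin n) K} (hc : c ≠ 0) :
    (rename Sum.inr c : MvPolynomial (Fin J ⊕ Fin n) K) ∉ liftedIdeal ι β := by
  intro hmem
  have h1 : (1 : MvPolynomial (Fin J ⊕ Fin n) K) ∈ liftedIdeal ι β :=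
    h.mem_of_rename_mul_mem hc (by rwa [mul_one])
  refine one_ne_zero (h.eq_zero_of_standard h1 fun t ht l hl => ?_)
  have ht0 : t = 0 := by
    have := support_monomial_subset (R := K) (s := (0 : Fin J ⊕ Fin n →₀ ℕ)) (a := 1) ht
    simpa using this
  have hb : b l ∈ inducedIdeal f' (map red δ) g := by
    rw [← h.presentation.groebner.1.1]; exact Ideal.subset_span ⟨l, rfl⟩
  refine barDegree_degree_ne_zero h.led' h.bar_order (by
    rw [h.natDegree_eq]; exact h.natDegree_pos) hb (h.presentation.groebner.2.1 l).ne_zero ?_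
  have : mbar.degree (b l) = 0 := le_antisymm (ht0 ▸ hl) (zero_le)
  rw [this]
  simp [barDegree]

/-- There is a denominator `D`, nonzero modulo `π`, with `D ȳ_j ∈ ψ(A[y; x])` for all `j`: it is
the determinant of the system of equations `Δ ȳ_j ≡ g_j(y)` modulo `π`. -/
theorem exists_denominator : ∃ (D : MvPolynomial (Fin n) A)
    (s : Fin (J + 1) → MvPolynomial (Unit ⊕ Fin n) A), map red D ≠ 0 ∧
    ∀ j, rename Sum.inr D * barVar A j - psiHom υ (s j) ∈ Ideal.span (Set.range β) := by
  classical
  have hred := h.reduction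
  -- Over `k`, the relation `Δ ȳ_j - g_j(y)` lies in the ideal of induced relations.
  have key : ∀ j, ∃ (G : MvPolynomial (Unit ⊕ Fin n) A) (c : Fin (J + 1) → MvPolynomial (Fin n) A),
      rename Sum.inr δ * barVar A j - psiHom υ G -
        C π * ∑ i, rename Sum.inr (c i) * barVar A i ∈ Ideal.span (Set.range β) := by
    intro j
    obtain ⟨G, hG, -⟩ := hred.exists_lift (g j)
    set E := rename Sum.inr δ * barVar A j - psiHom υ G with hE
    have h1 : map red E ∈ Ideal.span (Set.range b) := by
      rw [h.presentation.groebner.1.1, inducedIdeal, RingHom.mem_ker]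
      change evalBar f' (map red δ) g _ = 0
      rw [hE, map_sub, map_mul, map_rename, map_barVar, map_psiHom, hG, map_sub, map_mul,
        evalBar_rename, evalBar_psiHom h.eval_υ, toFracP_mul_evalBar_barVar
          (h.presentation.canonical.isUnit h.led') h.presentation.canonical.zero, sub_self]
    obtain ⟨a, ha⟩ := Ideal.mem_span_range_iff_exists_fun.1 h1
    choose a' ha' _ using fun l => hred.exists_lift (a l)
    obtain ⟨u, hu⟩ := hred.exists_eq_mul_of_map_eq_zero (p := E - ∑ l, a' l * β l) (by
      rw [map_sub, map_sum, ← ha, sub_eq_zero]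
      refine Finset.sum_congr rfl fun l _ => ?_
      rw [map_mul, ha', h.red_β])
    obtain ⟨r, hr, hstd⟩ := exists_standard mbar h.monic_β h.degree_β u
    obtain ⟨c, hc⟩ := exists_eq_sum_barVar fun t ht => h.barDegree_le_one (hstd t ht)
    refine ⟨G, c, ?_⟩
    have : E - C π * ∑ i, rename Sum.inr (c i) * barVar A i
        = ∑ l, a' l * β l + C π * (u - r) := by
      rw [← hc, mul_sub, ← hu]; ring
    rw [this]
    exact Ideal.add_mem _ (Ideal.sum_mem _ fun l _ => Ideal.mul_mem_left _ _
      (Ideal.subset_span ⟨l, rfl⟩)) (Ideal.mul_mem_left _ _ hr)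
  choose G c hGc using key
  -- The matrix is `Δ` times the identity modulo `π`, and it maps the vector of the `ȳ_j` to that
  -- of the `G_j(y)`.
  let M : Matrix (Fin (J + 1)) (Fin (J + 1)) (MvPolynomial (Fin n) A) :=
    Matrix.of fun j i => (if j = i then δ else 0) - C π * c j i
  refine ⟨M.det, fun l => ∑ j, rename Sum.inr (M.adjugate l j) * G j, ?_, fun l => ?_⟩
  · have h1 : M.map (map red) = Matrix.diagonal fun _ => map red δ := by
      ext1 j i
      simp only [Matrix.map_apply, Matrix.of_apply, M, map_sub, map_mul, map_C,
        (hred.red_eq_zero π).2 dvd_rfl, C_0, zero_mul, sub_zero, Matrix.diagonal_apply]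
      split_ifs <;> simp
    have h2 := RingHom.map_det (map red : MvPolynomial (Fin n) A →+* _) M
    rw [RingHom.mapMatrix_apply, h1, Matrix.det_diagonal] at h2
    rw [h2, Finset.prod_const]
    exact pow_ne_zero _ h.presentation.canonical.ne_zero
  · have hrel : ∀ j, ∑ i, rename Sum.inr (M j i) * barVar A i - psiHom υ (G j) ∈
        Ideal.span (Set.range β) := by
      intro j
      convert hGc j using 1
      simp only [M, Matrix.of_apply, map_sub, sub_mul, Finset.sum_sub_distrib, map_mul, rename_C,
        apply_ite (rename Sum.inr), map_zero, ite_mul, zero_mul, Finset.sum_ite_eq,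
        Finset.mem_univ, if_true, Finset.mul_sum]
      simp only [mul_assoc]
      ring
    have hadj : ∀ i, ∑ j, M.adjugate l j * M j i = if l = i then M.det else 0 := by
      intro i
      have := congrFun (congrFun (Matrix.adjugate_mul M) l) i
      rw [Matrix.mul_apply] at this
      rw [this, Matrix.smul_apply, Matrix.one_apply]
      split_ifs <;> simp
    have hsum := Ideal.sum_mem (Ideal.span (Set.range β)) (t := Finset.univ)
      (fun j _ => Ideal.mul_mem_left _ (rename Sum.inr (M.adjugate l j)) (hrel j))
    convert hsum using 1
    simp only [mul_sub, Finset.sum_sub_distrib, map_sum, map_mul, psiHom_rename]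
    congr 1
    simp only [Finset.mul_sum, ← mul_assoc, ← map_mul]
    rw [Finset.sum_comm]
    simp only [← Finset.sum_mul, ← map_sum, hadj, apply_ite (rename Sum.inr), map_zero, ite_mul,
      zero_mul, Finset.sum_ite_eq, Finset.mem_univ, if_true]

end IsLiftedPresentation

end LiftedPresentations

/-! ### The embedding of the lifted ring into `Q(S)` -/

section Embedding

/-- If `ψ : S → T` is injective and `D T ⊆ ψ(S)` for a nonzerodivisor `D`, then `T` embeds
over `S` in every extension of `S` in which `D` is invertible. -/
theorem exists_algHom_of_denominator {K S T Q : Type*} [CommRing K] [CommRing S] [CommRing T]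
    [CommRing Q] [Algebra K S] [Algebra K T] [Algebra S Q] [Algebra K Q] [IsScalarTower K S Q]
    (hQ : Function.Injective (algebraMap S Q)) {ψ : S →ₐ[K] T} (hψ : Function.Injective ψ) {D : S}
    (hu : IsUnit (algebraMap S Q D)) (hD : ∀ t, ψ D * t = 0 → t = 0)
    (hT : ∀ t, ∃ s, ψ D * t = ψ s) :
    ∃ θ : T →ₐ[K] Q, Function.Injective θ ∧ ∀ s, θ (ψ s) = algebraMap S Q s := by
  choose σ hσ using hT
  obtain ⟨u, hu⟩ := hu
  have key : ∀ t s, ψ D * t = ψ s → σ t = s := fun t s h => hψ ((hσ t).symm.trans h)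
  have hval : ∀ t s, ψ D * t = ψ (D * s) → algebraMap S Q (σ t) * ↑u⁻¹ = algebraMap S Q s := by
    intro t s h
    rw [key t _ h, map_mul, ← hu, mul_right_comm, Units.mul_inv, one_mul]
  let θ : T →ₐ[K] Q :=
    { toFun := fun t => algebraMap S Q (σ t) * ↑u⁻¹
      map_one' := by rw [hval 1 1 (by simp), map_one]
      map_zero' := by rw [hval 0 0 (by simp), map_zero]
      map_add' := fun t t' => by
        rw [key (t + t') (σ t + σ t') (by rw [mul_add, hσ, hσ, map_add]), map_add, add_mul]
      map_mul' := fun t t' => by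
        have h1 : D * σ (t * t') = σ t * σ t' := hψ (by
          rw [map_mul, map_mul, ← hσ, ← hσ, ← hσ]; ring)
        have h2 := congrArg (algebraMap S Q) h1
        rw [map_mul, map_mul, ← hu] at h2
        refine u.isUnit.mul_left_cancel ?_
        rw [← mul_assoc, h2]
        calc algebraMap S Q (σ t) * algebraMap S Q (σ t') * ↑u⁻¹
            = (↑u * ↑u⁻¹) * (algebraMap S Q (σ t) * algebraMap S Q (σ t') * ↑u⁻¹) := by
              rw [Units.mul_inv, one_mul]
          _ = _ := by ring
      commutes' := fun r => by
        rw [hval _ (algebraMap K S r) (by rw [map_mul, AlgHom.commutes]),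
          ← IsScalarTower.algebraMap_apply] }
  refine ⟨θ, (injective_iff_map_eq_zero θ).2 fun t ht => ?_, fun s => ?_⟩
  · have h1 : algebraMap S Q (σ t) = 0 := (Units.mul_left_eq_zero u⁻¹).1 ht
    rw [map_eq_zero_iff _ hQ] at h1
    exact hD t (by rw [hσ, h1, map_zero])
  · exact hval _ s (by rw [map_mul])

/-- A homomorphism from a domain that is integral over `P` is injective if it is so on `P`. -/
theorem injective_of_isIntegralElem {P S T : Type*} [CommRing P] [CommRing S] [IsDomain S]
    [CommRing T] {g : P →+* S} (hg : ∀ x, g.IsIntegralElem x) (φ : S →+* T)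
    (h : ∀ c, φ (g c) = 0 → c = 0) : Function.Injective φ := by
  refine (injective_iff_map_eq_zero φ).2 fun x hx => ?_
  by_contra hx0
  obtain ⟨p, hp, hpx⟩ := hg x
  have : Nontrivial P := g.domain_nontrivial
  obtain ⟨i, hi0, hi⟩ := Ideal.exists_coeff_ne_zero_mem_comap_of_root_mem hx0
    (I := RingHom.ker φ) hx hp.ne_zero hpx
  exact hi0 (h _ hi)

namespace IsLiftedPresentation

variable {A K k : Type} [CommRing A] [Field K] [Field k] {ι : A →+* K} {red : A →+* k} {π : A}
  {n J N : ℕ} {m : MonomialOrder (Unit ⊕ Fin n)} {mbar : MonomialOrder (Fin J ⊕ Fin n)}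
  {w : Unit ⊕ Fin n → Fin n → ℕ} {f : Polynomial (MvPolynomial (Fin n) K)}
  {wt : InputRing f → Fin n → ℕ} {f' : Polynomial (MvPolynomial (Fin n) k)}
  {φ : MvPolynomial (Unit ⊕ Fin n) A} {δ : MvPolynomial (Fin n) A}
  {g : Fin (J + 1) → MvPolynomial (Unit ⊕ Fin n) k}
  {b : Fin N → MvPolynomial (Fin J ⊕ Fin n) k}
  {β : Fin N → MvPolynomial (Fin J ⊕ Fin n) A} {υ : MvPolynomial (Fin J ⊕ Fin n) A}

variable (h : IsLiftedPresentation ι red π m mbar w f wt f' φ δ g b β υ)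
include h

/-- The lifted ring embeds in `Q(S)`, compatibly with `ψ`, and is integral over `P`. -/
theorem exists_embedding : ∃ θ : (MvPolynomial (Fin J ⊕ Fin n) K ⧸ liftedIdeal ι β) →ₐ[K] FracS f,
    Function.Injective θ ∧
    (∀ r, θ (Ideal.Quotient.mk _ (psiHom (map ι υ) r)) = toFrac f r) ∧
    ∀ t, (toFracP f).IsIntegralElem (θ t) := by
  have := h.prime
  let ψ : InputRing f →ₐ[K] (MvPolynomial (Fin J ⊕ Fin n) K ⧸ liftedIdeal ι β) :=
    Ideal.Quotient.liftₐ (inputIdeal f)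
      ((Ideal.Quotient.mkₐ K (liftedIdeal ι β)).comp (psiHom (map ι υ)))
      (fun r hr => Ideal.Quotient.eq_zero_iff_mem.2 (h.psi_mem r hr))
  have hψ : ∀ r, ψ (Ideal.Quotient.mk _ r) = Ideal.Quotient.mk _ (psiHom (map ι υ) r) :=
    fun r => rfl
  have hinj : Function.Injective ψ := by
    refine injective_of_isIntegralElem
      (g := (Ideal.Quotient.mk (inputIdeal f)).comp (inclP Unit).toRingHom) (fun x => ?_)
      ψ.toRingHom fun c hc => ?_
    · obtain ⟨p, rfl⟩ := Ideal.Quotient.mk_surjective x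
      exact RingHom.IsIntegralElem.of_map (g := algebraMap (InputRing f) (FracS f))
        (IsFractionRing.injective (InputRing f) (FracS f)) (isIntegralElem_toFrac h.monic p)
    · by_contra hc0
      refine h.not_rename_mem hc0 ?_
      have h1 : ψ (Ideal.Quotient.mk _ (rename Sum.inr c)) = 0 := hc
      rwa [hψ, psiHom_rename, Ideal.Quotient.eq_zero_iff_mem] at h1
  obtain ⟨D, s, hD, hs⟩ := h.exists_denominator
  have hD0 : map ι D ≠ 0 := by
    rw [Ne, h.reduction.map_injective.eq_iff' (map_zero _)]
    rintro rfl
    exact hD (map_zero _)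
  -- Standard monomials are linear in the `ȳ_j`, so that `D` is a denominator for all of `T`.
  have hT : ∀ t, ∃ r : MvPolynomial (Unit ⊕ Fin n) K,
      ψ (Ideal.Quotient.mk _ (inclP Unit (map ι D))) * t = ψ (Ideal.Quotient.mk _ r) := by
    intro t
    obtain ⟨p, rfl⟩ := Ideal.Quotient.mk_surjective t
    obtain ⟨q, hpq, hstd⟩ := h.exists_standard_lift p
    obtain ⟨c, hc⟩ := exists_eq_sum_barVar fun t ht => h.barDegree_le_one (hstd t ht)
    refine ⟨∑ j, rename Sum.inr (c j) * map ι (s j), ?_⟩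
    rw [hψ, hψ, ← map_mul, Ideal.Quotient.mk_eq_mk_iff_sub_mem, inclP, psiHom_rename]
    have : rename Sum.inr (map ι D) * p -
        psiHom (map ι υ) (∑ j, rename Sum.inr (c j) * map ι (s j)) =
        rename Sum.inr (map ι D) * (p - q) + ∑ j, rename Sum.inr (c j) *
          map ι (rename Sum.inr D * barVar A j - psiHom υ (s j)) := by
      simp only [map_sub, map_mul, map_rename, map_barVar, map_psiHom, map_sum, psiHom_rename,
        mul_sub, Finset.sum_sub_distrib]
      conv_rhs => rw [hc]
      simp only [Finset.mul_sum, mul_left_comm (rename Sum.inr (map ι D))]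
      ring
    rw [this]
    exact Ideal.add_mem _ (Ideal.mul_mem_left _ _ hpq) (Ideal.sum_mem _ fun j _ =>
      Ideal.mul_mem_left _ _ (map_mem_liftedIdeal (hs j)))
  obtain ⟨θ, hθ, hθψ⟩ := exists_algHom_of_denominator (Q := FracS f)
    (IsFractionRing.injective (InputRing f) (FracS f)) hinj
    (D := Ideal.Quotient.mk _ (inclP Unit (map ι D))) (h.led.isUnit_toFracP hD0)
    (fun t ht => by
      obtain ⟨p, rfl⟩ := Ideal.Quotient.mk_surjective t
      rw [hψ, ← map_mul, Ideal.Quotient.eq_zero_iff_mem, inclP, psiHom_rename] at ht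
      exact Ideal.Quotient.eq_zero_iff_mem.2 (h.mem_of_rename_mul_mem hD0 ht))
    (fun t => let ⟨r, hr⟩ := hT t; ⟨_, hr⟩)
  have hθr : ∀ r, θ (Ideal.Quotient.mk _ (psiHom (map ι υ) r)) = toFrac f r := fun r => by
    rw [← hψ, hθψ]; rfl
  refine ⟨θ, hθ, hθr, fun t => h.led.isIntegralElem_of_pow h.monic hD0 fun i => ?_⟩
  obtain ⟨r, hr⟩ := hT (t ^ i)
  refine ⟨r, ?_⟩
  rw [toFracP_apply, ← hθr, ← hθr, ← hψ, ← hψ, ← hr, map_mul, map_pow]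

end IsLiftedPresentation

end Embedding

/-! ### Numerators over `A` and normality of the lifted ring -/

section Normality

theorem degree_map_le {R R' σ : Type} [CommRing R] [CommRing R'] (m : MonomialOrder σ)
    (φ : R →+* R') (p : MvPolynomial σ R) : m.degree (map φ p) ≼[m] m.degree p :=
  m.degree_le_iff.2 fun _ hs => m.le_degree (support_map_subset φ p hs)

namespace IsLiftedPresentation

variable {A K k : Type} [CommRing A] [Field K] [Field k] {ι : A →+* K} {red : A →+* k} {π : A}
  {n J N : ℕ} {m : MonomialOrder (Unit ⊕ Fin n)} {mbar : MonomialOrder (Fin J ⊕ Fin n)}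
  {w : Unit ⊕ Fin n → Fin n → ℕ} {f : Polynomial (MvPolynomial (Fin n) K)}
  {wt : InputRing f → Fin n → ℕ} {f' : Polynomial (MvPolynomial (Fin n) k)}
  {φ : MvPolynomial (Unit ⊕ Fin n) A} {δ : MvPolynomial (Fin n) A}
  {g : Fin (J + 1) → MvPolynomial (Unit ⊕ Fin n) k}
  {b : Fin N → MvPolynomial (Fin J ⊕ Fin n) k}
  {β : Fin N → MvPolynomial (Fin J ⊕ Fin n) A} {υ : MvPolynomial (Fin J ⊕ Fin n) A}

omit [Field k] in
theorem θ_rename {θ : (MvPolynomial (Fin J ⊕ Fin n) K ⧸ liftedIdeal ι β) →ₐ[K] FracS f}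
    (hθ : ∀ r, θ (Ideal.Quotient.mk _ (psiHom (map ι υ) r)) = toFrac f r)
    (c : MvPolynomial (Fin n) K) :
    θ (Ideal.Quotient.mk _ (rename Sum.inr c)) = toFracP f c := by
  rw [← psiHom_rename (map ι υ), hθ, toFracP_apply, inclP]

omit [Field k] in
theorem θ_C {θ : (MvPolynomial (Fin J ⊕ Fin n) K ⧸ liftedIdeal ι β) →ₐ[K] FracS f}
    (hθ : ∀ r, θ (Ideal.Quotient.mk _ (psiHom (map ι υ) r)) = toFrac f r) (c : K) :
    θ (Ideal.Quotient.mk _ (C c)) = toFrac f (C c) := by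
  rw [← rename_C Sum.inr c, θ_rename hθ, toFracP_apply, inclP, rename_C]

variable (h : IsLiftedPresentation ι red π m mbar w f wt f' φ δ g b β υ)
include h

theorem map_δ_ne_zero : map ι δ ≠ 0 := by
  intro h0
  have := h.monic_δ.ne_zero
  rw [h0, map_zero] at this
  exact this rfl

theorem isUnit : IsUnit (toFracP f (map ι δ)) := h.led.isUnit_toFracP h.map_δ_ne_zero

theorem isUnit' : IsUnit (toFracP f' (map red δ)) := h.presentation.canonical.isUnit h.led'

theorem isNormal_map_red {p : MvPolynomial (Unit ⊕ Fin n) A} (hp : IsNormal f.natDegree p) :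
    IsNormal f'.natDegree (map red p) := by
  rw [h.natDegree_eq]
  exact hp.map red

/-- Division with remainder by `f(y)` over `A`. -/
theorem exists_normal (p : MvPolynomial (Unit ⊕ Fin n) A) : ∃ r, IsNormal f.natDegree r ∧
    toFrac f (map ι p) = toFrac f (map ι r) ∧ toFrac f' (map red p) = toFrac f' (map red r) := by
  obtain ⟨r, hr, hn, -⟩ := exists_normal_of_monic h.monic_φ h.degree_φ
    (0 : (Unit ⊕ Fin n →₀ ℕ) →+ ℕ) (by simp) p
  obtain ⟨c, hc⟩ := Ideal.mem_span_singleton.1 hr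
  refine ⟨r, hn, toFrac_eq_iff.2 ?_, toFrac_eq_iff.2 ?_⟩
  · rw [← map_sub, hc, map_mul, h.map_φ]
    exact Ideal.mul_mem_right _ _ (Ideal.subset_span rfl)
  · rw [← map_sub, hc, map_mul, h.red_φ]
    exact Ideal.mul_mem_right _ _ (Ideal.subset_span rfl)

/-- If `D z` has a numerator over `A`, with `D` nonzero modulo `π`, then so has `z`. -/
theorem exists_normal_of_mul {D : MvPolynomial (Fin n) A} (hD : map red D ≠ 0)
    {r : MvPolynomial (Unit ⊕ Fin n) K} (hr : IsNormal f.natDegree r)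
    {s : MvPolynomial (Unit ⊕ Fin n) A} (hs : IsNormal f.natDegree s)
    (h0 : toFracP f (map ι D) * toFrac f r = toFrac f (map ι s)) :
    ∃ r', IsNormal f.natDegree r' ∧ map ι r' = r ∧
      toFracP f' (map red D) * toFrac f' (map red r') = toFrac f' (map red s) := by
  have h1 : map ι (rename Sum.inr D) * r = map ι s := by
    rw [map_rename]
    refine (toFrac_eq_iff_of_normal h.led (hr.rename_mul _)
      (h.reduction.isNormal_map_iff.2 hs)).1 ?_
    rw [map_mul, ← h0, toFracP_apply, inclP]
  obtain ⟨r', rfl⟩ := h.reduction.exists_map_eq_of_mul_eq (by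
    rw [map_rename, Ne, (rename_injective _ Sum.inr_injective).eq_iff' (map_zero _)]
    exact hD) h1
  refine ⟨r', h.reduction.isNormal_map_iff.1 hr, rfl, ?_⟩
  rw [← map_mul] at h1
  rw [← h.reduction.map_injective h1, map_mul, map_mul, map_rename, toFracP_apply, inclP]

/-- The reduction modulo `π` of an integral fraction is integral: its powers have the common
denominator `Δ`. -/
theorem exists_mem_closureIn {H : MvPolynomial (Unit ⊕ Fin n) A} {z : FracS f}
    (hz : (toFracP f).IsIntegralElem z)
    (hHz : toFracP f (map ι δ) * z = toFrac f (map ι H)) :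
    ∃ z' ∈ closureIn f' (map red δ), toFracP f' (map red δ) * z' = toFrac f' (map red H) := by
  obtain ⟨u', hu'⟩ := h.isUnit'
  set z' : FracS f' := ↑u'⁻¹ * toFrac f' (map red H)
  have hz' : toFracP f' (map red δ) * z' = toFrac f' (map red H) := by
    rw [← hu', Units.mul_inv_cancel_left]
  refine ⟨z', ⟨h.led'.isIntegralElem_of_pow h.monic'
    h.presentation.canonical.ne_zero fun i => ?_, _, hz'⟩, hz'⟩
  obtain ⟨r, hr⟩ := ((mem_closureIn_iff h.monic h.conductor (z := z ^ i)).2 (by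
    induction i with
    | zero => rw [pow_zero]; exact RingHom.isIntegralElem_one _
    | succ i ih => rw [pow_succ]; exact ih.mul _ hz)).2
  obtain ⟨T, hrT, hT⟩ := h.led.exists_normal r
  rw [toFrac_eq_iff.2 hrT] at hr
  obtain ⟨s, hsn, hs, hs'⟩ := h.exists_normal (rename Sum.inr δ * H ^ i)
  obtain ⟨T', hT', -, hred⟩ := h.exists_normal_of_mul (D := δ ^ i) (by
    rw [map_pow]; exact pow_ne_zero _ h.presentation.canonical.ne_zero) hT hsn (by
    rw [← hs, ← hr, map_mul, map_rename, map_mul, map_pow, map_pow, map_pow, map_pow, ← hHz,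
      mul_pow, toFracP_apply, inclP]
    ring)
  refine ⟨map red T', ?_⟩
  have hupow : IsUnit (toFracP f' (map red (δ ^ i))) := by
    rw [map_pow, map_pow]; exact h.isUnit'.pow i
  refine hupow.mul_left_cancel ?_
  rw [hred, ← hs', map_mul, map_rename, map_mul, map_pow, map_pow, map_pow, map_pow, ← hz',
    mul_pow, toFracP_apply, inclP]
  ring

/-- The reduction of the numerator of an integral element is a combination of elements `x^α g_j`
with distinct leading monomials, so that no cancellation occurs. -/
theorem exists_eq_barSum_map {H : MvPolynomial (Unit ⊕ Fin n) A}
    (hH : IsNormal f.natDegree H) {z : FracS f} (hz : (toFracP f).IsIntegralElem z)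
    (hHz : toFracP f (map ι δ) * z = toFrac f (map ι H)) :
    ∃ p : MvPolynomial (Fin J ⊕ Fin n) k,
      (∀ t ∈ p.support, IsStandard (fun l => mbar.degree (b l)) t) ∧ map red H = barSum g p ∧
      (p.support.Nonempty → map red H ≠ 0 ∧ ∃ t ∈ p.support,
        m.degree (map red H) = m.degree (barMul g t) ∧
        ∀ s ∈ p.support, m.degree (barMul g s) ≼[m] m.degree (map red H)) := by
  classical
  have hpres := h.presentation
  obtain ⟨z', hz', hHz'⟩ := h.exists_mem_closureIn hz hHz
  obtain ⟨p, hpstd, hp⟩ := hpres.exists_eq_barSum h.led' h.monic' h.bar_order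
    (h.isNormal_map_red hH) hz' hHz'
  refine ⟨p, hpstd, hp, fun hpn => ?_⟩
  obtain ⟨hne, t, ht, hdeg, hmax⟩ := exists_degree_sum_eq m hpn
    (c := fun t => p.coeff t) (fun s hs => mem_support_iff.1 hs) (h := barMul g)
    (fun s _ => (monic_barMul hpres.canonical.monic s).1)
    ((hpres.injOn_degree_barMul h.led' h.monic' h.bar_order).mono hpstd)
  change barSum g p ≠ 0 at hne
  change m.degree (barSum g p) = _ at hdeg
  rw [hp]
  exact ⟨hne, t, ht, hdeg, fun s hs => hdeg ▸ hmax s hs⟩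

theorem exists_degree_eq_of_red_ne_zero {H : MvPolynomial (Unit ⊕ Fin n) A}
    (hH : IsNormal f.natDegree H) {z : FracS f} (hz : (toFracP f).IsIntegralElem z)
    (hHz : toFracP f (map ι δ) * z = toFrac f (map ι H)) (hred : red (m.leadingCoeff H) ≠ 0) :
    ∃ t, IsStandard (fun l => mbar.degree (b l)) t ∧ m.degree H = m.degree (barMul g t) := by
  obtain ⟨p, hpstd, hp, hmax⟩ := h.exists_eq_barSum_map hH hz hHz
  have hmem : m.degree H ∈ (map red H).support := by
    rw [mem_support_iff, coeff_map]
    exact hred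
  have hpn : p.support.Nonempty := by
    rw [Finset.nonempty_iff_ne_empty, Ne, support_eq_empty]
    rintro rfl
    rw [hp] at hmem
    simp [barSum] at hmem
  obtain ⟨-, t, ht, hdeg, -⟩ := hmax hpn
  exact ⟨t, hpstd t ht, hdeg ▸ m.toSyn.injective (le_antisymm (m.le_degree hmem)
    (degree_map_le m red H))⟩

variable {θ : (MvPolynomial (Fin J ⊕ Fin n) K ⧸ liftedIdeal ι β) →ₐ[K] FracS f}
  (hθ : ∀ r, θ (Ideal.Quotient.mk _ (psiHom (map ι υ) r)) = toFrac f r)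
include hθ

variable (hint : ∀ t, (toFracP f).IsIntegralElem (θ t))
include hint

/-- The numerators of the `ȳ_j` over `Δ` have no denominators, and reduce to the `g_j`. -/
theorem exists_numerators : ∃ G : Fin (J + 1) → MvPolynomial (Unit ⊕ Fin n) A,
    (∀ j, IsNormal f.natDegree (G j)) ∧ (∀ j, map red (G j) = g j) ∧
    ∀ j, toFracP f (map ι δ) * θ (Ideal.Quotient.mk _ (barVar K j)) = toFrac f (map ι (G j)) := by
  obtain ⟨D, s, hD, hs⟩ := h.exists_denominator
  have key : ∀ j, ∃ G : MvPolynomial (Unit ⊕ Fin n) A, IsNormal f.natDegree G ∧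
      map red G = g j ∧
      toFracP f (map ι δ) * θ (Ideal.Quotient.mk _ (barVar K j)) = toFrac f (map ι G) := by
    intro j
    obtain ⟨r, hr⟩ := ((mem_closureIn_iff h.monic h.conductor).2
      (hint (Ideal.Quotient.mk _ (barVar K j)))).2
    obtain ⟨r₁, hrr, hr₁⟩ := h.led.exists_normal r
    rw [toFrac_eq_iff.2 hrr] at hr
    obtain ⟨s', hs'n, hs', hs''⟩ := h.exists_normal (rename Sum.inr δ * s j)
    have h1 := map_mem_liftedIdeal (ι := ι) (hs j)
    rw [map_sub, map_mul, map_rename, map_barVar, map_psiHom, ← Ideal.Quotient.eq_zero_iff_mem,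
      map_sub, map_mul, sub_eq_zero] at h1
    have h2 := congrArg θ h1
    rw [map_mul, θ_rename hθ, hθ] at h2
    obtain ⟨G, hG, rfl, hG'⟩ := h.exists_normal_of_mul hD hr₁ hs'n (by
      rw [← hs', ← hr, map_mul, map_mul, ← h2, map_rename, toFracP_apply, toFracP_apply, inclP]
      ring)
    refine ⟨G, hG, ?_, hr⟩
    refine (toFrac_eq_iff_of_normal h.led' (h.isNormal_map_red hG)
      (h.presentation.canonical.normal j)).1 ((h.led'.isUnit_toFracP hD).mul_left_cancel ?_)
    have h3 := h.evalBar_map_eq_zero (hs j)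
    rw [map_sub, map_mul, map_rename, map_barVar, map_psiHom, map_sub, map_mul, evalBar_rename,
      evalBar_psiHom h.eval_υ, sub_eq_zero] at h3
    rw [hG', ← hs'', map_mul, map_mul, ← h3, map_rename, ← toFracP_mul_evalBar_barVar
      (h.presentation.canonical.isUnit h.led') h.presentation.canonical.zero, toFracP_apply,
      toFracP_apply, inclP]
    ring
  choose G h1 h2 h3 using key
  exact ⟨G, h1, h2, h3⟩

omit hint

variable {G : Fin (J + 1) → MvPolynomial (Unit ⊕ Fin n) A}
  (hGn : ∀ j, IsNormal f.natDegree (G j)) (hGred : ∀ j, map red (G j) = g j)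
  (hG : ∀ j, toFracP f (map ι δ) * θ (Ideal.Quotient.mk _ (barVar K j)) = toFrac f (map ι (G j)))

include hG in
theorem mul_θ_eq_toFrac_barSum {p : MvPolynomial (Fin J ⊕ Fin n) A}
    (hp : ∀ t ∈ p.support, IsStandard (fun l => mbar.degree (b l)) t) :
    toFracP f (map ι δ) * θ (Ideal.Quotient.mk _ (map ι p)) = toFrac f (map ι (barSum G p)) := by
  rw [map_barSum]
  refine toFracP_mul_eq_toFrac_barSum
    (ev := θ.toRingHom.comp (Ideal.Quotient.mk (liftedIdeal ι β))) (θ_rename hθ) hG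
    fun t ht => h.barDegree_le_one (hp t ?_)
  rwa [h.reduction.support_map] at ht

omit hθ in
include hGred in
theorem G_ne_zero (j : Fin (J + 1)) : G j ≠ 0 := by
  intro h0
  have h1 := hGred j
  rw [h0, map_zero] at h1
  exact (h.presentation.canonical.monic j).ne_zero h1.symm

include hGn hG

omit hθ in
theorem G_zero : G 0 = rename Sum.inr δ := by
  refine h.reduction.map_injective ?_
  refine (toFrac_eq_iff_of_normal h.led (h.reduction.isNormal_map_iff.2 (hGn 0))
    (h.reduction.isNormal_map_iff.2 (isNormal_rename h.natDegree_pos δ))).1 ?_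
  rw [← hG 0, map_rename]
  simp [barVar, toFracP_apply, inclP]

include hGred

/-- The numerators have the same leading monomials as their reductions. For an index `i` that
maximizes the excess of the weight of the numerator over that of its reduction, the expression of
`ȳ_i²` by standard monomials shows that twice the excess is at most the excess. -/
theorem degree_G_eq (j : Fin (J + 1)) : m.degree (G j) = m.degree (g j) := by
  classical
  have := h.reduction.isDomain
  have hne := h.G_ne_zero hGred
  have hzero : m.degree (G 0) = m.degree (g 0) := by
    have h1 : m.leadingCoeff (G 0) = 1 := by
      refine h.reduction.injective ?_
      have h2 := h.monic_δ
      rw [inclP, ← map_rename, ← h.G_zero hGn hG] at h2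
      rw [MonomialOrder.leadingCoeff, ← coeff_map, map_one, ← h.reduction.degree_map (ι := ι)]
      exact h2
    refine m.toSyn.injective (le_antisymm (m.le_degree ?_) (hGred 0 ▸ degree_map_le m red (G 0)))
    rw [← hGred 0, mem_support_iff, coeff_map]
    change red (m.leadingCoeff (G 0)) ≠ 0
    rw [h1, map_one]
    exact one_ne_zero
  set W := natWeight w with hWdef
  set Ω := lexWeight (inducedWeight m w g) with hΩdef
  obtain ⟨i, -, hi⟩ := Finset.exists_max_image Finset.univ
    (fun j => W (m.degree (G j)) - W (m.degree (g j))) ⟨0, Finset.mem_univ _⟩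
  replace hi := fun j => hi j (Finset.mem_univ _)
  have hi0 : W (m.degree (G i)) - W (m.degree (g i)) ≤ 0 := by
    -- Write `ȳ_i²` as a combination of standard monomials of at most the same induced weight.
    obtain ⟨p, hp, hpstd⟩ := exists_standard_weight mbar h.monic_β h.degree_β Ω h.weight_β
      (monomial (barExp i 0 + barExp i 0) (1 : A))
    have hstd : ∀ t ∈ p.support, IsStandard (fun l => mbar.degree (b l)) t ∧
        Ω t ≤ Ω (barExp i 0 + barExp i 0) := by
      intro t ht
      obtain ⟨h1, s, hs, h2⟩ := hpstd t ht
      have := support_monomial_subset hs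
      rw [Finset.mem_singleton] at this
      exact ⟨h1, this ▸ h2⟩
    have hb : monomial (barExp i 0 + barExp i 0) (1 : A) =
        (barVar A i * barVar A i : MvPolynomial (Fin J ⊕ Fin n) A) := by
      have : (barVar A i : MvPolynomial (Fin J ⊕ Fin n) A) = monomial (barExp i 0) 1 := by
        rw [monomial_barExp, C_1, one_mul, rename_monomial, Finsupp.mapDomain_zero]
        exact (one_mul _).symm
      rw [this, monomial_mul, one_mul]
    have h1 := map_mem_liftedIdeal (ι := ι) hp
    rw [hb, map_sub, map_mul, map_barVar, ← Ideal.Quotient.eq_zero_iff_mem, map_sub, map_mul,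
      sub_eq_zero] at h1
    have h2 := congrArg θ h1
    rw [map_mul] at h2
    have h3 := h.mul_θ_eq_toFrac_barSum hθ hG fun t ht => (hstd t ht).1
    have h4 : map ι (G i) * map ι (G i) - map ι (G 0) * map ι (barSum G p) ∈ inputIdeal f := by
      rw [← toFrac_eq_iff, map_mul, map_mul, ← h3, ← h2, ← hG i, ← hG 0]
      simp only [barVar, Fin.cases_zero, map_one]
      ring
    have hGi : ∀ j, map ι (G j) ≠ 0 := fun j =>
      (h.reduction.map_injective.ne_iff' (map_zero _)).2 (hne j)
    have hN : map ι (barSum G p) ≠ 0 := by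
      intro h0
      rw [h0, mul_zero, sub_zero] at h4
      have h5 := h.prime.mem_or_mem h4
      exact hGi i (eq_zero_of_isNormal h.monic (h.reduction.isNormal_map_iff.2 (hGn i))
        (h5.elim id id))
    -- The relation `G_i² = Δ · ∑ c x^α G_j` in `S` yields a relation between weights.
    have h5 := h.typeI.natWeight_add_eq h.monic h.prime h.order (hGi i) (hGi i) (hGi 0) hN
      (h.reduction.isNormal_map_iff.2 (hGn i)) (h.reduction.isNormal_map_iff.2 (hGn i))
      (h.reduction.isNormal_map_iff.2 (hGn 0))
      (h.reduction.isNormal_map_iff.2 (IsNormal.barSum hGn p)) h4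
    rw [h.reduction.degree_map, h.reduction.degree_map, h.reduction.degree_map, hzero] at h5
    obtain ⟨t, ht, hdt⟩ := exists_mem_support_barMul
      (m.degree_mem_support fun h0 => hN (by rw [h0, map_zero]))
    have h6 := h.order.natWeight_le_degree hdt
    have h7 := (hstd t ht).2
    have h8 := natWeight_degree_barMul (w := w) h.presentation.canonical.monic
      (h.barDegree_le_one (hstd t ht).1)
    rw [(monic_barMul h.presentation.canonical.monic t).2] at h8
    rw [degree_barMul hne] at h6
    have h9 := hi (barIndex t)
    rw [map_add, lexWeight_barExp] at h7
    simp only [Finsupp.mapDomain_zero, map_zero, zero_add] at h7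
    rw [map_add] at h6 h8
    change _ ≤ W _ - W _ at h9
    change W _ + W _ = W _ + W _ at h5
    change W _ ≤ W _ + W _ at h6
    change Ω _ ≤ (W _ - W _) + (W _ - W _) at h7
    change W _ + W _ = Ω _ + W _ at h8
    set a := W (m.degree (G i))
    set a' := W (m.degree (g i))
    set c := W (m.degree (G (barIndex t)))
    set c' := W (m.degree (g (barIndex t)))
    set e := W ((barShift t).mapDomain Sum.inr)
    set z := W (m.degree (g 0))
    have h10 : a + a ≤ z + (e + c) := h5.le.trans (add_le_add_right h6 z)
    have h11 : e + c' ≤ (a' - z) + (a' - z) + z := h8.le.trans (add_le_add_left h7 z)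
    have h12 : c - c' ≤ a - a' := h9
    have h13 : (a - a') + (a - a') ≤ a - a' := by
      calc (a - a') + (a - a') = (a + a) - (a' + a') := by abel
        _ ≤ z + (e + c) - (a' + a') := sub_le_sub_right h10 _
        _ = (e + c') + (c - c') + (z - (a' + a')) := by abel
        _ ≤ ((a' - z) + (a' - z) + z) + (a - a') + (z - (a' + a')) :=
            add_le_add_left (add_le_add h11 h12) _
        _ = a - a' := by abel
    exact nonpos_of_add_le_left h13
  have hle := (hi j).trans hi0
  have hge : W (m.degree (g j)) ≤ W (m.degree (G j)) :=
    h.order.natWeight_le (hGred j ▸ degree_map_le m red (G j))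
  have heq : W (m.degree (G j)) = W (m.degree (g j)) := le_antisymm (sub_nonpos.1 hle) hge
  refine h.typeI.distinct _ _ (hGn j _ (m.degree_mem_support (hne j))) ?_
    (natWeight_eq_iff.1 heq)
  rw [← h.natDegree_eq]
  exact h.presentation.canonical.normal j _
    (m.degree_mem_support (h.presentation.canonical.monic j).ne_zero)

theorem degree_barMul_eq (t : Fin J ⊕ Fin n →₀ ℕ) :
    m.degree (barMul G t) = m.degree (barMul g t) := by
  have := h.reduction.isDomain
  rw [degree_barMul (h.G_ne_zero hGred), (monic_barMul h.presentation.canonical.monic t).2,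
    h.degree_G_eq hθ hGn hGred hG]

/-- If the leading coefficient of the numerator of an integral element vanishes modulo `π`, one can
subtract the numerator of an element of the lifted ring with the same reduction, and divide
by `π`, without changing the leading monomial. -/
theorem exists_sub_barSum_eq {H : MvPolynomial (Unit ⊕ Fin n) A} (hH0 : H ≠ 0)
    (hH : IsNormal f.natDegree H) {z : FracS f} (hz : (toFracP f).IsIntegralElem z)
    (hHz : toFracP f (map ι δ) * z = toFrac f (map ι H)) (hred : red (m.leadingCoeff H) = 0) :
    ∃ (p : MvPolynomial (Fin J ⊕ Fin n) A) (H₁ : MvPolynomial (Unit ⊕ Fin n) A),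
      (∀ t ∈ p.support, IsStandard (fun l => mbar.degree (b l)) t) ∧
      H - barSum G p = C π * H₁ ∧ IsNormal f.natDegree H₁ ∧ H₁ ≠ 0 ∧ m.degree H₁ = m.degree H ∧
      π * m.leadingCoeff H₁ = m.leadingCoeff H := by
  classical
  have := h.reduction.isDomain
  obtain ⟨p, hpstd, hp, hmax⟩ := h.exists_eq_barSum_map hH hz hHz
  have hle : m.degree (map red H) ≼[m] m.degree H := degree_map_le m red H
  obtain ⟨p', hp', hsub⟩ := h.reduction.exists_lift p
  have hred' : map red (barSum G p') = map red H := by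
    rw [map_barSum, hp', funext hGred, hp]
  obtain ⟨H₁, hH₁⟩ := h.reduction.exists_eq_mul_of_map_eq_zero (p := H - barSum G p')
    (by rw [map_sub, hred', sub_self])
  have hlt : ∀ s ∈ (barSum G p').support, s ≺[m] m.degree H := by
    intro s hs
    obtain ⟨t, ht, hst⟩ := exists_mem_support_barMul hs
    obtain ⟨hne, u, -, -, hmax⟩ := hmax ⟨t, hsub ht⟩
    have h1 : s ≼[m] m.degree (map red H) := by
      refine (m.le_degree hst).trans ?_
      rw [h.degree_barMul_eq hθ hGn hGred hG]
      exact hmax t (hsub ht)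
    refine h1.trans_lt (lt_of_le_of_ne hle fun h2 => ?_)
    have h3 := m.degree_mem_support hne
    rw [m.toSyn.injective h2, mem_support_iff, coeff_map] at h3
    exact h3 hred
  have hcoeff : π * H₁.coeff (m.degree H) = m.leadingCoeff H := by
    have h1 := congrArg (coeff (m.degree H)) hH₁
    rw [coeff_sub, coeff_C_mul, notMem_support_iff.1 fun hs => lt_irrefl _ (hlt _ hs),
      sub_zero] at h1
    exact h1.symm
  have hlc0 : m.leadingCoeff H ≠ 0 := m.leadingCoeff_ne_zero_iff.2 hH0
  have hc0 : H₁.coeff (m.degree H) ≠ 0 := fun h0 => hlc0 (by rw [← hcoeff, h0, mul_zero])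
  have hsupp : ∀ s ∈ H₁.support, s ∈ (H - barSum G p').support := fun s hs => by
    rw [hH₁, mem_support_iff, coeff_C_mul]
    exact mul_ne_zero h.reduction.ne_zero (mem_support_iff.1 hs)
  have hdeg : m.degree H₁ = m.degree H := by
    refine m.toSyn.injective (le_antisymm (m.degree_le_iff.2 fun s hs => ?_)
      (m.le_degree (mem_support_iff.2 hc0)))
    rcases Finset.mem_union.1 (support_sub _ _ _ (hsupp s hs)) with h2 | h2
    · exact m.le_degree h2
    · exact (hlt s h2).le
  refine ⟨p', H₁, fun t ht => hpstd t (hsub ht), hH₁, fun s hs =>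
    (hH.sub (IsNormal.barSum hGn p')) s (hsupp s hs), fun h0 => hc0 (by rw [h0, coeff_zero]),
    hdeg, ?_⟩
  rw [MonomialOrder.leadingCoeff, hdeg, hcoeff]

include hint

/-- The leading monomial of the numerator of an integral element is that of some `x^α g_j`. -/
theorem exists_degree_eq (i : ℕ) {H : MvPolynomial (Unit ⊕ Fin n) A} (hH0 : H ≠ 0)
    (hH : IsNormal f.natDegree H) {z : FracS f} (hz : (toFracP f).IsIntegralElem z)
    (hHz : toFracP f (map ι δ) * z = toFrac f (map ι H))
    (hdvd : ¬ π ^ (i + 1) ∣ m.leadingCoeff H) :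
    ∃ t, IsStandard (fun l => mbar.degree (b l)) t ∧ m.degree H = m.degree (barMul g t) := by
  induction i generalizing H z with
  | zero =>
    refine h.exists_degree_eq_of_red_ne_zero hH hz hHz fun h0 => hdvd ?_
    rw [zero_add, pow_one]
    exact (h.reduction.red_eq_zero _).1 h0
  | succ i ih =>
    by_cases hred : red (m.leadingCoeff H) = 0
    · obtain ⟨p, H₁, hp, hH₁, hn, hne, hdeg, hlc⟩ :=
        h.exists_sub_barSum_eq hθ hGn hGred hG hH0 hH hz hHz hred
      have hπ : (C (ι π)⁻¹ * C (ι π) : MvPolynomial (Unit ⊕ Fin n) K) = 1 := by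
        rw [← C_mul, inv_mul_cancel₀ h.reduction.ι_ne_zero, C_1]
      have hz₁ : (toFracP f).IsIntegralElem
          (toFrac f (C (ι π)⁻¹) * (z - θ (Ideal.Quotient.mk _ (map ι p)))) :=
        (isIntegralElem_toFrac h.monic _).mul _ (hz.sub _ (hint _))
      have hHz₁ : toFracP f (map ι δ) *
          (toFrac f (C (ι π)⁻¹) * (z - θ (Ideal.Quotient.mk _ (map ι p)))) =
            toFrac f (map ι H₁) := by
        rw [mul_left_comm, mul_sub, hHz, h.mul_θ_eq_toFrac_barSum hθ hG hp, ← map_sub, ← map_sub,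
          hH₁, ← map_mul, map_mul (map ι), map_C, ← mul_assoc, hπ, one_mul]
      rw [← hdeg]
      refine ih hne hn hz₁ hHz₁ fun hd => hdvd ?_
      rw [← hlc, pow_succ' π (i + 1)]
      exact mul_dvd_mul_left _ hd
    · exact h.exists_degree_eq_of_red_ne_zero hH hz hHz hred

/-- The lifted ring is integrally closed: the numerator of an integral element can be reduced to
zero by subtracting numerators of elements of the lifted ring. -/
theorem mem_range {z : FracS f} (hz : (toFracP f).IsIntegralElem z) : z ∈ Set.range θ := by
  classical
  have := h.reduction.isDomain
  -- Induction on the leading monomial of the numerator.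
  have key : ∀ (H : MvPolynomial (Unit ⊕ Fin n) K) (z : FracS f), IsNormal f.natDegree H →
      (toFracP f).IsIntegralElem z → toFracP f (map ι δ) * z = toFrac f H → z ∈ θ.range := by
    intro H
    induction hu : m.toSyn (m.degree H) using WellFoundedLT.induction generalizing H with
    | ind u ih =>
    subst hu
    intro z hH hz hHz
    by_cases hH0 : H = 0
    · rw [hH0, map_zero, h.isUnit.mul_right_eq_zero] at hHz
      rw [hHz]
      exact zero_mem _
    obtain ⟨i, HA, hHA⟩ := h.reduction.exists_C_mul_eq_map H
    have hC := h.reduction.C_ne_zero (σ := Unit ⊕ Fin n) i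
    have hHA0 : HA ≠ 0 := by
      rintro rfl
      rw [map_zero] at hHA
      exact mul_ne_zero hC hH0 hHA
    have hdegA : m.degree HA = m.degree H := by
      rw [← h.reduction.degree_map, ← hHA, m.degree_mul hC hH0, m.degree_C, zero_add]
    obtain ⟨l, hl⟩ := h.reduction.exists_not_dvd _ (m.leadingCoeff_ne_zero_iff.2 hHA0)
    obtain ⟨t, ht, hdeg⟩ := h.exists_degree_eq hθ hint hGn hGred hG l hHA0
      (h.reduction.isNormal_map_iff.1 (hHA ▸ hH.C_mul _))
      (z := toFrac f (C (ι (π ^ i))) * z) ((isIntegralElem_toFrac h.monic _).mul _ hz)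
      (by rw [mul_left_comm, hHz, ← map_mul, hHA]) hl
    set B := map ι (barMul G t) with hB
    have hBdeg : m.degree B = m.degree H := by
      rw [hB, h.reduction.degree_map, h.degree_barMul_eq hθ hGn hGred hG, ← hdeg, hdegA]
    have hB0 : B.coeff (m.degree H) ≠ 0 := by
      rw [← hBdeg, m.coeff_degree_ne_zero_iff]
      refine (h.reduction.map_injective.ne_iff' (map_zero _)).2 (mul_ne_zero ?_
        (h.G_ne_zero hGred _))
      rw [rename_monomial, Ne, monomial_eq_zero]
      exact one_ne_zero
    have hBn : IsNormal f.natDegree B := h.reduction.isNormal_map_iff.2 (IsNormal.barMul hGn t)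
    have hBθ : toFracP f (map ι δ) * θ (Ideal.Quotient.mk _ (map ι (monomial t 1))) =
        toFrac f B := by
      rw [h.mul_θ_eq_toFrac_barSum hθ hG fun s hs => ?_, barSum_monomial_one]
      have := support_monomial_subset hs
      rw [Finset.mem_singleton] at this
      exact this ▸ ht
    set c := H.coeff (m.degree H) / B.coeff (m.degree H)
    have hx : toFracP f (map ι δ) * θ (Ideal.Quotient.mk _ (C c * map ι (monomial t 1))) =
        toFrac f (C c * B) := by
      rw [map_mul, map_mul, θ_C hθ, mul_left_comm, hBθ, map_mul]
    set x := Ideal.Quotient.mk (liftedIdeal ι β) (C c * map ι (monomial t 1))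
    have hsub : z - θ x ∈ θ.range := by
      have hHz' : toFracP f (map ι δ) * (z - θ x) = toFrac f (H - C c * B) := by
        rw [mul_sub, hHz, hx, map_sub]
      by_cases h0 : H - C c * B = 0
      · rw [h0, map_zero, h.isUnit.mul_right_eq_zero] at hHz'
        rw [hHz']
        exact zero_mem _
      · refine ih _ ?_ _ rfl _ (hH.sub (hBn.C_mul c)) (hz.sub _ (hint _)) hHz'
        refine lt_of_le_of_ne (m.degree_le_iff.2 fun s hs => ?_) fun he => ?_
        · rcases Finset.mem_union.1 (support_sub _ _ _ hs) with h2 | h2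
          · exact m.le_degree h2
          · rw [mem_support_iff, coeff_C_mul] at h2
            rw [← hBdeg]
            exact m.le_degree (mem_support_iff.2 (right_ne_zero_of_mul h2))
        · have h2 := m.degree_mem_support h0
          rw [m.toSyn.injective he, mem_support_iff, coeff_sub, coeff_C_mul,
            div_mul_cancel₀ _ hB0, sub_self] at h2
          exact h2 rfl
    have := add_mem hsub (AlgHom.mem_range_self θ x)
    rwa [sub_add_cancel] at this
  obtain ⟨r, hr⟩ := ((mem_closureIn_iff h.monic h.conductor).2 hz).2
  obtain ⟨H, hrH, hH⟩ := h.led.exists_normal r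
  exact key H z hH hz (hr.trans (toFrac_eq_iff.2 hrH))

end IsLiftedPresentation

end Normality

/-! ### The lifted ring is the integral closure -/

section IntegralClosure

variable {A K k : Type} [CommRing A] [Field K] [Field k] {ι : A →+* K} {red : A →+* k} {π : A}
  {n J N : ℕ} {m : MonomialOrder (Unit ⊕ Fin n)} {mbar : MonomialOrder (Fin J ⊕ Fin n)}
  {w : Unit ⊕ Fin n → Fin n → ℕ} {f : Polynomial (MvPolynomial (Fin n) K)}
  {wt : InputRing f → Fin n → ℕ} {f' : Polynomial (MvPolynomial (Fin n) k)}
  {φ : MvPolynomial (Unit ⊕ Fin n) A} {δ : MvPolynomial (Fin n) A}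
  {g : Fin (J + 1) → MvPolynomial (Unit ⊕ Fin n) k}
  {b : Fin N → MvPolynomial (Fin J ⊕ Fin n) k}
  {β : Fin N → MvPolynomial (Fin J ⊕ Fin n) A} {υ : MvPolynomial (Fin J ⊕ Fin n) A}

theorem IsLiftedPresentation.exists_algHom
    (h : IsLiftedPresentation ι red π m mbar w f wt f' φ δ g b β υ) :
    ∃ θ : (MvPolynomial (Fin J ⊕ Fin n) K ⧸ liftedIdeal ι β) →ₐ[K] FracS f,
      Function.Injective θ ∧
      (∀ r, θ (Ideal.Quotient.mk _ (psiHom (map ι υ) r)) = toFrac f r) ∧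
      Set.range θ = closureIn f (map ι δ) := by
  obtain ⟨θ, hinj, hθ, hint⟩ := h.exists_embedding
  obtain ⟨G, hGn, hGred, hG⟩ := h.exists_numerators hθ hint
  refine ⟨θ, hinj, hθ, Set.ext fun z => ⟨?_, fun hz => ?_⟩⟩
  · rintro ⟨t, rfl⟩
    exact (mem_closureIn_iff h.monic h.conductor).2 (hint t)
  · exact h.mem_range hθ hint hGn hGred hG hz.1

theorem closureIn_eq {F : Type} [Field F] {f : Polynomial (MvPolynomial (Fin n) F)}
    {Δ : MvPolynomial (Fin n) F} (hf : f.Monic) (hΔ : IsConductor f Δ) :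
    closureIn f Δ = {z | IsIntegral (InputRing f) z} :=
  Set.ext fun z => (mem_closureIn_iff hf hΔ).trans (isIntegral_iff_isIntegralElem hf z).symm

/-- Two presentations of the same subalgebra are isomorphic. -/
theorem exists_algEquiv_of_range_eq {F R T Q : Type} [Field F] [CommRing R] [CommRing T]
    [CommRing Q] [Algebra F R] [Algebra F T] [Algebra F Q] (ev : R →ₐ[F] Q) (θ : T →ₐ[F] Q)
    (hθ : Function.Injective θ) (h : Set.range ev = Set.range θ) :
    ∃ e : (R ⧸ RingHom.ker ev) ≃ₐ[F] T, ∀ p, θ (e (Ideal.Quotient.mk _ p)) = ev p := by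
  have hr : ev.range = θ.range := SetLike.coe_injective (by simpa using h)
  refine ⟨(Ideal.quotientKerEquivRange ev).trans ((Subalgebra.equivOfEq _ _ hr).trans
    (AlgEquiv.ofInjective θ hθ).symm), fun p => ?_⟩
  have : ∀ y : θ.range, θ ((AlgEquiv.ofInjective θ hθ).symm y) = y := fun y => by
    conv_rhs => rw [← (AlgEquiv.ofInjective θ hθ).apply_symm_apply y]
    rfl
  rw [AlgEquiv.trans_apply, AlgEquiv.trans_apply, this]
  rfl

end IntegralClosure

/-! ### The local ring of `ℚ` at a prime -/

section LocalRing

/-- The rational numbers whose denominator is prime to `q`. -/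
def denomPrimeTo (q : ℕ) [Fact q.Prime] : Subring ℚ where
  carrier := {r | (r.den : ZMod q) ≠ 0}
  mul_mem' {r s} hr hs h := by
    obtain ⟨c, hc⟩ := Rat.mul_den_dvd r s
    refine mul_ne_zero hr hs ?_
    rw [← Nat.cast_mul, hc, Nat.cast_mul, h, zero_mul]
  one_mem' := by simp
  add_mem' {r s} hr hs h := by
    obtain ⟨c, hc⟩ := Rat.add_den_dvd r s
    refine mul_ne_zero hr hs ?_
    rw [← Nat.cast_mul, hc, Nat.cast_mul, h, zero_mul]
  zero_mem' := by simp
  neg_mem' {r} hr := by simpa using hr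

variable {q : ℕ} [Fact q.Prime]

theorem mem_denomPrimeTo {r : ℚ} : r ∈ denomPrimeTo q ↔ ¬ q ∣ r.den := by
  rw [← ZMod.natCast_eq_zero_iff]
  rfl

/-- Reduction modulo `q`. -/
def redMod (q : ℕ) [Fact q.Prime] : denomPrimeTo q →+* ZMod q where
  toFun r := ((r : ℚ) : ZMod q)
  map_one' := by simp
  map_mul' r s := Rat.cast_mul_of_ne_zero r.2 s.2
  map_zero' := by simp
  map_add' r s := Rat.cast_add_of_ne_zero r.2 s.2

theorem redMod_apply (r : denomPrimeTo q) :
    redMod q r = ((r : ℚ).num : ZMod q) / ((r : ℚ).den : ZMod q) := Rat.cast_def _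

theorem div_mem_denomPrimeTo (a : ℤ) {d : ℕ} (hd : ¬ q ∣ d) : (a / d : ℚ) ∈ denomPrimeTo q := by
  rw [mem_denomPrimeTo]
  intro h
  have := Rat.den_dvd a d
  rw [Rat.divInt_eq_div, Int.cast_natCast] at this
  exact hd (h.trans (Int.natCast_dvd_natCast.1 this))

theorem isReduction_redMod (q : ℕ) [hq : Fact q.Prime] :
    IsReduction (denomPrimeTo q).subtype (redMod q) (q : denomPrimeTo q) where
  injective := Subtype.val_injective
  surjective x := by
    obtain ⟨a, rfl⟩ := ZMod.intCast_surjective x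
    exact ⟨a, map_intCast _ a⟩
  red_eq_zero r := by
    constructor
    · intro h
      rw [redMod_apply, div_eq_zero_iff, or_iff_left r.2, ZMod.intCast_zmod_eq_zero_iff_dvd] at h
      obtain ⟨a, ha⟩ := h
      refine ⟨⟨_, div_mem_denomPrimeTo a (mem_denomPrimeTo.1 r.2)⟩, Subtype.ext ?_⟩
      have hd : ((r : ℚ).den : ℚ) ≠ 0 := by exact_mod_cast (r : ℚ).den_ne_zero
      conv_lhs => rw [← Rat.num_div_den (r : ℚ), ha]
      push_cast
      ring
    · rintro ⟨s, rfl⟩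
      rw [map_mul, map_natCast, ZMod.natCast_self, zero_mul]
  ne_zero h := by
    have := congrArg Subtype.val h
    push_cast at this
    exact hq.out.ne_zero (by exact_mod_cast this)
  exists_mul_eq x := by
    obtain ⟨i, d, hd, hxd⟩ := Nat.exists_eq_pow_mul_and_not_dvd x.den_ne_zero q hq.out.ne_one
    refine ⟨i, ⟨_, div_mem_denomPrimeTo x.num hd⟩, ?_⟩
    have hd0 : (d : ℚ) ≠ 0 := by
      rintro h0
      exact hd (by rw [Nat.cast_eq_zero.1 h0]; exact dvd_zero q)
    have hq0 : (q : ℚ) ≠ 0 := by exact_mod_cast hq.out.ne_zero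
    have hx := Rat.num_div_den x
    rw [hxd] at hx
    simp only [map_pow, map_natCast, Subring.subtype_apply]
    conv_lhs => rw [← hx]
    push_cast
    field_simp
  exists_not_dvd r hr := by
    refine ⟨(r : ℚ).num.natAbs, ?_⟩
    rintro ⟨s, hs⟩
    have h1 : (r : ℚ) = (q : ℚ) ^ ((r : ℚ).num.natAbs + 1) * (s : ℚ) := by
      have := congrArg Subtype.val hs
      simpa using this
    have h2 : (r : ℚ).num * (s : ℚ).den =
        (q : ℤ) ^ ((r : ℚ).num.natAbs + 1) * ((s : ℚ).num * (r : ℚ).den) := by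
      have h3 : ((r : ℚ).num : ℚ) = (r : ℚ) * (r : ℚ).den := (Rat.mul_den_eq_num _).symm
      have h4 : ((s : ℚ).num : ℚ) = (s : ℚ) * (s : ℚ).den := (Rat.mul_den_eq_num _).symm
      have : ((r : ℚ).num : ℚ) * (s : ℚ).den =
        (q : ℚ) ^ ((r : ℚ).num.natAbs + 1) * ((s : ℚ).num * (r : ℚ).den) := by
        rw [h3, h4]
        linear_combination ((r : ℚ).den * (s : ℚ).den : ℚ) * h1
      exact_mod_cast this
    have h3 : q ^ ((r : ℚ).num.natAbs + 1) ∣ (r : ℚ).num.natAbs := by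
      have hc : Nat.Coprime (q ^ ((r : ℚ).num.natAbs + 1)) (s : ℚ).den :=
        Nat.Coprime.pow_left _ ((Nat.Prime.coprime_iff_not_dvd hq.out).2 (mem_denomPrimeTo.1 s.2))
      refine hc.dvd_of_dvd_mul_right ?_
      have h4 := Int.natAbs_dvd_natAbs.2 (Dvd.intro _ h2.symm)
      simpa [Int.natAbs_mul, Int.natAbs_pow] using h4
    have h0 : 0 < (r : ℚ).num.natAbs := by
      rw [Int.natAbs_pos, Ne, Rat.num_eq_zero]
      exact fun h0 => hr (Subtype.ext h0)
    exact absurd (Nat.le_of_dvd h0 h3) (not_le.2 ((Nat.lt_succ_self _).trans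
      (Nat.lt_pow_self hq.out.one_lt)))

end LocalRing

/-! ### Coefficientwise reduction and rational reconstruction -/

section Reconstruction

variable {σ : Type}

theorem IsModImage.exists_lift {q : ℕ} [Fact q.Prime] {p : MvPolynomial σ ℚ}
    {p' : MvPolynomial σ (ZMod q)} (h : IsModImage q p p') :
    ∃ P : MvPolynomial σ (denomPrimeTo q), map (denomPrimeTo q).subtype P = p ∧
      map (redMod q) P = p' := by
  classical
  let c : (σ →₀ ℕ) → denomPrimeTo q := fun t => ⟨p.coeff t, mem_denomPrimeTo.2 (h t).1⟩
  have hc : ∀ t, coeff t (∑ s ∈ p.support, monomial s (c s)) = c t := by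
    intro t
    simp only [coeff_sum, coeff_monomial, Finset.sum_ite_eq']
    split_ifs with ht
    · rfl
    · exact (Subtype.ext (notMem_support_iff.1 ht)).symm
  refine ⟨∑ t ∈ p.support, monomial t (c t), ?_, ?_⟩ <;> ext t <;> rw [coeff_map, hc]
  · rfl
  · rw [redMod_apply, div_eq_iff (mem_denomPrimeTo.2 (h t).1)]
    exact (h t).2.symm

theorem IsModImage.eq_zero {q : ℕ} [Fact q.Prime] {p' : MvPolynomial σ (ZMod q)}
    (h : IsModImage q 0 p') : p' = 0 := by
  obtain ⟨P, hP, rfl⟩ := h.exists_lift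
  rw [(isReduction_redMod q).map_injective.eq_iff' (map_zero _)] at hP
  rw [hP, map_zero]

theorem IsModImage.eq_one {q : ℕ} [Fact q.Prime] {p' : MvPolynomial σ (ZMod q)}
    (h : IsModImage q 1 p') : p' = 1 := by
  obtain ⟨P, hP, rfl⟩ := h.exists_lift
  rw [(isReduction_redMod q).map_injective.eq_iff' (map_one _)] at hP
  rw [hP, map_one]

section

variable {q n : ℕ} {f : Polynomial (MvPolynomial (Fin n) ℚ)}
  {f' : Polynomial (MvPolynomial (Fin n) (ZMod q))} [Fact q.Prime]
  (h : ∀ i, IsModImage q (f.coeff i) (f'.coeff i))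
include h

theorem isModImage_evalY : IsModImage q (evalY f) (evalY f') := by
  intro a
  obtain ⟨α, hα⟩ := exponent_eq a
  rw [hα, coeff_evalY, coeff_evalY]
  exact h _ α

theorem natDegree_eq_and_monic_of_isModImage (hf : f.Monic) :
    f'.natDegree = f.natDegree ∧ f'.Monic := by
  have h1 : f'.coeff f.natDegree = 1 :=
    IsModImage.eq_one (by simpa [hf.coeff_natDegree] using h f.natDegree)
  have h2 : f'.natDegree ≤ f.natDegree := by
    refine Polynomial.natDegree_le_iff_coeff_eq_zero.2 fun i hi => IsModImage.eq_zero ?_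
    have := h i
    rwa [Polynomial.coeff_eq_zero_of_natDegree_lt hi] at this
  exact ⟨Polynomial.natDegree_eq_of_le_of_coeff_ne_zero h2 (h1 ▸ one_ne_zero),
    Polynomial.monic_of_natDegree_le_of_coeff_eq_one _ h2 h1⟩

end

variable {L : Type} [Fintype L] {q : L → ℕ} {p : ∀ l, MvPolynomial σ (ZMod (q l))}
  {p₀ : MvPolynomial σ ℚ}

/-- The reconstructed coefficient `α/β` has denominator prime to the modulus, since a prime that
divides `N` and `β` divides `α`. -/
theorem IsLift.isModImage [∀ l, Fact (q l).Prime] (h : IsLift q p p₀) (l : L) :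
    IsModImage (q l) p₀ (p l) := by
  intro a
  obtain ⟨c, hc, hN, -⟩ := h a
  have hl : ((q l : ℕ) : ℤ) ∣ c * (p₀.coeff a).den - (p₀.coeff a).num :=
    (Int.natCast_dvd_natCast.2 (Finset.dvd_prod_of_mem q (Finset.mem_univ l))).trans hN
  constructor
  · intro hd
    have h1 : ((q l : ℕ) : ℤ) ∣ (p₀.coeff a).num :=
      (dvd_sub_right ((Int.natCast_dvd_natCast.2 hd).mul_left c)).1 hl
    exact Nat.not_coprime_of_dvd_of_dvd (Fact.out : (q l).Prime).one_lt
      (Int.natCast_dvd.1 h1) hd (p₀.coeff a).reduced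
  · rw [← hc l, ← sub_eq_zero]
    have := (ZMod.intCast_zmod_eq_zero_iff_dvd _ _).2 hl
    push_cast at this
    exact this

theorem intCast_prod_dvd [∀ l, Fact (q l).Prime] (hq : Function.Injective q) {c : ℤ}
    (h : ∀ l, (c : ZMod (q l)) = 0) : ((∏ l, q l : ℕ) : ℤ) ∣ c := by
  rw [Nat.cast_prod]
  refine Fintype.prod_dvd_of_coprime (fun l l' hl => ?_) fun l =>
    (ZMod.intCast_zmod_eq_zero_iff_dvd _ _).1 (h l)
  exact Nat.isCoprime_iff_coprime.2 ((Nat.coprime_primes Fact.out Fact.out).2 (hq.ne hl))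

theorem IsLift.coeff_eq_zero [∀ l, Fact (q l).Prime] (hq : Function.Injective q)
    (h : IsLift q p p₀) {a : σ →₀ ℕ} (ha : ∀ l, (p l).coeff a = 0) : p₀.coeff a = 0 := by
  obtain ⟨c, hc, -, hmin⟩ := h a
  have h1 := hmin 0 (by simpa using intCast_prod_dvd hq fun l => (hc l).trans (ha l))
  have h2 : 0 < (p₀.coeff a).den := (p₀.coeff a).den_pos
  simp only [Rat.num_zero, Rat.den_zero] at h1
  rw [← Rat.num_eq_zero]
  have h3 : (p₀.coeff a).num ^ 2 ≤ 0 := by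
    have : (1 : ℤ) ≤ ((p₀.coeff a).den : ℤ) ^ 2 := one_le_pow₀ (by exact_mod_cast h2)
    rcases h1 with h1 | ⟨h1, -⟩ <;> push_cast at h1 <;> linarith
  exact pow_eq_zero_iff two_ne_zero |>.1 (le_antisymm h3 (sq_nonneg _))

theorem IsLift.coeff_eq_one [∀ l, Fact (q l).Prime] [Nonempty L] (hq : Function.Injective q)
    (h : IsLift q p p₀) {a : σ →₀ ℕ} (ha : ∀ l, (p l).coeff a = 1) : p₀.coeff a = 1 := by
  obtain ⟨c, hc, hN, hmin⟩ := h a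
  have hdvd : ((∏ l, q l : ℕ) : ℤ) ∣ c - 1 :=
    intCast_prod_dvd hq fun l => by rw [Int.cast_sub, hc l, ha l, Int.cast_one, sub_self]
  have h1 := hmin 1 (by simpa using hdvd)
  set r := p₀.coeff a
  have h2 : (1 : ℤ) ≤ (r.den : ℤ) := by exact_mod_cast r.den_pos
  simp only [Rat.num_one, Rat.den_one] at h1
  have hden : (r.den : ℤ) = 1 := by
    by_contra h3
    have h4 : (2 : ℤ) ≤ r.den := by omega
    rcases h1 with h1 | ⟨h1, -⟩ <;> push_cast at h1 <;> nlinarith [sq_nonneg r.num]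
  rw [hden] at h1
  -- The modulus is not a unit, so that `0` is no candidate.
  have hnum : r.num ≠ 0 := by
    intro h0
    rw [hden, h0, mul_one, sub_zero] at hN
    have h3 : ((∏ l, q l : ℕ) : ℤ) ∣ 1 := (dvd_sub_right hN).1 hdvd
    obtain ⟨l⟩ := ‹Nonempty L›
    have h4 : q l ∣ 1 := by
      refine Int.natCast_dvd_natCast.1 (dvd_trans ?_ h3)
      exact Int.natCast_dvd_natCast.2 (Finset.dvd_prod_of_mem q (Finset.mem_univ l))
    exact (Fact.out : (q l).Prime).one_lt.ne' (Nat.dvd_one.1 h4)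
  have h5 : r.num = 1 := by
    have h6 : 0 < r.num ^ 2 := by positivity
    rcases h1 with h1 | ⟨h1, h7 | ⟨-, h7⟩⟩
    · push_cast at h1; linarith
    · have : r.den = 1 := by exact_mod_cast hden
      omega
    · push_cast at h1
      have : r.num ^ 2 = 1 := by linarith
      nlinarith
  rw [← Rat.num_div_den r, h5, show r.den = 1 by exact_mod_cast hden]
  simp

theorem IsLift.exists_mem_support [∀ l, Fact (q l).Prime] (hq : Function.Injective q)
    (h : IsLift q p p₀) {a : σ →₀ ℕ} (ha : a ∈ p₀.support) : ∃ l, a ∈ (p l).support := by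
  by_contra! h'
  exact mem_support_iff.1 ha (h.coeff_eq_zero hq fun l => notMem_support_iff.1 (h' l))

/-- The lift of monic polynomials with a common leading monomial is monic with the same leading
monomial. -/
theorem IsLift.degree_eq_and_monic [∀ l, Fact (q l).Prime] [Nonempty L]
    (hq : Function.Injective q) (h : IsLift q p p₀) (m : MonomialOrder σ)
    (hp : ∀ l, m.Monic (p l)) {e : σ →₀ ℕ} (he : ∀ l, m.degree (p l) = e) :
    m.degree p₀ = e ∧ m.Monic p₀ := by
  have h1 : p₀.coeff e = 1 :=
    h.coeff_eq_one hq fun l => by rw [← he l]; exact hp l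
  have h2 : m.degree p₀ = e := by
    refine m.toSyn.injective (le_antisymm (m.degree_le_iff.2 fun a ha => ?_)
      (m.le_degree (mem_support_iff.2 (by rw [h1]; exact one_ne_zero))))
    obtain ⟨l, hl⟩ := h.exists_mem_support hq ha
    rw [← he l]
    exact m.le_degree hl
  exact ⟨h2, by rw [MonomialOrder.Monic, MonomialOrder.leadingCoeff, h2, h1]⟩

end Reconstruction

/-! ### Lifting from several primes -/

theorem theorem15 {n J K : ℕ}
    -- the input over `ℚ`: an affine domain `S⁽⁰⁾ = P⁽⁰⁾[y]/⟨f(y)⟩` of type I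
    (f : Polynomial (MvPolynomial (Fin n) ℚ)) (hf : f.Monic) (hprime : (inputIdeal f).IsPrime)
    (wt : InputRing f → Fin n → ℕ) (w : Unit ⊕ Fin n → Fin n → ℕ) (hwt : IsTypeI f wt w)
    -- the orderings on the input and output polynomial rings
    (m : MonomialOrder (Unit ⊕ Fin n)) (hm : IsWeightOverGrevlex m w)
    (mbar : MonomialOrder (Fin J ⊕ Fin n)) (hmbar : IsDependentDegreeFirst mbar)
    -- the monic conductor element
    (Δ : MvPolynomial (Fin n) ℚ) (hΔmonic : m.Monic (inclP Unit Δ)) (hΔ : IsConductor f Δ)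
    -- the primes, and the images of `f` and `Δ`
    {L : Type} [Fintype L] [Nonempty L] (q : L → ℕ) [hq : ∀ l, Fact (q l).Prime]
    (hqinj : Function.Injective q)
    (fq : ∀ l, Polynomial (MvPolynomial (Fin n) (ZMod (q l))))
    (hfq : ∀ l i, IsModImage (q l) (f.coeff i) ((fq l).coeff i))
    (Δq : ∀ l, MvPolynomial (Fin n) (ZMod (q l))) (hΔq : ∀ l, IsModImage (q l) Δ (Δq l))
    -- the presentations in positive characteristic, compatible with each other
    (g : ∀ l, Fin (J + 1) → MvPolynomial (Unit ⊕ Fin n) (ZMod (q l)))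
    (b : ∀ l, Fin K → MvPolynomial (Fin J ⊕ Fin n) (ZMod (q l)))
    (hpres : ∀ l, IsCanonicalPresentation m mbar w (fq l) (Δq l) (g l) (b l))
    (hLMg : ∀ l l' j, m.degree (g l j) = m.degree (g l' j))
    (hLMb : ∀ l l' k, mbar.degree (b l k) = mbar.degree (b l' k))
    -- the inclusion maps in positive characteristic, given by the images of `y`
    (yq : ∀ l, MvPolynomial (Fin J ⊕ Fin n) (ZMod (q l)))
    (hyq : ∀ l, evalBar (fq l) (Δq l) (g l) (yq l) = toFrac (fq l) (X (Sum.inl ())))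
    -- the lifted relations and the lifted map
    (bN : Fin K → MvPolynomial (Fin J ⊕ Fin n) ℚ) (hbN : ∀ k, IsLift q (fun l => b l k) (bN k))
    (yN : MvPolynomial (Fin J ⊕ Fin n) ℚ) (hyN : IsLift q yq yN)
    -- the stopping criterion
    (hGB : IsGroebnerBasis mbar bN (Ideal.span (Set.range bN)))
    (hI : ∀ r ∈ inputIdeal f, psi yN r ∈ Ideal.span (Set.range bN)) :
    -- the lifted presentation is the integral closure, compatibly with the map `psi yN`
    (∃ θ : (MvPolynomial (Fin J ⊕ Fin n) ℚ ⧸ Ideal.span (Set.range bN)) →ₐ[ℚ] FracS f,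
      Function.Injective θ ∧
      (∀ r, θ (Ideal.Quotient.mk _ (psi yN r)) = toFrac f r) ∧
      Set.range θ = closureIn f Δ ∧
      Set.range θ = {z | IsIntegral (InputRing f) z}) ∧
    -- and it is isomorphic to the presentation given by any canonical set over `ℚ`
    (∀ (J₀ : ℕ) (g₀ : Fin (J₀ + 1) → MvPolynomial (Unit ⊕ Fin n) ℚ), IsCanonical m f Δ g₀ →
      ∃ e : (MvPolynomial (Fin J₀ ⊕ Fin n) ℚ ⧸ inducedIdeal f Δ g₀) ≃ₐ[ℚ]
          (MvPolynomial (Fin J ⊕ Fin n) ℚ ⧸ Ideal.span (Set.range bN)),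
        ∀ p r, evalBar f Δ g₀ p = toFrac f r →
          e (Ideal.Quotient.mk _ p) = Ideal.Quotient.mk _ (psi yN r)) := by
  classical
  have hred := fun l => isReduction_redMod (q l)
  have hdm := fun l => natDegree_eq_and_monic_of_isModImage (hfq l) hf
  -- In each relation modulo `q l'`, the leading monomial has the largest weight. So it has in the
  -- lifted relation, whose support lies in the union of the supports of its reductions.
  have hweight : ∀ l k, ∀ t ∈ (bN k).support, lexWeight (inducedWeight m w (g l)) t ≤
      lexWeight (inducedWeight m w (g l)) (mbar.degree (b l k)) := by
    intro l k t ht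
    obtain ⟨l', hl'⟩ := (hbN k).exists_mem_support hqinj ht
    obtain ⟨φ, hφ, hφ'⟩ := (isModImage_evalY (hfq l')).exists_lift
    have hw : ∀ t ∈ (evalY (fq l')).support,
        natWeight w t ≤ natWeight w (Finsupp.single (Sum.inl ()) (fq l').natDegree) :=
      fun t ht => (hred l').natWeight_le hwt hf hprime hφ hφ' (hdm l').1 ht
    have hg : inducedWeight m w (g l) = inducedWeight m w (g l') := by
      simp only [inducedWeight, hLMg l l']
    rw [hg, hLMb l l']
    exact (hpres l').lexWeight_le (isLedByPower_of_natWeight_le (hdm l').2 hm hw) (hdm l').2 hm hw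
      hmbar k hl'
  have hbar : ∀ l k, mbar.degree (bN k) = mbar.degree (b l k) ∧ mbar.Monic (bN k) := fun l k =>
    (hbN k).degree_eq_and_monic hqinj mbar (fun l' => (hpres l').groebner.2.1 k) fun l' =>
      hLMb l' l k
  obtain ⟨l⟩ := ‹Nonempty L›
  obtain ⟨φ, hφ, hφ'⟩ := (isModImage_evalY (hfq l)).exists_lift
  obtain ⟨δ, rfl, hδ'⟩ := (hΔq l).exists_lift
  obtain ⟨υ, rfl, hυ'⟩ := (hyN.isModImage l).exists_lift
  choose β hβ hβ' using fun k => ((hbN k).isModImage l).exists_lift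
  obtain rfl : (fun k => map (denomPrimeTo (q l)).subtype (β k)) = bN := funext hβ
  have hlift : IsLiftedPresentation (denomPrimeTo (q l)).subtype (redMod (q l)) (q l) m mbar w f wt
      (fq l) φ δ (g l) (b l) β υ :=
    { reduction := hred l
      order := hm
      bar_order := hmbar
      monic := hf
      prime := hprime
      typeI := hwt
      monic' := (hdm l).2
      natDegree_eq := (hdm l).1
      map_φ := hφ
      red_φ := hφ'
      conductor := hΔ
      monic_δ := hΔmonic
      presentation := hδ' ▸ hpres l
      red_β := hβ'
      monic_β := fun k => by
        have := (hbar l k).2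
        rw [MonomialOrder.Monic, MonomialOrder.leadingCoeff, (hred l).degree_map, coeff_map] at this
        exact (hred l).injective (this.trans (map_one _).symm)
      degree_β := fun k => by rw [← (hred l).degree_map, (hbar l k).1]
      weight_β := fun k t ht => hweight l k t (by rwa [(hred l).support_map])
      groebner := hGB
      eval_υ := by rw [hδ', hυ']; exact hyq l
      psi_mem := hI }
  obtain ⟨θ, hinj, hθ, hrange⟩ := hlift.exists_algHom
  refine ⟨⟨θ, hinj, hθ, hrange, hrange.trans (closureIn_eq hf hΔ)⟩, fun J₀ g₀ hg₀ => ?_⟩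
  obtain ⟨e, he⟩ := exists_algEquiv_of_range_eq (evalBar f _ g₀) θ hinj
    ((hg₀.range_evalBar hlift.led hf).trans hrange.symm)
  exact ⟨e, fun p r hp => hinj (((he p).trans hp).trans (hθ r).symm)⟩
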